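/- Let $\Gamma$ be any index set and let $\ell_2(\Gamma)$ be the complex Hilbert space with canonical basis $(e_j)_{j\in\Gamma}$. For $1<p<\infty$ let $S_p(\Gamma)$ be the Schatten class of bounded operators $A$ on $\ell_2(\Gamma)$ with $\|A\|_{S_p}=(\mathrm{tr}\,|A|^p)^{1/p}<\infty$, and write $A_{jk}=\langle e_j, A e_k\rangle$ (inner product linear in the second variable). A symbol $M\colon\Gamma\times\Gamma\to\mathbf{C}$ defines a completely bounded Schur multiplier on $S_p(\Gamma)$ if $S_M\colon (A_{jk})\mapsto (M(j,k)A_{jk})$ is a well-defined bounded map $S_p(\Gamma)\to S_p(\Gamma)$ and $S_M\otimes \mathrm{id}$, i.e. the Schur multiplier with symbol $((j,a),(k,b))\mapsto M(j,k)$, is bounded on $S_p(\Gamma\times I)$ for every countable index set $I$, with a bound that does not depend on $I$. Let $\mathcal{H}$ be a real or complex Hilbert space, let $u_j,u'_j,w_j,w'_j$ ($j\in\Gamma$) be arbitrary vectors in $\mathcal{H}$ and let $\Lambda\colon\mathcal{H}\to\mathcal{H}$ be a linear contraction ($\|\Lambda\|\le 1$). Then, for every $1<p<\infty$, the symbol $$M(j,k)=\Big\langle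 \frac{u_j+u'_k}{\|u_j+u'_k\|},\ \Lambda\Big(\frac{w_j+w'_k}{\|w_j+w'_k\|}\Big)\Big\rangle,$$ where $x/\|x\|$ is understood as $0$ for $x=0$, defines a completely bounded Schur multiplier on $S_p(\Gamma)$. -/

import Mathlib

open scoped ENNReal NNReal

noncomputable section

/-- The complex Hilbert space `ℓ²(Γ)`. -/
abbrev EllTwo (Γ : Type*) : Type _ := lp (fun _ : Γ => ℂ) 2

open Classical in
/-- The canonical basis vector `e_k` of `ℓ²(Γ)`. -/
def basisVec {Γ : Type*} (k : Γ) : EllTwo Γ := lp.single 2 k (1 : ℂ)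

/-- The matrix entry (kernel) `A_{j,k} = ⟨e_j, A e_k⟩`, that is, the `j`-th coordinate of `A e_k`. -/
def matrixEntry {Γ : Type*} (A : EllTwo Γ →L[ℂ] EllTwo Γ) (j k : Γ) : ℂ := A (basisVec k) j

/-- The trace of a positive operator on `ℓ²(Γ)`: the sum of its (nonnegative) diagonal entries,
with values in `[0, ∞]`. -/
def positiveTrace {Γ : Type*} (T : EllTwo Γ →L[ℂ] EllTwo Γ) : ℝ≥0∞ :=
  ∑' j, ENNReal.ofReal (matrixEntry T j j).re

/-- The operator `|A|^p` on a complex Hilbert space, where `|A| = (A* A)^{1/2}` and its power are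
given by the continuous functional calculus. -/
def absPow {E : Type*} [NormedAddCommGroup E] [InnerProductSpace ℂ E] [CompleteSpace E]
    (p : ℝ) (A : E →L[ℂ] E) : E →L[ℂ] E :=
  CFC.abs A ^ p

/-- The Schatten norm `‖A‖_{S_p} = (tr |A|^p)^{1/p}`, with values in `[0, ∞]`. -/
def schattenNorm {Γ : Type*} (p : ℝ) (A : EllTwo Γ →L[ℂ] EllTwo Γ) : ℝ≥0∞ :=
  positiveTrace (absPow p A) ^ (1 / p)

/-- The Schatten class `S_p(Γ)`: the bounded operators on `ℓ²(Γ)` with finite `S_p`-norm. -/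
def schattenClass (Γ : Type*) (p : ℝ) : Set (EllTwo Γ →L[ℂ] EllTwo Γ) :=
  {A | schattenNorm p A < ∞}

/-- `B` is the Schur product of the symbol `M` with `A`: its matrix is `M(j,k) A_{j,k}`. -/
def IsSchurProduct {Γ : Type*} (M : Γ → Γ → ℂ) (A B : EllTwo Γ →L[ℂ] EllTwo Γ) : Prop :=
  ∀ j k, matrixEntry B j k = M j k * matrixEntry A j k

/-- `M` defines a Schur multiplier `S_M : S_p(Γ) → S_p(Γ)`, bounded with norm at most `C`.
Operators are determined by their matrices, so `S_M` is unique and it is automatically linear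
(see `IsSchurProduct.unique`, `IsSchurProduct.add`, `IsSchurProduct.smul`). -/
def SchurBoundedBy {Γ : Type*} (p : ℝ) (M : Γ → Γ → ℂ) (C : ℝ≥0) : Prop :=
  ∃ S : schattenClass Γ p → schattenClass Γ p,
    (∀ A, IsSchurProduct M A.1 (S A).1) ∧
    ∀ A, schattenNorm p (S A).1 ≤ C * schattenNorm p A.1

/-- The symbol on `Γ × ι` of the amplification `S_M ⊗ id`
(see `IsSchurProduct.amplify`). -/
def amplifySymbol {Γ : Type*} (M : Γ → Γ → ℂ) (ι : Type*) : Γ × ι → Γ × ι → ℂ :=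
  fun x y => M x.1 y.1

/-- `M` defines a completely bounded Schur multiplier on `S_p(Γ)`: the multiplier `S_M` is bounded
on `S_p(Γ)`, and `S_M ⊗ id` extends to bounded maps on `S_p(Γ × ι)`, with a common
bound, for all countable index sets `ι`. -/
def IsCompletelyBoundedSchurMultiplier {Γ : Type*} (p : ℝ) (M : Γ → Γ → ℂ) : Prop :=
  (∃ C : ℝ≥0, SchurBoundedBy p M C) ∧
  ∃ C : ℝ≥0, ∀ (ι : Type) [Countable ι], SchurBoundedBy p (amplifySymbol M ι) C

/-- The Grothendieck-type symbol
`M(j,k) = ⟨(u_j + u'_k)/‖u_j + u'_k‖, Λ ((w_j + w'_k)/‖w_j + w'_k‖)⟩`, where `x/‖x‖` is read as `0`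
when `x = 0`. The scalar field is `ℝ` or `ℂ`; `RCLike.map` is the inclusion into `ℂ`. -/
def grothendieckSymbol {𝕜 : Type*} [RCLike 𝕜] {H : Type*} [NormedAddCommGroup H]
    [InnerProductSpace 𝕜 H] {Γ : Type*} (u u' w w' : Γ → H) (Λ : H →L[𝕜] H) (j k : Γ) : ℂ :=
  RCLike.map 𝕜 ℂ (inner 𝕜 (((‖u j + u' k‖⁻¹ : ℝ) : 𝕜) • (u j + u' k))
    (Λ (((‖w j + w' k‖⁻¹ : ℝ) : 𝕜) • (w j + w' k))))

/-- An operator on `ℓ²(Γ)` is determined by its matrix. -/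
theorem eq_of_matrixEntry {Γ : Type*} {A B : EllTwo Γ →L[ℂ] EllTwo Γ}
    (h : ∀ j k, matrixEntry A j k = matrixEntry B j k) : A = B := by
  classical
  ext1 f
  have hf := lp.hasSum_single (p := 2) (by simp) f
  have key : ∀ k, A (lp.single 2 k (f k)) = B (lp.single 2 k (f k)) := by
    intro k
    have e : lp.single (E := fun _ : Γ => ℂ) 2 k (f k) = f k • basisVec k := by
      have := lp.single_smul (E := fun _ : Γ => ℂ) 2 k (f k) (1 : ℂ)
      rw [smul_eq_mul, mul_one] at this
      rw [this, basisVec]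
    rw [e, map_smul, map_smul]
    congr 1
    apply lp.ext
    funext j
    exact h j k
  have hA := A.hasSum hf
  have hB := B.hasSum hf
  simp only [key] at hA
  exact hA.unique hB

theorem IsSchurProduct.unique {Γ : Type*} {M : Γ → Γ → ℂ} {A B B' : EllTwo Γ →L[ℂ] EllTwo Γ}
    (h : IsSchurProduct M A B) (h' : IsSchurProduct M A B') : B = B' :=
  eq_of_matrixEntry fun j k => (h j k).trans (h' j k).symm

theorem IsSchurProduct.add {Γ : Type*} {M : Γ → Γ → ℂ} {A A' B B' : EllTwo Γ →L[ℂ] EllTwo Γ}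
    (h : IsSchurProduct M A B) (h' : IsSchurProduct M A' B') :
    IsSchurProduct M (A + A') (B + B') := by
  intro j k
  have h1 := h j k
  have h2 := h' j k
  simp only [matrixEntry] at h1 h2
  simp [matrixEntry, h1, h2, mul_add]

theorem IsSchurProduct.smul {Γ : Type*} {M : Γ → Γ → ℂ} {A B : EllTwo Γ →L[ℂ] EllTwo Γ} (c : ℂ)
    (h : IsSchurProduct M A B) : IsSchurProduct M (c • A) (c • B) := by
  intro j k
  have h1 := h j k
  simp only [matrixEntry] at h1
  simp [matrixEntry, h1, mul_left_comm]

/-- `T` is the elementary tensor `A ⊗ B`, as an operator on `ℓ²(Γ × ι) = ℓ²(Γ) ⊗ ℓ²(ι)`. -/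
def IsElementaryTensor {Γ ι : Type*} (A : EllTwo Γ →L[ℂ] EllTwo Γ) (B : EllTwo ι →L[ℂ] EllTwo ι)
    (T : EllTwo (Γ × ι) →L[ℂ] EllTwo (Γ × ι)) : Prop :=
  ∀ x y, matrixEntry T x y = matrixEntry A x.1 y.1 * matrixEntry B x.2 y.2

/-- The Schur multiplier with the amplified symbol maps `A ⊗ B` to `S_M(A) ⊗ B`, so it is
`S_M ⊗ id`. -/
theorem IsSchurProduct.amplify {Γ ι : Type*} {M : Γ → Γ → ℂ} {A A' : EllTwo Γ →L[ℂ] EllTwo Γ}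
    {B : EllTwo ι →L[ℂ] EllTwo ι} {T T' : EllTwo (Γ × ι) →L[ℂ] EllTwo (Γ × ι)}
    (hA : IsSchurProduct M A A') (hT : IsElementaryTensor A B T)
    (hT' : IsElementaryTensor A' B T') : IsSchurProduct (amplifySymbol M ι) T T' := by
  intro x y
  rw [hT' x y, hT x y, hA, amplifySymbol, mul_assoc]

end

set_option linter.unusedSectionVars false

noncomputable section


namespace SchurMultiplier

open Matrix
open scoped ComplexOrder

/-! ### Trace inequalities for Hermitian matrices via joint spectral weights -/

section Spectral

variable {ι : Type*} [Fintype ι] [DecidableEq ι]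

/-! Averaging over directions reduces the symbol to signs of linear forms. For a standard
Gaussian-type vector `x` on a finite-dimensional real space, `∫ sgn⟪ξ,x⟫ ⟪η,x⟫ = c ⟪ξ/‖ξ‖, η⟫`, with
`c ≥ 1/(4π)` in every dimension (`exists_integral_sgn_mul`). For fixed `x`, the symbol `sgn⟪u_j +
u'_k, x⟫` compares the numbers `⟪u_j, x⟫` and `-⟪u'_k, x⟫`; it is a generalized triangular
truncation, bounded on Schatten classes by Cotlar's identity (`schattenPow_orderSymbol_le`),
uniformly in `x`.

The representation is used twice. Let `S(x)` be the truncation of a Hermitian `A` by the signs of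
`⟪w_j + w_k, x⟫`. The coefficients of `S` against `⟪L* e_i, x⟫` are `b_i = c⟪e_i, L(unit(w_j +
w_k))⟫ A_jk`. Bessel's inequality bounds their square function by `S` (`trace_sum_sq_pow_le`), and
the noncommutative Khintchine inequality (`integral_schattenPow_gaussSum_le`) then bounds the
Gaussian sum `X(x) = ∑ ⟪e_i, x⟫ b_i`. Truncating `X(x)` by the signs of `⟪u_j + u_k, x⟫` and
averaging gives `c²` times the required Schur product. A Hermitian dilation removes the symmetry
assumption, and splitting into real and imaginary parts handles complex scalars.

The estimates are made at exponents `q = 2^(k+1)`, where Schatten norms are traces of integer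
powers. Most follow one scheme: Young's inequality with a small coefficient on the unknown trace,
which is finite and can be absorbed. The transposed symbol has the same form, so duality gives the
conjugate exponent, and the three lines theorem reaches every `p` between `q'` and `q`
(`exists_interpolation_const`).

All constants depend only on `p`. Finite sections therefore pass to `ℓ²(Γ)` by lower semicontinuity
of the trace (`positiveTrace_absPow_le_of_compressions`). Complete boundedness costs nothing: the
amplified symbol is again of Grothendieck type, over `Γ × ι`. -/

theorem exists_unitary_diagonal {X : Matrix ι ι ℂ} (hX : X.IsHermitian) :
    ∃ (U : Matrix ι ι ℂ) (l : ι → ℝ), Uᴴ * U = 1 ∧ U * Uᴴ = 1 ∧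
      X = U * diagonal (fun i => (l i : ℂ)) * Uᴴ ∧ (X.PosSemidef → ∀ i, 0 ≤ l i) := by
  refine ⟨hX.eigenvectorUnitary, hX.eigenvalues, ?_, ?_, ?_, fun h => h.eigenvalues_nonneg⟩
  · have := Unitary.star_mul_self_of_mem hX.eigenvectorUnitary.2
    rwa [star_eq_conjTranspose] at this
  · have := Unitary.mul_star_self_of_mem hX.eigenvectorUnitary.2
    rwa [star_eq_conjTranspose] at this
  · conv_lhs => rw [hX.spectral_theorem]
    rw [Unitary.conjStarAlgAut_apply, star_eq_conjTranspose]
    rfl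

theorem unitary_conj_diagonal_pow {κ : Type*} [Fintype κ] [DecidableEq κ] {U : Matrix ι κ ℂ}
    (hU : Uᴴ * U = 1) (l : κ → ℂ) (n : ℕ) :
    (U * diagonal l * Uᴴ) ^ (n + 1) = U * diagonal (fun i => l i ^ (n + 1)) * Uᴴ := by
  induction n with
  | zero => simp
  | succ n ih =>
    rw [pow_succ, ih]
    calc U * diagonal (fun i => l i ^ (n + 1)) * Uᴴ * (U * diagonal l * Uᴴ)
        = U * (diagonal (fun i => l i ^ (n + 1)) * (Uᴴ * U) * diagonal l) * Uᴴ := by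
          simp only [Matrix.mul_assoc]
      _ = _ := by
          rw [hU, Matrix.mul_one, diagonal_mul_diagonal]
          simp only [pow_succ]

/-- The squared moduli of the entries of `Uᴴ V` act as a nonnegative joint weight for the two
spectra. This is what lets scalar inequalities in two variables pass to traces of noncommuting
matrices. -/
theorem trace_unitary_conj (U V : Matrix ι ι ℂ) (a b : ι → ℝ) :
    trace ((U * diagonal (fun i => (a i : ℂ)) * Uᴴ) * (V * diagonal (fun i => (b i : ℂ)) * Vᴴ)) =
      ((∑ i, ∑ j, Complex.normSq ((Uᴴ * V) i j) * a i * b j : ℝ) : ℂ) := by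
  have h : trace ((U * diagonal (fun i => (a i : ℂ)) * Uᴴ) *
        (V * diagonal (fun i => (b i : ℂ)) * Vᴴ)) =
      trace (diagonal (fun i => (a i : ℂ)) * (Uᴴ * V) *
        (diagonal (fun i => (b i : ℂ)) * (Uᴴ * V)ᴴ)) := by
    rw [conjTranspose_mul, conjTranspose_conjTranspose, Matrix.mul_assoc U, Matrix.mul_assoc U,
      trace_mul_comm U]
    simp only [Matrix.mul_assoc]
  rw [h]
  rw [trace]
  push_cast
  refine Finset.sum_congr rfl fun i _ => ?_
  rw [diag_apply, Matrix.mul_apply]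
  refine Finset.sum_congr rfl fun j _ => ?_
  rw [diagonal_mul, diagonal_mul, conjTranspose_apply,
    Complex.normSq_eq_conj_mul_self, Complex.star_def]
  ring

/-- Joint spectral weights of a pair of Hermitian matrices. -/
theorem exists_joint_weights {X Y : Matrix ι ι ℂ} (hX : X.IsHermitian) (hY : Y.IsHermitian) :
    ∃ (D : ι → ι → ℝ) (l m : ι → ℝ), (∀ i j, 0 ≤ D i j) ∧ (X.PosSemidef → ∀ i, 0 ≤ l i) ∧
      (Y.PosSemidef → ∀ i, 0 ≤ m i) ∧
      ∀ a b : ℕ, (trace (X ^ a * Y ^ b)).re = ∑ i, ∑ j, D i j * l i ^ a * m j ^ b := by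
  obtain ⟨U, l, hU, hU', hXU, hl⟩ := exists_unitary_diagonal hX
  obtain ⟨V, m, hV, hV', hYV, hm⟩ := exists_unitary_diagonal hY
  have key : ∀ {Z W : Matrix ι ι ℂ} {d : ι → ℝ}, Wᴴ * W = 1 → W * Wᴴ = 1 →
      Z = W * diagonal (fun i => (d i : ℂ)) * Wᴴ → ∀ n : ℕ,
      Z ^ n = W * diagonal (fun i => ((d i ^ n : ℝ) : ℂ)) * Wᴴ := by
    intro Z W d h1 h2 h3 n
    cases n with
    | zero => simp [h2]
    | succ n => rw [h3, unitary_conj_diagonal_pow h1]; simp only [Complex.ofReal_pow]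
  refine ⟨fun i j => Complex.normSq ((Uᴴ * V) i j), l, m, fun i j => Complex.normSq_nonneg _,
    hl, hm, fun a b => ?_⟩
  rw [key hU hU' hXU a, key hV hV' hYV b, trace_unitary_conj, Complex.ofReal_re]

/-- A polynomial inequality in two real variables passes to traces of Hermitian matrices. -/
theorem trace_young_psd {P Z : Matrix ι ι ℂ} (hP : P.PosSemidef) (hZ : Z.PosSemidef)
    (n : ℕ) {ε : ℝ} (hε : 0 < ε) :
    (trace (P ^ n * Z)).re ≤ ε * (trace (P ^ (n + 1))).re +
      (ε ^ n)⁻¹ * (trace (Z ^ (n + 1))).re := by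
  obtain ⟨D, l, m, hD, hl, hm, h⟩ := exists_joint_weights hP.1 hZ.1
  have h1 := h n 1
  have h2 := h (n + 1) 0
  have h3 := h 0 (n + 1)
  simp only [pow_one, pow_zero, mul_one, one_mul] at h1 h2 h3
  rw [h1, h2, h3]
  simp only [Finset.mul_sum, ← Finset.sum_add_distrib]
  refine Finset.sum_le_sum fun i _ => Finset.sum_le_sum fun j _ => ?_
  have hl := hl hP i
  have hm := hm hZ j
  -- Young's inequality without sharp constants: compare `m` with `ε l` and bound the product by
  -- whichever term dominates.
  have : l i ^ n * m j ≤ ε * l i ^ (n + 1) + (ε ^ n)⁻¹ * m j ^ (n + 1) := by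
    rcases le_total (m j) (ε * l i) with hc | hc
    · calc l i ^ n * m j ≤ l i ^ n * (ε * l i) := by gcongr
        _ = ε * l i ^ (n + 1) := by ring
        _ ≤ _ := le_add_of_nonneg_right (by positivity)
    · calc l i ^ n * m j = (ε ^ n)⁻¹ * ((ε * l i) ^ n * m j) := by
            rw [mul_pow]; field_simp
        _ ≤ (ε ^ n)⁻¹ * ((m j) ^ n * m j) := by gcongr
        _ = (ε ^ n)⁻¹ * m j ^ (n + 1) := by ring
        _ ≤ _ := le_add_of_nonneg_left (by positivity)
  nlinarith [mul_le_mul_of_nonneg_left this (hD i j)]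

/-- Eigenvalues may be negative here; evenness of `n + 1` makes the two pure powers insensitive to
sign, so the scalar inequality for absolute values suffices. -/
theorem trace_young_hermitian {X Y : Matrix ι ι ℂ} (hX : X.IsHermitian) (hY : Y.IsHermitian)
    (n : ℕ) (hn : Even (n + 1)) {ε : ℝ} (hε : 0 < ε) :
    |(trace (X ^ n * Y)).re| ≤ ε * (trace (X ^ (n + 1))).re +
      (ε ^ n)⁻¹ * (trace (Y ^ (n + 1))).re := by
  obtain ⟨D, l, m, hD, hl, hm, h⟩ := exists_joint_weights hX hY
  have h1 := h n 1
  have h2 := h (n + 1) 0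
  have h3 := h 0 (n + 1)
  simp only [pow_one, pow_zero, mul_one, one_mul] at h1 h2 h3
  rw [h1, h2, h3]
  simp only [Finset.mul_sum, ← Finset.sum_add_distrib]
  refine (Finset.abs_sum_le_sum_abs _ _).trans (Finset.sum_le_sum fun i _ => ?_)
  refine (Finset.abs_sum_le_sum_abs _ _).trans (Finset.sum_le_sum fun j _ => ?_)
  have : |l i| ^ n * |m j| ≤ ε * |l i| ^ (n + 1) + (ε ^ n)⁻¹ * |m j| ^ (n + 1) := by
    rcases le_total (|m j|) (ε * |l i|) with hc | hc
    · calc |l i| ^ n * |m j| ≤ |l i| ^ n * (ε * |l i|) := by gcongr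
        _ = ε * |l i| ^ (n + 1) := by ring
        _ ≤ _ := le_add_of_nonneg_right (by positivity)
    · calc |l i| ^ n * |m j| = (ε ^ n)⁻¹ * ((ε * |l i|) ^ n * |m j|) := by
            rw [mul_pow]; field_simp
        _ ≤ (ε ^ n)⁻¹ * (|m j| ^ n * |m j|) := by gcongr
        _ = (ε ^ n)⁻¹ * |m j| ^ (n + 1) := by ring
        _ ≤ _ := le_add_of_nonneg_left (by positivity)
  rw [hn.pow_abs, hn.pow_abs] at this
  rw [abs_mul, abs_mul, abs_pow, abs_of_nonneg (hD i j)]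
  nlinarith [mul_le_mul_of_nonneg_left this (hD i j)]

/-- For Hermitian `b` and `X`, splitting an even power of `X` between the two factors `b` decreases
the trace. -/
theorem trace_split_pow_le {b X : Matrix ι ι ℂ} (hb : b.IsHermitian) (hX : X.IsHermitian)
    {k l : ℕ} (hkl : Even (k + l)) :
    (trace (b * X ^ k * b * X ^ l)).re ≤ (trace (b * b * X ^ (k + l))).re := by
  obtain ⟨U, d, hU, hU', hXU, -⟩ := exists_unitary_diagonal hX
  have key : ∀ n : ℕ, X ^ n = U * diagonal (fun i => ((d i ^ n : ℝ) : ℂ)) * Uᴴ := by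
    intro n
    cases n with
    | zero => simp [hU']
    | succ n => rw [hXU, unitary_conj_diagonal_pow hU]; simp only [Complex.ofReal_pow]
  set c : Matrix ι ι ℂ := Uᴴ * b * U with hc
  have hcH : cᴴ = c := by
    simp [hc, conjTranspose_mul, hb.eq, Matrix.mul_assoc]
  have e1 : ∀ k l : ℕ, (trace (b * X ^ k * b * X ^ l)).re =
      ∑ i, ∑ j, Complex.normSq (c i j) * (d j ^ k * d i ^ l) := by
    intro k l
    have : trace (b * X ^ k * b * X ^ l) =
        trace (c * diagonal (fun i => ((d i ^ k : ℝ) : ℂ)) *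
          (c * diagonal (fun i => ((d i ^ l : ℝ) : ℂ)))) := by
      rw [key, key, hc]
      have := trace_mul_comm Uᴴ (b * U * diagonal (fun i => ((d i ^ k : ℝ) : ℂ)) * Uᴴ * b * U *
        diagonal (fun i => ((d i ^ l : ℝ) : ℂ)))
      simp only [Matrix.mul_assoc] at this ⊢
      exact this.symm
    rw [this]
    have e2 : ∀ i j, c j i = star (c i j) := fun i j => by
      conv_lhs => rw [← hcH, conjTranspose_apply]
    rw [trace, Complex.re_sum]
    refine Finset.sum_congr rfl fun i _ => ?_
    rw [diag_apply, Matrix.mul_apply, Complex.re_sum]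
    refine Finset.sum_congr rfl fun j _ => ?_
    rw [mul_diagonal, mul_diagonal, e2 i j]
    have : c i j * ((d j ^ k : ℝ) : ℂ) * (star (c i j) * ((d i ^ l : ℝ) : ℂ)) =
      ((Complex.normSq (c i j) * (d j ^ k * d i ^ l) : ℝ) : ℂ) := by
      push_cast
      rw [Complex.normSq_eq_conj_mul_self, Complex.star_def]
      ring
    rw [this, Complex.ofReal_re]
  have e3 := e1 0 (k + l)
  have e4 := e1 (k + l) 0
  rw [pow_zero, Matrix.mul_one] at e3
  have e5 : trace (b * X ^ (k + l) * b * X ^ 0) = trace (b * b * X ^ (k + l)) := by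
    rw [pow_zero, Matrix.mul_one, trace_mul_comm, Matrix.mul_assoc]
  rw [e5] at e4
  have e6 : (trace (b * X ^ k * b * X ^ l)).re = (trace (b * X ^ l * b * X ^ k)).re := by
    rw [Matrix.mul_assoc (b * X ^ k), trace_mul_comm, ← Matrix.mul_assoc]
  -- The left side is symmetric in `k` and `l`, so it may be averaged with its swap. In an
  -- eigenbasis of `X` the claim becomes `d_j^k d_i^l + d_j^l d_i^k ≤ d_i^(k+l) + d_j^(k+l)`, which
  -- holds for real `d` because `k + l` is even.
  have e7 : (trace (b * X ^ k * b * X ^ l)).re + (trace (b * X ^ l * b * X ^ k)).re ≤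
      (trace (b * b * X ^ (k + l))).re + (trace (b * b * X ^ (k + l))).re := by
    nth_rewrite 1 [e3]
    rw [e4, e1, e1, ← Finset.sum_add_distrib, ← Finset.sum_add_distrib]
    refine Finset.sum_le_sum fun i _ => ?_
    rw [← Finset.sum_add_distrib, ← Finset.sum_add_distrib]
    refine Finset.sum_le_sum fun j _ => ?_
    have h1 : d j ^ k * d i ^ l + d j ^ l * d i ^ k ≤ d i ^ (k + l) + d j ^ (k + l) := by
      rw [← hkl.pow_abs, ← hkl.pow_abs (d j)]
      have h1 : d j ^ k * d i ^ l ≤ |d j| ^ k * |d i| ^ l := by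
        rw [← abs_pow, ← abs_pow, ← abs_mul]; exact le_abs_self _
      have h1' : d j ^ l * d i ^ k ≤ |d j| ^ l * |d i| ^ k := by
        rw [← abs_pow, ← abs_pow, ← abs_mul]; exact le_abs_self _
      have ha := abs_nonneg (d j)
      have hb := abs_nonneg (d i)
      rw [pow_add, pow_add]
      rcases le_total |d i| |d j| with h | h
      · nlinarith [mul_nonneg (sub_nonneg.2 (pow_le_pow_left₀ hb h k))
          (sub_nonneg.2 (pow_le_pow_left₀ hb h l))]
      · nlinarith [mul_nonneg (sub_nonneg.2 (pow_le_pow_left₀ ha h k))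
          (sub_nonneg.2 (pow_le_pow_left₀ ha h l))]
    have := mul_le_mul_of_nonneg_left h1 (Complex.normSq_nonneg (c i j))
    simp only [pow_zero]
    linarith
  linarith

theorem trace_mul_re_nonneg {P Z : Matrix ι ι ℂ} (hP : P.PosSemidef) (hZ : Z.PosSemidef) :
    0 ≤ (trace (P * Z)).re := by
  obtain ⟨D, l, m, hD, hl, hm, h⟩ := exists_joint_weights hP.1 hZ.1
  have h1 := h 1 1
  simp only [pow_one] at h1
  rw [h1]
  exact Finset.sum_nonneg fun i _ => Finset.sum_nonneg fun j _ =>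
    mul_nonneg (mul_nonneg (hD i j) (hl hP i)) (hm hZ j)

theorem exists_eq_conjTranspose_mul_self {P : Matrix ι ι ℂ} (hP : P.PosSemidef) :
    ∃ G : Matrix ι ι ℂ, P = Gᴴ * G := by
  obtain ⟨U, l, -, -, h, hl⟩ := exists_unitary_diagonal hP.1
  refine ⟨diagonal (fun i => (Real.sqrt (l i) : ℂ)) * Uᴴ, ?_⟩
  rw [conjTranspose_mul, conjTranspose_conjTranspose, diagonal_conjTranspose, Matrix.mul_assoc,
    ← Matrix.mul_assoc (diagonal _), diagonal_mul_diagonal, ← Matrix.mul_assoc]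
  conv_lhs => rw [h]
  congr 3
  ext i
  rw [Pi.star_apply, Complex.star_def, Complex.conj_ofReal, ← Complex.ofReal_mul,
    Real.mul_self_sqrt (hl hP i)]

end Spectral

end SchurMultiplier


namespace SchurMultiplier

open Matrix
open scoped ComplexOrder

/-! ### Schatten powers at dyadic exponents: Hölder, quasi-triangle inequality, dilation -/

section SchattenPow

variable {ι : Type*} [Fintype ι] [DecidableEq ι]

/-- The quantity `tr (A* A)^(2^k)`, that is, `‖A‖_q^q` in the Schatten norm with `q = 2^(k+1)`. -/
def schattenPow (k : ℕ) (A : Matrix ι ι ℂ) : ℝ := (trace ((Aᴴ * A) ^ (2 ^ k))).re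

theorem schattenPow_nonneg (k : ℕ) (A : Matrix ι ι ℂ) : 0 ≤ schattenPow k A :=
  (Complex.nonneg_iff.1 ((posSemidef_conjTranspose_mul_self A).pow _).trace_nonneg).1

theorem schattenPow_zero_eq (A : Matrix ι ι ℂ) : schattenPow 0 A = ∑ i, ∑ j, ‖A i j‖ ^ 2 := by
  rw [schattenPow, pow_zero, pow_one, trace_mul_comm, trace, Complex.re_sum]
  refine Finset.sum_congr rfl fun i _ => ?_
  rw [diag_apply, Matrix.mul_apply, Complex.re_sum]
  refine Finset.sum_congr rfl fun j _ => ?_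
  rw [conjTranspose_apply, Complex.star_def, Complex.mul_conj, Complex.ofReal_re,
    Complex.normSq_eq_norm_sq]

theorem schattenPow_succ (k : ℕ) (A : Matrix ι ι ℂ) :
    schattenPow (k + 1) A = schattenPow k (Aᴴ * A) := by
  rw [schattenPow, schattenPow, conjTranspose_mul, conjTranspose_conjTranspose, pow_succ' 2 k,
    pow_mul, pow_two]

theorem schattenPow_of_isHermitian (k : ℕ) {A : Matrix ι ι ℂ} (hA : A.IsHermitian) :
    schattenPow k A = (trace (A ^ (2 ^ (k + 1)))).re := by
  rw [schattenPow, hA.eq, pow_succ' 2 k, pow_mul, pow_two A]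

/-- The intertwining `(A Aᴴ)^n A = A (Aᴴ A)^n` and cyclicity of the trace exchange `A Aᴴ` and `Aᴴ
A`; the power is written as `n + 1` to have a factor to move. -/
theorem schattenPow_conjTranspose (k : ℕ) (A : Matrix ι ι ℂ) :
    schattenPow k Aᴴ = schattenPow k A := by
  obtain ⟨n, hn⟩ : ∃ n, 2 ^ k = n + 1 := Nat.exists_eq_succ_of_ne_zero (by positivity)
  rw [schattenPow, schattenPow, conjTranspose_conjTranspose, hn]
  have : ∀ n : ℕ, (A * Aᴴ) ^ n * A = A * (Aᴴ * A) ^ n := by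
    intro n
    induction n with
    | zero => simp
    | succ n ih =>
      rw [pow_succ', Matrix.mul_assoc, ih, pow_succ']
      simp only [Matrix.mul_assoc]
  rw [pow_succ, ← Matrix.mul_assoc, this, pow_succ', Matrix.mul_assoc, Matrix.mul_assoc,
    trace_mul_comm]
  simp only [Matrix.mul_assoc]
  rw [trace_mul_comm]
  simp only [Matrix.mul_assoc]

/-- Cauchy–Schwarz for the Hilbert–Schmidt inner product, the base case of the dyadic induction. -/
theorem norm_trace_mul_sq_le (X Y : Matrix ι ι ℂ) :
    ‖trace (X * Y)‖ ^ 2 ≤ schattenPow 0 X * schattenPow 0 Y := by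
  rw [← schattenPow_conjTranspose 0 Y, schattenPow_zero_eq, schattenPow_zero_eq,
    ← Finset.sum_product', ← Finset.sum_product']
  refine le_trans ?_ (Finset.sum_mul_sq_le_sq_mul_sq (Finset.univ ×ˢ Finset.univ)
    (fun p : ι × ι => ‖X p.1 p.2‖) (fun p => ‖Yᴴ p.1 p.2‖))
  refine pow_le_pow_left₀ (norm_nonneg _) ?_ 2
  rw [Finset.sum_product, trace]
  refine (norm_sum_le _ _).trans (Finset.sum_le_sum fun i _ => ?_)
  rw [diag_apply, Matrix.mul_apply]
  refine (norm_sum_le _ _).trans (Finset.sum_le_sum fun j _ => ?_)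
  rw [norm_mul, conjTranspose_apply, norm_star]

/-- Trace inequalities for the dyadic Schatten classes, by simultaneous induction. -/
theorem norm_trace_pow_le_and_schattenPow_mul_sq_le (k : ℕ) :
    (∀ Z : Matrix ι ι ℂ, ‖trace (Z ^ (2 ^ (k + 1)))‖ ≤ schattenPow k Z) ∧
    ∀ X Y : Matrix ι ι ℂ, schattenPow k (X * Y) ^ 2 ≤ schattenPow (k + 1) X *
      schattenPow (k + 1) Y := by
  -- Cyclicity turns powers of `(XY)ᴴ(XY)` into powers of the product of the positive matrices `XᴴX`
  -- and `YYᴴ`.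
  have cyc : ∀ (X Y : Matrix ι ι ℂ) (n : ℕ), trace (((X * Y)ᴴ * (X * Y)) ^ n) =
      trace ((Xᴴ * X * (Y * Yᴴ)) ^ n) := by
    intro X Y n
    cases n with
    | zero => simp
    | succ n =>
      have : ∀ n : ℕ, ((X * Y)ᴴ * (X * Y)) ^ n * Yᴴ = Yᴴ * (Xᴴ * X * (Y * Yᴴ)) ^ n := by
        intro n
        induction n with
        | zero => simp
        | succ n ih =>
          rw [pow_succ', Matrix.mul_assoc, ih, pow_succ', conjTranspose_mul]
          simp only [Matrix.mul_assoc]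
      rw [pow_succ]
      nth_rewrite 2 [conjTranspose_mul]
      rw [Matrix.mul_assoc, ← Matrix.mul_assoc, this, Matrix.mul_assoc, trace_mul_comm, pow_succ]
      simp only [Matrix.mul_assoc]
  induction k with
  | zero =>
    constructor
    · intro Z
      have := norm_trace_mul_sq_le Z Z
      rw [← pow_two, ← pow_two] at this
      simpa using (pow_le_pow_iff_left₀ (norm_nonneg _) (schattenPow_nonneg _ _) two_ne_zero).1 this
    · intro X Y
      rw [schattenPow, cyc, pow_zero, pow_one, schattenPow_succ,
        ← schattenPow_conjTranspose (0 + 1) Y, schattenPow_succ, conjTranspose_conjTranspose]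
      refine le_trans ?_ (norm_trace_mul_sq_le _ _)
      rw [← sq_abs]
      exact pow_le_pow_left₀ (abs_nonneg _) (Complex.abs_re_le_norm _) 2
  | succ k ih =>
    obtain ⟨iha, ihb⟩ := ih
    constructor
    -- `Z^(2^(k+2))` is `(Z²)^(2^(k+1))`: the trace bound at level `k` followed by the product bound
    -- for `Z · Z` gives level `k + 1`.
    · intro Z
      rw [pow_succ' 2 (k + 1), pow_mul]
      refine (iha _).trans ?_
      have := ihb Z Z
      rw [← pow_two, ← pow_two] at this
      exact (pow_le_pow_iff_left₀ (schattenPow_nonneg _ _) (schattenPow_nonneg _ _)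
        two_ne_zero).1 this
    · intro X Y
      rw [schattenPow_succ (k + 1) X, ← schattenPow_conjTranspose (k + 1 + 1) Y,
        schattenPow_succ (k + 1) Yᴴ, conjTranspose_conjTranspose]
      refine le_trans ?_ (ihb _ _)
      refine pow_le_pow_left₀ (schattenPow_nonneg _ _) ?_ 2
      -- Here the trace bound is applied to the non-Hermitian matrix `XᴴX · YYᴴ`, which is why it is
      -- needed for arbitrary `Z`.
      refine le_trans ?_ (iha _)
      rw [schattenPow, cyc]
      exact Complex.re_le_norm _

/-- Hölder's inequality combined with a weighted arithmetic–geometric mean. The free `ε` allows one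
of the two terms to be absorbed later. -/
theorem schattenPow_mul_le (k : ℕ) (X Y : Matrix ι ι ℂ) {ε : ℝ} (hε : 0 < ε) :
    schattenPow k (X * Y) ≤ ε⁻¹ * schattenPow (k + 1) X + ε * schattenPow (k + 1) Y := by
  have h := (norm_trace_pow_le_and_schattenPow_mul_sq_le k).2 X Y
  have hx := schattenPow_nonneg (k + 1) X
  have hy := schattenPow_nonneg (k + 1) Y
  refine abs_le_of_sq_le_sq' ?_ (by positivity) |>.2
  refine h.trans ?_
  have : ε⁻¹ * ε = 1 := inv_mul_cancel₀ hε.ne'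
  nlinarith [sq_nonneg (ε⁻¹ * schattenPow (k + 1) X - ε * schattenPow (k + 1) Y),
    mul_nonneg hx hy]

theorem schattenPow_smul (k : ℕ) (c : ℂ) (A : Matrix ι ι ℂ) :
    schattenPow k (c • A) = (‖c‖ ^ 2) ^ 2 ^ k * schattenPow k A := by
  rw [schattenPow, conjTranspose_smul, smul_mul_smul, smul_pow, trace_smul, smul_eq_mul,
    Complex.star_def, ← Complex.normSq_eq_conj_mul_self, Complex.normSq_eq_norm_sq,
    ← Complex.ofReal_pow, Complex.re_ofReal_mul, schattenPow]

/-- A triangle inequality up to a constant, independent of the matrix size. It comes from the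
parallelogram bound `(X+Y)ᴴ(X+Y) ≤ 2XᴴX + 2YᴴY`, tested against a power of the left side. -/
theorem schattenPow_add_le (k : ℕ) : ∃ C : ℝ, 0 ≤ C ∧
    ∀ {ι : Type*} [Fintype ι] [DecidableEq ι] (X Y : Matrix ι ι ℂ),
      schattenPow k (X + Y) ≤ C * (schattenPow k X + schattenPow k Y) := by
  obtain ⟨n, hn⟩ : ∃ n, 2 ^ k = n + 1 := Nat.exists_eq_succ_of_ne_zero (by positivity)
  refine ⟨4 * (8 : ℝ) ^ n, by positivity, fun {ι} _ _ X Y => ?_⟩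
  set P := (X + Y)ᴴ * (X + Y) with hP
  have hPp : P.PosSemidef := posSemidef_conjTranspose_mul_self _
  have h1 : (trace (P ^ n * P)).re ≤ 2 * (trace (P ^ n * (Xᴴ * X))).re +
      2 * (trace (P ^ n * (Yᴴ * Y))).re := by
    have h2 : 0 ≤ (trace (P ^ n * ((X - Y)ᴴ * (X - Y)))).re :=
      trace_mul_re_nonneg (hPp.pow n) (posSemidef_conjTranspose_mul_self _)
    have h3 : (X - Y)ᴴ * (X - Y) = (2 : ℂ) • (Xᴴ * X) + (2 : ℂ) • (Yᴴ * Y) - P := by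
      rw [hP, conjTranspose_sub, conjTranspose_add, two_smul, two_smul]
      noncomm_ring
    rw [h3, Matrix.mul_sub, Matrix.mul_add, Matrix.mul_smul, Matrix.mul_smul, trace_sub, trace_add,
      trace_smul, trace_smul] at h2
    simp only [smul_eq_mul, Complex.sub_re, Complex.add_re, Complex.mul_re, Complex.re_ofNat,
      Complex.im_ofNat, zero_mul, sub_zero] at h2
    linarith
  -- With `ε = 1/8`, the two terms contribute `2/8 + 2/8 = 1/2` of `tr P^(n+1)`, which is absorbed.
  have h2 := trace_young_psd hPp (posSemidef_conjTranspose_mul_self X) n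
    (show (0 : ℝ) < 1 / 8 by norm_num)
  have h3 := trace_young_psd hPp (posSemidef_conjTranspose_mul_self Y) n
    (show (0 : ℝ) < 1 / 8 by norm_num)
  rw [← pow_succ] at h1
  have h4 : (((1 : ℝ) / 8) ^ n)⁻¹ = 8 ^ n := by rw [one_div, inv_pow, inv_inv]
  rw [h4] at h2 h3
  simp only [schattenPow, hn]
  rw [← hP]
  linarith

theorem trace_fromBlocks_diag (A B C D : Matrix ι ι ℂ) :
    trace (fromBlocks A B C D) = trace A + trace D := by
  simp [trace, Fintype.sum_sum_type]

theorem schattenPow_dilation (k : ℕ) (A : Matrix ι ι ℂ) :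
    schattenPow k (fromBlocks 0 A Aᴴ 0) = 2 * schattenPow k A := by
  rw [schattenPow, fromBlocks_conjTranspose, fromBlocks_multiply]
  simp only [conjTranspose_zero, Matrix.zero_mul, Matrix.mul_zero, conjTranspose_conjTranspose,
    zero_add, add_zero]
  rw [fromBlocks_diagonal_pow, trace_fromBlocks_diag, Complex.add_re, two_mul]
  nth_rewrite 1 [← schattenPow_conjTranspose]
  rw [schattenPow, schattenPow, conjTranspose_conjTranspose]

end SchattenPow

/-! ### Generalized triangular truncations by Cotlar's method -/

section OrderSymbol

variable {ι : Type*} [Fintype ι] [DecidableEq ι]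

/-- The Schur product of a symbol and a matrix. -/
def schur (m : ι → ι → ℂ) (A : Matrix ι ι ℂ) : Matrix ι ι ℂ := Matrix.of fun j k => m j k * A j k

/-- The symbol that is `1` at `(j, k)` if `y k ≤ x j`, and `-1` otherwise. -/
def orderSymbol (x y : ι → ℝ) (j k : ι) : ℂ := if y k ≤ x j then 1 else -1

/-- Cotlar's identity for generalized triangular truncations. -/
theorem cotlar_identity (x y : ι → ℝ) (A : Matrix ι ι ℂ) :
    (schur (orderSymbol x y) A)ᴴ * schur (orderSymbol x y) A =
      Aᴴ * A + (-1 : ℂ) • schur (orderSymbol y y) (Aᴴ * schur (orderSymbol x y) A) +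
        schur (orderSymbol y y) ((schur (orderSymbol x y) A)ᴴ * A) := by
  ext k l
  simp only [Matrix.add_apply, Matrix.smul_apply, smul_eq_mul, schur, of_apply,
    Matrix.mul_apply, conjTranspose_apply, Finset.mul_sum, ← Finset.sum_add_distrib]
  refine Finset.sum_congr rfl fun j _ => ?_
  simp only [orderSymbol]
  have : ∀ p : Prop, [Decidable p] → star (if p then (1 : ℂ) else -1) = if p then 1 else -1 := by
    intro p _; split_ifs <;> simp
  rw [star_mul', this]
  -- Entrywise this is `s_k s_l = 1 - σ s_l + σ s_k`, where `σ` compares `y l` with `y k`. When `s_k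
  -- ≠ s_l`, the value `x j` separates `y k` from `y l` and forces `σ`; the inconsistent sign
  -- patterns are excluded by transitivity.
  split_ifs <;> first | (exfalso; linarith) | ring

/-- Exponent doubling: the power of `B` at level `k + 1` is that of `BᴴB` at level `k`, and Cotlar's
identity expresses `BᴴB` through truncations of `AᴴB` and `BᴴA`. Hölder bounds these by a mixture of
`A` and `B`, and the `B` part is absorbed. At level `0` the symbol has modulus one. -/
theorem schattenPow_orderSymbol_le (k : ℕ) : ∃ C : ℝ, 0 ≤ C ∧
    ∀ {ι : Type*} [Fintype ι] [DecidableEq ι] (x y : ι → ℝ) (A : Matrix ι ι ℂ),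
      schattenPow k (schur (orderSymbol x y) A) ≤ C * schattenPow k A := by
  induction k with
  | zero =>
    refine ⟨1, zero_le_one, fun x y A => ?_⟩
    rw [one_mul, schattenPow_zero_eq, schattenPow_zero_eq]
    refine Finset.sum_le_sum fun i _ => Finset.sum_le_sum fun j _ => ?_
    rw [schur, of_apply, orderSymbol]
    split_ifs <;> simp
  | succ k ih =>
    obtain ⟨h, hh, H⟩ := ih
    obtain ⟨C, hC, hadd⟩ := schattenPow_add_le k
    -- Chosen so that the total coefficient `(C² + C) h ε` of `b` below is at most `1/2`.
    set ε : ℝ := (2 * ((C * C + C) * h + 1))⁻¹ with hε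
    have hε0 : 0 < ε := by positivity
    refine ⟨2 * (C * C + (C * C + C) * h * ε⁻¹), by positivity, fun {ι} _ _ x y A => ?_⟩
    set B := schur (orderSymbol x y) A with hB
    have h1 := schattenPow_succ k B
    rw [hB, cotlar_identity, ← hB] at h1
    have h2 := hadd (Aᴴ * A + (-1 : ℂ) • schur (orderSymbol y y) (Aᴴ * B))
      (schur (orderSymbol y y) (Bᴴ * A))
    have h3 := hadd (Aᴴ * A) ((-1 : ℂ) • schur (orderSymbol y y) (Aᴴ * B))
    rw [schattenPow_smul] at h3
    simp only [norm_neg, norm_one, one_pow, one_mul] at h3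
    have h4 := H y y (Aᴴ * B)
    have h5 := H y y (Bᴴ * A)
    have h6 := schattenPow_mul_le k Aᴴ B hε0
    have h7 := schattenPow_mul_le k Bᴴ A (inv_pos.2 hε0)
    rw [inv_inv, schattenPow_conjTranspose] at h7
    rw [schattenPow_conjTranspose] at h6
    rw [← schattenPow_succ] at h3
    have hA0 := schattenPow_nonneg (k + 1) A
    have hB0 := schattenPow_nonneg (k + 1) B
    set a := schattenPow (k + 1) A
    set b := schattenPow (k + 1) B
    have h8 : b ≤ C * (C * (a + h * (ε⁻¹ * a + ε * b)) + h * (ε * b + ε⁻¹ * a)) := by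
      refine h1.le.trans (h2.trans (mul_le_mul_of_nonneg_left (add_le_add (h3.trans ?_) (h5.trans ?_)) hC))
      · exact mul_le_mul_of_nonneg_left (add_le_add le_rfl
          (h4.trans (mul_le_mul_of_nonneg_left h6 hh))) hC
      · exact mul_le_mul_of_nonneg_left h7 hh
    have h9 : (C * C + C) * h * ε ≤ 1 / 2 := by
      rw [hε, ← div_eq_mul_inv, div_le_div_iff₀ (by positivity) (by norm_num)]
      nlinarith [mul_nonneg (add_nonneg (mul_nonneg hC hC) hC) hh]
    nlinarith [mul_le_mul_of_nonneg_right h9 hB0]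

end OrderSymbol

end SchurMultiplier


namespace SchurMultiplier

open MeasureTheory
open scoped RealInnerProductSpace

/-! ### Polynomial growth, used to justify Gaussian integrability -/

section PolynomialGrowth

variable {E : Type*} [NormedAddCommGroup E] {F : Type*} [NormedAddCommGroup F]

/-- A function bounded by a power of `1 + ‖x‖`. -/
def PolyGrowth (f : E → F) : Prop := ∃ (C : ℝ) (n : ℕ), 0 ≤ C ∧ ∀ x, ‖f x‖ ≤ C * (1 + ‖x‖) ^ n

theorem PolyGrowth.of_norm_le {f : E → F} {C : ℝ} (h : ∀ x, ‖f x‖ ≤ C) : PolyGrowth f :=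
  ⟨C, 0, (norm_nonneg _).trans (h 0), fun x => by simpa using h x⟩

theorem PolyGrowth.mono {G : Type*} [NormedAddCommGroup G] {f : E → F} {g : E → G}
    (hg : PolyGrowth g) {C : ℝ} (hC : 0 ≤ C) (h : ∀ x, ‖f x‖ ≤ C * ‖g x‖) : PolyGrowth f := by
  obtain ⟨D, n, hD, hg⟩ := hg
  refine ⟨C * D, n, by positivity, fun x => (h x).trans ?_⟩
  rw [mul_assoc]
  exact mul_le_mul_of_nonneg_left (hg x) hC

theorem PolyGrowth.add {f g : E → F} (hf : PolyGrowth f) (hg : PolyGrowth g) :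
    PolyGrowth fun x => f x + g x := by
  obtain ⟨C, n, hC, hf⟩ := hf
  obtain ⟨D, m, hD, hg⟩ := hg
  refine ⟨C + D, n + m, by positivity, fun x => (norm_add_le _ _).trans ?_⟩
  have h1 : (1 : ℝ) ≤ 1 + ‖x‖ := by linarith [norm_nonneg x]
  have h2 := pow_le_pow_right₀ h1 (Nat.le_add_right n m)
  have h3 := pow_le_pow_right₀ h1 (Nat.le_add_left m n)
  rw [add_mul]
  exact add_le_add ((hf x).trans (by gcongr)) ((hg x).trans (by gcongr))

theorem PolyGrowth.mul {R : Type*} [NormedRing R] {f g : E → R} (hf : PolyGrowth f)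
    (hg : PolyGrowth g) : PolyGrowth fun x => f x * g x := by
  obtain ⟨C, n, hC, hf⟩ := hf
  obtain ⟨D, m, hD, hg⟩ := hg
  refine ⟨C * D, n + m, by positivity, fun x => (norm_mul_le _ _).trans ?_⟩
  calc ‖f x‖ * ‖g x‖ ≤ (C * (1 + ‖x‖) ^ n) * (D * (1 + ‖x‖) ^ m) :=
        mul_le_mul (hf x) (hg x) (norm_nonneg _) (by positivity)
    _ = _ := by rw [pow_add]; ring

theorem PolyGrowth.sum {α : Type*} (s : Finset α) {f : α → E → F}
    (hf : ∀ a ∈ s, PolyGrowth (f a)) : PolyGrowth fun x => ∑ a ∈ s, f a x := by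
  classical
  induction s using Finset.induction_on with
  | empty => exact PolyGrowth.of_norm_le (C := 0) (by simp)
  | insert a s ha ih =>
    simp only [Finset.sum_insert ha]
    exact (hf a (Finset.mem_insert_self _ _)).add
      (ih fun b hb => hf b (Finset.mem_insert_of_mem hb))

theorem PolyGrowth.norm_id : PolyGrowth fun x : E => ‖x‖ :=
  ⟨1, 1, zero_le_one, fun x => by simp⟩

end PolynomialGrowth

/-! ### Gaussian calculus and the representation of unit vectors by signs -/

section Gaussian

variable {E : Type*} [NormedAddCommGroup E]

/-- The Gaussian density `exp (-π ‖x‖²)`. -/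
def gaussWeight (x : E) : ℝ := Real.exp (-Real.pi * ‖x‖ ^ 2)

theorem continuous_gaussWeight : Continuous (gaussWeight : E → ℝ) := by
  unfold gaussWeight; fun_prop

theorem gaussWeight_pos (x : E) : 0 < gaussWeight x := Real.exp_pos _

theorem gaussWeight_mul_pow_le (N : ℕ) (x : E) :
    gaussWeight x * (1 + ‖x‖) ^ N ≤ Real.exp (N ^ 2) := by
  have h1 : (1 + ‖x‖) ^ N ≤ Real.exp (N * ‖x‖) := by
    rw [Real.exp_nat_mul]
    exact pow_le_pow_left₀ (by positivity) (by linarith [Real.add_one_le_exp ‖x‖]) _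
  calc gaussWeight x * (1 + ‖x‖) ^ N
      ≤ Real.exp (-Real.pi * ‖x‖ ^ 2) * Real.exp (N * ‖x‖) :=
        mul_le_mul_of_nonneg_left h1 (Real.exp_pos _).le
    _ = Real.exp (-Real.pi * ‖x‖ ^ 2 + N * ‖x‖) := (Real.exp_add _ _).symm
    _ ≤ _ := Real.exp_le_exp.2 (by
        nlinarith [Real.pi_gt_three, sq_nonneg ((N : ℝ) - ‖x‖ / 2), sq_nonneg ‖x‖,
          mul_nonneg (sub_nonneg.2 Real.pi_gt_three.le) (sq_nonneg ‖x‖)])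

variable [InnerProductSpace ℝ E] [FiniteDimensional ℝ E] [MeasurableSpace E] [BorelSpace E]

variable (E) in
/-- The rotation invariant Gaussian probability measure with density `exp (-π ‖x‖²)`. -/
def gaussMeasure : Measure E := volume.withDensity fun x => ENNReal.ofReal (gaussWeight x)

theorem integral_gaussMeasure {F : Type*} [NormedAddCommGroup F] [NormedSpace ℝ F] (f : E → F) :
    ∫ x, f x ∂(gaussMeasure E) = ∫ x, gaussWeight x • f x := by
  rw [gaussMeasure, integral_withDensity_eq_integral_toReal_smul
    (continuous_gaussWeight.measurable.ennreal_ofReal) (by simp)]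
  simp only [ENNReal.toReal_ofReal (gaussWeight_pos _).le]

theorem integrable_gaussMeasure_iff {F : Type*} [NormedAddCommGroup F] [NormedSpace ℝ F]
    {f : E → F} :
    Integrable f (gaussMeasure E) ↔ Integrable fun x => gaussWeight x • f x := by
  rw [gaussMeasure, integrable_withDensity_iff_integrable_smul'
    (continuous_gaussWeight.measurable.ennreal_ofReal) (by simp)]
  simp only [ENNReal.toReal_ofReal (gaussWeight_pos _).le]

theorem PolyGrowth.integrable {F : Type*} [NormedAddCommGroup F] [NormedSpace ℝ F] {f : E → F}
    (hf : PolyGrowth f) (hm : AEStronglyMeasurable f volume) : Integrable f (gaussMeasure E) := by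
  obtain ⟨C, n, hC, hf⟩ := hf
  rw [integrable_gaussMeasure_iff]
  set d := Module.finrank ℝ E
  have h1 : Integrable (fun x : E => (1 + ‖x‖) ^ (-((d + 1 : ℕ) : ℝ))) :=
    integrable_one_add_norm (by exact_mod_cast Nat.lt_succ_self d)
  refine (h1.const_mul (C * Real.exp ((n + (d + 1) : ℕ) ^ 2))).mono'
    (continuous_gaussWeight.aestronglyMeasurable.smul hm) (Filter.Eventually.of_forall fun x => ?_)
  have hx : 0 < 1 + ‖x‖ := by positivity
  rw [norm_smul, Real.norm_of_nonneg (gaussWeight_pos x).le, Real.rpow_neg hx.le,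
    Real.rpow_natCast, ← div_eq_mul_inv, le_div_iff₀ (by positivity)]
  calc gaussWeight x * ‖f x‖ * (1 + ‖x‖) ^ (d + 1)
      ≤ gaussWeight x * (C * (1 + ‖x‖) ^ n) * (1 + ‖x‖) ^ (d + 1) := by
        have := (gaussWeight_pos x).le
        gcongr
        exact hf x
    _ = C * (gaussWeight x * (1 + ‖x‖) ^ (n + (d + 1))) := by rw [pow_add]; ring
    _ ≤ _ := mul_le_mul_of_nonneg_left (gaussWeight_mul_pow_le _ x) hC

instance : IsProbabilityMeasure (gaussMeasure E) := by
  have hi : Integrable (fun _ : E => (1 : ℝ)) (gaussMeasure E) :=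
    (PolyGrowth.of_norm_le (C := 1) (by simp)).integrable aestronglyMeasurable_const
  have h := integral_gaussMeasure (fun _ : E => (1 : ℝ))
  have h2 := GaussianFourier.integral_rexp_neg_mul_sq_norm (V := E) Real.pi_pos
  simp only [smul_eq_mul, mul_one, gaussWeight] at h
  rw [h2, div_self Real.pi_ne_zero, Real.one_rpow, integral_const, smul_eq_mul, mul_one] at h
  constructor
  have hf : IsFiniteMeasure (gaussMeasure E) := by
    rcases (integrable_const_iff (c := (1 : ℝ))).1 hi with h | h
    · exact absurd h one_ne_zero
    · exact h
  rw [← ENNReal.toReal_eq_one_iff]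
  exact h

theorem integral_gaussMeasure_comp (R : E ≃ₗᵢ[ℝ] E) {F : Type*} [NormedAddCommGroup F]
    [NormedSpace ℝ F] (f : E → F) :
    ∫ x, f (R x) ∂(gaussMeasure E) = ∫ x, f x ∂(gaussMeasure E) := by
  rw [integral_gaussMeasure, integral_gaussMeasure]
  have := R.measurePreserving.integral_comp R.toHomeomorph.measurableEmbedding
    (fun x => gaussWeight x • f x)
  rw [← this]
  simp [gaussWeight]

theorem polyGrowth_inner (v : E) : PolyGrowth fun x : E => ⟪v, x⟫ :=
  PolyGrowth.norm_id.mono (norm_nonneg v) fun x => by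
    simpa using norm_inner_le_norm (𝕜 := ℝ) v x

/-- Gaussian integration by parts. -/
theorem integral_inner_mul_gaussMeasure (v : E) {f : E → ℝ} (hf : Differentiable ℝ f)
    (hg : PolyGrowth f) (hc : Continuous fun x => fderiv ℝ f x v)
    (hg' : PolyGrowth fun x => fderiv ℝ f x v) :
    ∫ x, ⟪v, x⟫ * f x ∂(gaussMeasure E) =
      (2 * Real.pi)⁻¹ * ∫ x, fderiv ℝ f x v ∂(gaussMeasure E) := by
  have hd : ∀ x : E, HasFDerivAt (gaussWeight : E → ℝ)
      (gaussWeight x • ((-Real.pi) • ((2 : ℝ) • innerSL ℝ x))) x := by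
    intro x
    have h1 := (hasStrictFDerivAt_norm_sq x).hasFDerivAt
    have h2 := (h1.const_mul (-Real.pi)).exp
    convert! h2 using 1
    ext y
    simp [gaussWeight]
  have hd' : ∀ x : E, fderiv ℝ (gaussWeight : E → ℝ) x v =
      -(2 * Real.pi) * (gaussWeight x * ⟪v, x⟫) := by
    intro x
    rw [(hd x).fderiv]
    simp only [_root_.smul_apply, innerSL_apply_apply, smul_eq_mul, real_inner_comm v x]
    ring
  have e1 := integrable_gaussMeasure_iff.1 (hg'.integrable hc.aestronglyMeasurable)
  have e2 := integrable_gaussMeasure_iff.1 (hg.integrable hf.continuous.aestronglyMeasurable)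
  have e3 := integrable_gaussMeasure_iff.1 (((polyGrowth_inner v).mul hg).integrable
    ((continuous_const.inner continuous_id).mul hf.continuous).aestronglyMeasurable)
  have h := integral_mul_fderiv_eq_neg_fderiv_mul_of_integrable (μ := (volume : Measure E))
    (f := (gaussWeight : E → ℝ)) (g := f) (v := v) (by
      refine (e3.const_mul (-(2 * Real.pi))).congr (Filter.Eventually.of_forall fun x => ?_)
      simp only [hd', smul_eq_mul]
      ring) e1 e2 (fun x _ => (hd x).differentiableAt) (fun x _ => hf x)
  rw [integral_gaussMeasure, integral_gaussMeasure]
  simp only [smul_eq_mul]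
  rw [h]
  simp only [hd']
  rw [← integral_neg, ← integral_const_mul]
  refine integral_congr_ae (Filter.Eventually.of_forall fun x => ?_)
  have := Real.pi_ne_zero
  simp only
  field_simp

theorem integral_inner_sq (v : E) :
    ∫ x, ⟪v, x⟫ ^ 2 ∂(gaussMeasure E) = (2 * Real.pi)⁻¹ * ‖v‖ ^ 2 := by
  have hd : ∀ x, fderiv ℝ (fun x : E => ⟪v, x⟫) x v = ‖v‖ ^ 2 := by
    intro x
    rw [show (fun x : E => ⟪v, x⟫) = innerSL ℝ v from rfl, ContinuousLinearMap.fderiv]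
    simp
  have h := integral_inner_mul_gaussMeasure v (f := fun x => ⟪v, x⟫) (innerSL ℝ v).differentiable
    (polyGrowth_inner v) (by simp only [hd]; fun_prop)
    (by simp only [hd]; exact PolyGrowth.of_norm_le (fun _ => le_rfl))
  simp only [hd, integral_const, probReal_univ, one_smul, ← pow_two] at h
  exact h

theorem integral_inner_pow_four (v : E) :
    ∫ x, ⟪v, x⟫ ^ 4 ∂(gaussMeasure E) = 3 * ((2 * Real.pi)⁻¹ * ‖v‖ ^ 2) ^ 2 := by
  have hd : ∀ x, fderiv ℝ (fun x : E => ⟪v, x⟫ ^ 3) x v = 3 * ‖v‖ ^ 2 * ⟪v, x⟫ ^ 2 := by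
    intro x
    have : HasFDerivAt (fun x : E => ⟪v, x⟫) (innerSL ℝ v) x := (innerSL ℝ v).hasFDerivAt
    rw [(this.pow 3).fderiv]
    simp
    ring
  have h3 : PolyGrowth fun x : E => ⟪v, x⟫ ^ 2 := by
    simpa only [pow_two] using (polyGrowth_inner v).mul (polyGrowth_inner v)
  have h4 : PolyGrowth fun x : E => ⟪v, x⟫ ^ 3 := by
    simpa only [pow_succ _ 2] using h3.mul (polyGrowth_inner v)
  have h := integral_inner_mul_gaussMeasure v (f := fun x => ⟪v, x⟫ ^ 3)
    ((innerSL ℝ v).differentiable.pow 3)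
    h4 (by simp only [hd]; fun_prop)
    (by simp only [hd]; exact h3.mono (C := ‖3 * ‖v‖ ^ 2‖) (norm_nonneg _)
          fun x => (norm_mul _ _).le)
  simp only [hd, integral_const_mul, integral_inner_sq, ← pow_succ'] at h
  rw [h]
  ring

/-- The sign function with `sgn 0 = 1`. -/
def sgn (t : ℝ) : ℝ := if 0 ≤ t then 1 else -1

theorem measurable_sgn : Measurable sgn :=
  Measurable.ite measurableSet_Ici measurable_const measurable_const

theorem abs_sgn (t : ℝ) : |sgn t| = 1 := by unfold sgn; split_ifs <;> simp

theorem sgn_mul_self (t : ℝ) : sgn t * t = |t| := by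
  unfold sgn; split_ifs with h
  · rw [one_mul, abs_of_nonneg h]
  · rw [abs_of_neg (not_le.1 h), neg_one_mul]

theorem sgn_mul_of_pos {r : ℝ} (hr : 0 < r) (t : ℝ) : sgn (r * t) = sgn t := by
  unfold sgn; simp [mul_nonneg_iff_of_pos_left hr]

theorem integrable_sgn_mul (ξ η : E) :
    Integrable (fun x => sgn ⟪ξ, x⟫ * ⟪η, x⟫) (gaussMeasure E) := by
  refine (((PolyGrowth.of_norm_le (C := 1) fun x => ?_)).mul (polyGrowth_inner η)).integrable ?_
  · rw [Real.norm_eq_abs, abs_sgn]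
  · exact ((measurable_sgn.comp (by fun_prop)).mul (by fun_prop)).aestronglyMeasurable

/-- A lower bound free of the dimension: integrating `t² ≤ |t| + t⁴` bounds the first absolute
moment below by `σ² - 3σ⁴`, where `σ² = 1/(2π)`, and `6σ² ≤ 1`. -/
theorem le_integral_abs_inner {e : E} (he : ‖e‖ = 1) :
    (4 * Real.pi)⁻¹ ≤ ∫ x, |⟪e, x⟫| ∂(gaussMeasure E) := by
  have h2 : PolyGrowth fun x : E => ⟪e, x⟫ ^ 2 := by
    simpa only [pow_two] using (polyGrowth_inner e).mul (polyGrowth_inner e)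
  have h4 : PolyGrowth fun x : E => ⟪e, x⟫ ^ 4 := by
    have : ∀ t : ℝ, t ^ 4 = t ^ 2 * t ^ 2 := fun t => by ring
    simpa only [this] using h2.mul h2
  have h1 : PolyGrowth fun x : E => |⟪e, x⟫| :=
    (polyGrowth_inner e).mono zero_le_one (by simp)
  have i1 := h1.integrable (by fun_prop)
  have i2 := h2.integrable (by fun_prop)
  have i4 := h4.integrable (by fun_prop)
  have h := integral_mono i2 (i1.add i4) (fun x => by
    simp only [Pi.add_apply]
    rcases le_total |⟪e, x⟫| 1 with h | h
    · rw [← sq_abs]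
      nlinarith [abs_nonneg ⟪e, x⟫, pow_nonneg (abs_nonneg ⟪e, x⟫) 4, even_two.pow_abs ⟪e, x⟫,
        show 0 ≤ ⟪e, x⟫ ^ 4 by positivity]
    · have := sq_abs ⟪e, x⟫
      nlinarith [abs_nonneg ⟪e, x⟫, sq_nonneg (⟪e, x⟫ ^ 2)])
  rw [integral_inner_sq] at h
  simp only [Pi.add_apply] at h
  rw [integral_add i1 i4, integral_inner_pow_four, he] at h
  have hp := Real.pi_gt_three
  have e1 : (4 * Real.pi)⁻¹ = (2 * Real.pi)⁻¹ / 2 := by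
    rw [show 4 * Real.pi = 2 * Real.pi * 2 by ring, mul_inv, div_eq_mul_inv]
  have e2 : (2 * Real.pi)⁻¹ * 6 ≤ 1 := by
    rw [inv_mul_le_iff₀ (by positivity)]; linarith
  have e3 : 0 < (2 * Real.pi)⁻¹ := by positivity
  rw [e1]
  nlinarith

/-- The vector `x / ‖x‖`, read as `0` for `x = 0`. -/
def unit (x : E) : E := ‖x‖⁻¹ • x

variable (E) in
/-- Gaussian representation of the unit vector `ξ / ‖ξ‖`. -/
theorem exists_integral_sgn_mul : ∃ c : ℝ, (4 * Real.pi)⁻¹ ≤ c ∧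
    ∀ ξ η : E, ∫ x, sgn ⟪ξ, x⟫ * ⟪η, x⟫ ∂(gaussMeasure E) = c * ⟪unit ξ, η⟫ := by
  -- Since `sgn 0 = 1`, the integrand is an odd linear form.
  have hzero : ∀ η : E, ∫ x, sgn ⟪(0 : E), x⟫ * ⟪η, x⟫ ∂(gaussMeasure E) = 0 := by
    intro η
    have := integral_gaussMeasure_comp (LinearIsometryEquiv.neg ℝ)
      (fun x : E => sgn ⟪(0 : E), x⟫ * ⟪η, x⟫)
    simp only [inner_zero_left, LinearIsometryEquiv.coe_neg, inner_neg_right, mul_neg,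
      integral_neg, neg_zero] at this ⊢
    linarith
  -- The reflection in the line of `e` preserves the Gaussian measure, fixes `⟪e, x⟫` and changes
  -- the sign of `⟪η, x⟫`.
  have horth : ∀ e η : E, ⟪e, η⟫ = 0 → ∫ x, sgn ⟪e, x⟫ * ⟪η, x⟫ ∂(gaussMeasure E) = 0 := by
    intro e η h
    set R := (Submodule.span ℝ {e}).reflection
    have h1 : R e = e := Submodule.reflection_mem_subspace_eq_self
      (Submodule.mem_span_singleton_self e)
    have h2 : R η = -η := Submodule.reflection_mem_subspace_orthogonalComplement_eq_neg
      (Submodule.mem_orthogonal_singleton_iff_inner_right.2 h)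
    have := integral_gaussMeasure_comp R (fun x : E => sgn ⟪e, x⟫ * ⟪η, x⟫)
    have h3 : ∀ x, ⟪e, R x⟫ = ⟪e, x⟫ := fun x => by
      conv_lhs => rw [← h1]
      exact R.inner_map_map e x
    have h4 : ∀ x, ⟪η, R x⟫ = -⟪η, x⟫ := fun x => by
      have := R.inner_map_map η x
      rw [h2, inner_neg_left] at this
      linarith
    simp only [h3, h4, mul_neg, integral_neg] at this
    linarith
  by_cases hE : ∃ e : E, ‖e‖ = 1
  · obtain ⟨e₀, he₀⟩ := hE
    refine ⟨∫ x, |⟪e₀, x⟫| ∂(gaussMeasure E), le_integral_abs_inner he₀, fun ξ η => ?_⟩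
    by_cases hξ : ξ = 0
    · rw [hξ, hzero, unit, smul_zero, inner_zero_left, mul_zero]
    set e := unit ξ with he
    have hn : 0 < ‖ξ‖ := norm_pos_iff.2 hξ
    have hee : ‖e‖ = 1 := by
      rw [he, unit, norm_smul, norm_inv, norm_norm, inv_mul_cancel₀ hn.ne']
    have hs : ∀ x, sgn ⟪ξ, x⟫ = sgn ⟪e, x⟫ := fun x => by
      rw [he, unit, real_inner_smul_left, sgn_mul_of_pos (inv_pos.2 hn)]
    have hη : ∀ x, sgn ⟪ξ, x⟫ * ⟪η, x⟫ =
        ⟪e, η⟫ * |⟪e, x⟫| + sgn ⟪e, x⟫ * ⟪η - ⟪e, η⟫ • e, x⟫ := fun x => by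
      rw [hs, ← sgn_mul_self, inner_sub_left, real_inner_smul_left]
      ring
    simp only [hη]
    rw [integral_add, integral_const_mul, horth, add_zero, mul_comm]
    · congr 1
      -- A reflection carrying `e₀` to `e` shows that the first absolute moment is the same for all
      -- unit vectors, so `c` does not depend on `ξ`.
      have := integral_gaussMeasure_comp (ℝ ∙ (e₀ - e))ᗮ.reflection (fun x => |⟪e, x⟫|)
      rw [← this]
      have h5 := Submodule.reflection_sub (he₀.trans hee.symm)
      refine integral_congr_ae (Filter.Eventually.of_forall fun x => ?_)
      have h6 := (ℝ ∙ (e₀ - e))ᗮ.reflection.inner_map_map e₀ x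
      rw [h5] at h6
      simp only [h6]
    · rw [inner_sub_right, real_inner_smul_right, real_inner_self_eq_norm_sq, hee]
      ring
    · simpa only [← sgn_mul_self] using (integrable_sgn_mul e e).const_mul ⟪e, η⟫
    · exact integrable_sgn_mul _ _
  · have h0 : ∀ ξ : E, ξ = 0 := by
      intro ξ
      by_contra h
      exact hE ⟨‖ξ‖⁻¹ • ξ, by
        rw [norm_smul, norm_inv, norm_norm, inv_mul_cancel₀ (norm_ne_zero_iff.2 h)]⟩
    exact ⟨(4 * Real.pi)⁻¹, le_rfl, fun ξ η => by
      rw [h0 ξ, hzero, unit, smul_zero, inner_zero_left, mul_zero]⟩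

/-- Bessel's inequality for the Gaussian variables `⟪a i, x⟫`. -/
theorem sum_integral_inner_mul_sq_le {κ : Type*} [Fintype κ] {a : κ → E}
    (ha : ∀ v : κ → ℝ, ‖∑ i, v i • a i‖ ^ 2 ≤ ∑ i, v i ^ 2) {φ : E → ℝ}
    (hφ : Measurable φ) {C : ℝ} (hC : ∀ x, ‖φ x‖ ≤ C) :
    ∑ i, (∫ x, ⟪a i, x⟫ * φ x ∂(gaussMeasure E)) ^ 2 ≤
      (2 * Real.pi)⁻¹ * ∫ x, φ x ^ 2 ∂(gaussMeasure E) := by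
  have gφ : PolyGrowth φ := PolyGrowth.of_norm_le hC
  set v : κ → ℝ := fun i => ∫ x, ⟪a i, x⟫ * φ x ∂(gaussMeasure E) with hv
  have hint : ∀ z : E, Integrable (fun x => ⟪z, x⟫ * φ x) (gaussMeasure E) := fun z =>
    ((polyGrowth_inner z).mul gφ).integrable
      (Measurable.mul (by fun_prop) hφ).aestronglyMeasurable
  have hφ2 : Integrable (fun x => φ x ^ 2) (gaussMeasure E) := by
    simpa only [pow_two] using (gφ.mul gφ).integrable (hφ.mul hφ).aestronglyMeasurable
  have hz2 : ∀ z : E, Integrable (fun x => ⟪z, x⟫ ^ 2) (gaussMeasure E) := fun z => by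
    simpa only [pow_two] using ((polyGrowth_inner z).mul (polyGrowth_inner z)).integrable
      (by fun_prop)
  set z : E := ∑ i, v i • a i with hz
  have h1 : ∑ i, v i ^ 2 = ∫ x, ⟪z, x⟫ * φ x ∂(gaussMeasure E) := by
    simp only [hz, sum_inner, real_inner_smul_left, Finset.sum_mul, mul_assoc]
    rw [integral_finsetSum _ fun i _ => (hint _).const_mul _]
    refine Finset.sum_congr rfl fun i _ => ?_
    rw [integral_const_mul, pow_two]
  -- The factor `2π` is the inverse variance of a unit linear form. Expanding the square, the cross
  -- term gives `-4π ∑ v_i²` and the last term at most `2π ∑ v_i²`.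
  have h2 : 0 ≤ ∫ x, (φ x - 2 * Real.pi * ⟪z, x⟫) ^ 2 ∂(gaussMeasure E) :=
    integral_nonneg fun x => sq_nonneg _
  have h3 : ∀ x, (φ x - 2 * Real.pi * ⟪z, x⟫) ^ 2 =
      φ x ^ 2 + (-(4 * Real.pi)) * (⟪z, x⟫ * φ x) + (4 * Real.pi ^ 2) * ⟪z, x⟫ ^ 2 :=
    fun x => by ring
  simp only [h3] at h2
  have h6 := hφ2.add ((hint z).const_mul (-(4 * Real.pi)))
  simp only [Pi.add_def] at h6
  rw [integral_add h6 ((hz2 z).const_mul _), integral_add hφ2 ((hint z).const_mul _), integral_const_mul, integral_const_mul,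
    integral_inner_sq, ← h1] at h2
  have h4 := ha v
  rw [← hz] at h4
  have hp := Real.pi_pos
  have h5 : 4 * Real.pi ^ 2 * ((2 * Real.pi)⁻¹ * ‖z‖ ^ 2) = 2 * Real.pi * ‖z‖ ^ 2 := by
    field_simp
    ring
  rw [h5] at h2
  rw [inv_mul_eq_div, le_div_iff₀ (by positivity)]
  nlinarith

theorem sum_norm_integral_inner_mul_sq_le {κ : Type*} [Fintype κ] {a : κ → E}
    (ha : ∀ v : κ → ℝ, ‖∑ i, v i • a i‖ ^ 2 ≤ ∑ i, v i ^ 2) {φ : E → ℂ}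
    (hφ : Measurable φ) {C : ℝ} (hC : ∀ x, ‖φ x‖ ≤ C) :
    ∑ i, ‖∫ x, (⟪a i, x⟫ : ℂ) * φ x ∂(gaussMeasure E)‖ ^ 2 ≤
      (2 * Real.pi)⁻¹ * ∫ x, ‖φ x‖ ^ 2 ∂(gaussMeasure E) := by
  have gφ : PolyGrowth φ := PolyGrowth.of_norm_le hC
  have hint : ∀ z : E, Integrable (fun x => (⟪z, x⟫ : ℂ) * φ x) (gaussMeasure E) := fun z => by
    refine PolyGrowth.integrable (PolyGrowth.mul ?_ gφ)
      (Measurable.mul (by fun_prop) hφ).aestronglyMeasurable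
    exact (polyGrowth_inner z).mono zero_le_one (by simp)
  have hre : ∀ i, (∫ x, (⟪a i, x⟫ : ℂ) * φ x ∂(gaussMeasure E)).re =
      ∫ x, ⟪a i, x⟫ * (φ x).re ∂(gaussMeasure E) := fun i => by
    rw [← RCLike.re_eq_complex_re, ← integral_re (hint _)]
    simp
  have him : ∀ i, (∫ x, (⟪a i, x⟫ : ℂ) * φ x ∂(gaussMeasure E)).im =
      ∫ x, ⟪a i, x⟫ * (φ x).im ∂(gaussMeasure E) := fun i => by
    rw [← RCLike.im_eq_complex_im, ← integral_im (hint _)]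
    simp
  have mre : Measurable fun x => (φ x).re := Complex.measurable_re.comp hφ
  have mim : Measurable fun x => (φ x).im := Complex.measurable_im.comp hφ
  have bre : ∀ x, ‖(φ x).re‖ ≤ C := fun x => (Complex.abs_re_le_norm _).trans (hC x)
  have bim : ∀ x, ‖(φ x).im‖ ≤ C := fun x => (Complex.abs_im_le_norm _).trans (hC x)
  have h1 := sum_integral_inner_mul_sq_le ha mre bre
  have h2 := sum_integral_inner_mul_sq_le ha mim bim
  have i1 : Integrable (fun x => (φ x).re ^ 2) (gaussMeasure E) := by
    have := PolyGrowth.of_norm_le bre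
    simpa only [pow_two] using (this.mul this).integrable (mre.mul mre).aestronglyMeasurable
  have i2 : Integrable (fun x => (φ x).im ^ 2) (gaussMeasure E) := by
    have := PolyGrowth.of_norm_le bim
    simpa only [pow_two] using (this.mul this).integrable (mim.mul mim).aestronglyMeasurable
  simp only [← Complex.normSq_eq_norm_sq, Complex.normSq_apply, ← pow_two, hre, him]
  rw [integral_add i1 i2, Finset.sum_add_distrib, mul_add]
  exact add_le_add h1 h2

end Gaussian

end SchurMultiplier


namespace SchurMultiplier

open Matrix MeasureTheory
open scoped RealInnerProductSpace ComplexOrder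

/-! ### Noncommutative Khintchine inequality via Gaussian integration by parts -/

section Khintchine

attribute [local instance] Matrix.linftyOpNormedRing Matrix.linftyOpNormedAlgebra

variable {ι : Type*} [Fintype ι] [DecidableEq ι] {κ : Type*} [Fintype κ]
  {E : Type*} [NormedAddCommGroup E] [InnerProductSpace ℝ E]

/-- The real part of `tr (b M)`, as a continuous linear functional of `M`. -/
def reTraceMul (b : Matrix ι ι ℂ) : Matrix ι ι ℂ →L[ℝ] ℝ :=
  LinearMap.toContinuousLinearMap
    (Complex.reLm ∘ₗ Matrix.traceLinearMap ι ℝ ℂ ∘ₗ LinearMap.mulLeft ℝ b)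

theorem reTraceMul_apply (b M : Matrix ι ι ℂ) : reTraceMul b M = (trace (b * M)).re := rfl

/-- The matrix-valued linear map `x ↦ ∑ i, ⟪e i, x⟫ b i`. -/
def gaussSum (e : κ → E) (b : κ → Matrix ι ι ℂ) : E →L[ℝ] Matrix ι ι ℂ :=
  ∑ i, (innerSL ℝ (e i)).smulRight (b i)

theorem gaussSum_apply (e : κ → E) (b : κ → Matrix ι ι ℂ) (x : E) :
    gaussSum e b x = ∑ i, ⟪e i, x⟫ • b i := by
  simp [gaussSum]

theorem gaussSum_isHermitian (e : κ → E) {b : κ → Matrix ι ι ℂ} (hb : ∀ i, (b i).IsHermitian)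
    (x : E) : (gaussSum e b x).IsHermitian := by
  rw [gaussSum_apply, IsHermitian, conjTranspose_sum]
  refine Finset.sum_congr rfl fun i _ => ?_
  rw [conjTranspose_smul, (hb i).eq, star_trivial]

theorem polyGrowth_gaussSum_pow (e : κ → E) (b : κ → Matrix ι ι ℂ) (n : ℕ) :
    PolyGrowth fun x => gaussSum e b x ^ n := by
  induction n with
  | zero => exact PolyGrowth.of_norm_le (C := ‖(1 : Matrix ι ι ℂ)‖) (by simp)
  | succ n ih =>
    simp only [pow_succ]
    exact ih.mul (PolyGrowth.norm_id.mono (ContinuousLinearMap.opNorm_nonneg (gaussSum e b)) fun x => by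
      rw [norm_norm]; exact (gaussSum e b).le_opNorm x)

theorem polyGrowth_reTraceMul (c : Matrix ι ι ℂ) {f : E → Matrix ι ι ℂ} (hf : PolyGrowth f) :
    PolyGrowth fun x => reTraceMul c (f x) :=
  hf.mono (ContinuousLinearMap.opNorm_nonneg (reTraceMul c)) fun x => (reTraceMul c).le_opNorm (f x)

theorem hasFDerivAt_reTraceMul_pow (e : κ → E) (b : κ → Matrix ι ι ℂ) (c : Matrix ι ι ℂ) (n : ℕ)
    (x : E) : HasFDerivAt (fun x => reTraceMul c (gaussSum e b x ^ n))
      ((reTraceMul c).comp (∑ i ∈ Finset.range n, MulOpposite.op (gaussSum e b x ^ i) •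
        gaussSum e b x ^ (n.pred - i) • gaussSum e b)) x :=
  (reTraceMul c).hasFDerivAt.comp x ((gaussSum e b).hasFDerivAt.fun_pow' n)

theorem fderiv_reTraceMul_pow (e : κ → E) (b : κ → Matrix ι ι ℂ) (c : Matrix ι ι ℂ) (n : ℕ)
    (x v : E) : fderiv ℝ (fun x => reTraceMul c (gaussSum e b x ^ n)) x v =
      ∑ i ∈ Finset.range n,
        reTraceMul c (gaussSum e b x ^ (n - 1 - i) * gaussSum e b v * gaussSum e b x ^ i) := by
  rw [(hasFDerivAt_reTraceMul_pow e b c n x).fderiv]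
  simp

/-- The noncommutative Khintchine inequality for Gaussian sums with Hermitian coefficients. -/
theorem integral_schattenPow_gaussSum_le (k : ℕ) : ∃ C : ℝ, 0 ≤ C ∧
    ∀ {ι : Type*} [Fintype ι] [DecidableEq ι] {κ : Type*} [Fintype κ]
      {E : Type*} [NormedAddCommGroup E] [InnerProductSpace ℝ E] [FiniteDimensional ℝ E]
      [MeasurableSpace E] [BorelSpace E] (e : OrthonormalBasis κ ℝ E)
      (b : κ → Matrix ι ι ℂ) (_ : ∀ i, (b i).IsHermitian),
      Integrable (fun x => schattenPow k (gaussSum e b x)) (gaussMeasure E) ∧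
      ∫ x, schattenPow k (gaussSum e b x) ∂(gaussMeasure E) ≤
        C * (trace ((∑ i, b i * b i) ^ (2 ^ k))).re := by
  obtain ⟨n, hn⟩ : ∃ n, 2 ^ k = n + 1 := Nat.exists_eq_succ_of_ne_zero (by positivity)
  have hq : 2 ^ (k + 1) = 2 * n + 1 + 1 := by rw [pow_succ, hn]; ring
  -- Differentiating `X^(2n+1)` yields `2n + 1` terms; this `ε` leaves exactly half of the unknown
  -- integral to absorb.
  set ε : ℝ := (2 * (2 * n + 1))⁻¹ with hε
  have hε0 : 0 < ε := by positivity
  refine ⟨2 * ((2 * n + 1) * (ε ^ n)⁻¹), by positivity, ?_⟩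
  intro ι _ _ κ _ E _ _ _ _ _ e b hb
  classical
  set X := gaussSum e b with hX
  have hXH : ∀ x, (X x).IsHermitian := gaussSum_isHermitian e hb
  have hT : ∀ x, schattenPow k (X x) = (trace (X x ^ (2 * n + 1 + 1))).re := fun x => by
    rw [schattenPow_of_isHermitian k (hXH x), hq]
  have hXc : Continuous X := X.continuous
  have hint : ∀ m : ℕ, Integrable (fun x => reTraceMul 1 (X x ^ m)) (gaussMeasure E) := fun m =>
    (polyGrowth_reTraceMul 1 (polyGrowth_gaussSum_pow _ b m)).integrable
      ((reTraceMul 1).continuous.comp (hXc.pow m)).aestronglyMeasurable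
  have hT' : ∀ x, schattenPow k (X x) = reTraceMul 1 (X x ^ (2 * n + 1 + 1)) := fun x => by
    rw [hT, reTraceMul_apply, Matrix.one_mul]
  have hTint : Integrable (fun x => schattenPow k (X x)) (gaussMeasure E) := by
    simp only [hT']; exact hint _
  refine ⟨hTint, ?_⟩
  set P := ∑ i, b i * b i with hP
  have hPp : P.PosSemidef := posSemidef_sum _ fun i _ => by
    have := posSemidef_conjTranspose_mul_self (b i)
    rwa [(hb i).eq] at this
  have hXe : ∀ i, X (e i) = b i := fun i => by
    rw [hX, gaussSum_apply, Finset.sum_eq_single i]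
    · rw [e.inner_eq_one, one_smul]
    · intro j _ hj
      rw [e.inner_eq_zero hj, zero_smul]
    · simp
  have hfd : ∀ i x, fderiv ℝ (fun x => reTraceMul (b i) (X x ^ (2 * n + 1))) x (e i) =
      ∑ j ∈ Finset.range (2 * n + 1),
        reTraceMul (b i) (X x ^ (2 * n - j) * b i * X x ^ j) := fun i x => by
    rw [fderiv_reTraceMul_pow, ← hX, hXe]
    rfl
  have hfc : ∀ i, Continuous fun x =>
      fderiv ℝ (fun x => reTraceMul (b i) (X x ^ (2 * n + 1))) x (e i) := fun i => by
    simp only [hfd]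
    refine continuous_finsetSum _ fun j _ => (reTraceMul (b i)).continuous.comp ?_
    exact ((hXc.pow _).mul continuous_const).mul (hXc.pow _)
  have hfg : ∀ i, PolyGrowth fun x =>
      fderiv ℝ (fun x => reTraceMul (b i) (X x ^ (2 * n + 1))) x (e i) := fun i => by
    simp only [hfd]
    refine PolyGrowth.sum _ fun j _ => polyGrowth_reTraceMul _ ?_
    exact ((polyGrowth_gaussSum_pow _ b _).mul (PolyGrowth.of_norm_le (fun _ => le_rfl))).mul
      (polyGrowth_gaussSum_pow _ b _)
  have hfdi : ∀ i, Integrable (fun x =>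
      fderiv ℝ (fun x => reTraceMul (b i) (X x ^ (2 * n + 1))) x (e i)) (gaussMeasure E) :=
    fun i => (hfg i).integrable (hfc i).aestronglyMeasurable
  have hFg : ∀ i, PolyGrowth fun x => reTraceMul (b i) (X x ^ (2 * n + 1)) := fun i =>
    polyGrowth_reTraceMul _ (polyGrowth_gaussSum_pow _ b _)
  have hFc : ∀ i, Continuous fun x => reTraceMul (b i) (X x ^ (2 * n + 1)) := fun i =>
    (reTraceMul (b i)).continuous.comp (hXc.pow _)
  -- Write one factor of `X^(2n+2)` as `∑ ⟪e_i, x⟫ b_i` and integrate by parts in the direction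
  -- `e_i`, where the derivative of `X` is `b_i`.
  have h1 : ∫ x, schattenPow k (X x) ∂(gaussMeasure E) =
      (2 * Real.pi)⁻¹ * ∫ x, ∑ i,
        fderiv ℝ (fun x => reTraceMul (b i) (X x ^ (2 * n + 1))) x (e i) ∂(gaussMeasure E) := by
    rw [integral_finsetSum _ fun i _ => hfdi i, Finset.mul_sum]
    have : ∀ x, schattenPow k (X x) = ∑ i, ⟪e i, x⟫ * reTraceMul (b i) (X x ^ (2 * n + 1)) := by
      intro x
      rw [hT, pow_succ']
      nth_rewrite 1 [hX]
      rw [gaussSum_apply, Matrix.sum_mul, trace_sum, Complex.re_sum]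
      refine Finset.sum_congr rfl fun i _ => ?_
      rw [Matrix.smul_mul, trace_smul, Complex.smul_re, reTraceMul_apply, smul_eq_mul]
    simp only [this]
    rw [integral_finsetSum]
    · refine Finset.sum_congr rfl fun i _ => ?_
      exact integral_inner_mul_gaussMeasure (e i)
        (fun x => (hasFDerivAt_reTraceMul_pow _ b (b i) _ x).differentiableAt) (hFg i)
        (hfc i) (hfg i)
    · intro i _
      exact ((polyGrowth_inner (e i)).mul (hFg i)).integrable
        (Continuous.mul (by fun_prop) (hFc i)).aestronglyMeasurable
  have h2 : ∀ x, ∑ i, fderiv ℝ (fun x => reTraceMul (b i) (X x ^ (2 * n + 1))) x (e i) ≤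
      (2 * n + 1) * (ε * schattenPow k (X x) + (ε ^ n)⁻¹ * (trace (P ^ (n + 1))).re) := by
    intro x
    have hX2 : (X x * X x).PosSemidef := by
      have := posSemidef_conjTranspose_mul_self (X x)
      rwa [(hXH x).eq] at this
    have h3 := trace_young_psd hX2 hPp n hε0
    have h4 : ∀ m : ℕ, (X x * X x) ^ m = X x ^ (2 * m) := fun m => by rw [pow_mul, pow_two]
    rw [h4, h4, show 2 * (n + 1) = 2 * n + 1 + 1 by ring, ← hT] at h3
    refine le_trans ?_ (mul_le_mul_of_nonneg_left h3 (by positivity))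
    rw [trace_mul_comm, hP, Matrix.sum_mul, trace_sum, Complex.re_sum, Finset.mul_sum]
    refine Finset.sum_le_sum fun i _ => ?_
    rw [hfd]
    -- The two copies of `b_i` are separated by powers of `X`; bringing them together only increases
    -- the trace, and then `∑ b_i²` appears.
    have h5 : ∀ j ∈ Finset.range (2 * n + 1), reTraceMul (b i) (X x ^ (2 * n - j) * b i * X x ^ j) ≤
        (trace (b i * b i * X x ^ (2 * n))).re := by
      intro j hj
      have hj : 2 * n - j + j = 2 * n := Nat.sub_add_cancel (Nat.lt_succ_iff.1 (Finset.mem_range.1 hj))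
      have := trace_split_pow_le (hb i) (hXH x) (k := 2 * n - j) (l := j)
        (by rw [hj]; exact even_two_mul n)
      rw [hj] at this
      rw [reTraceMul_apply]
      simpa only [Matrix.mul_assoc] using this
    refine (Finset.sum_le_sum h5).trans ?_
    rw [Finset.sum_const, Finset.card_range, nsmul_eq_mul]
    push_cast
    exact le_rfl
  have h6 : ∫ x, ∑ i, fderiv ℝ (fun x => reTraceMul (b i) (X x ^ (2 * n + 1))) x (e i)
      ∂(gaussMeasure E) ≤ ∫ x, (2 * n + 1) * (ε * schattenPow k (X x) +
        (ε ^ n)⁻¹ * (trace (P ^ (n + 1))).re) ∂(gaussMeasure E) :=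
    integral_mono (integrable_finsetSum _ fun i _ => hfdi i)
      (((hTint.const_mul ε).add (integrable_const _)).const_mul _) h2
  rw [integral_const_mul, integral_add (hTint.const_mul ε) (integrable_const _), integral_const_mul,
    integral_const, probReal_univ, one_smul] at h6
  rw [hn]
  set I := ∫ x, schattenPow k (X x) ∂(gaussMeasure E)
  have hI : 0 ≤ I := integral_nonneg fun x => schattenPow_nonneg _ _
  have ht : 0 ≤ (trace (P ^ (n + 1))).re :=
    (Complex.nonneg_iff.1 (hPp.pow _).trace_nonneg).1
  have hpi : (2 * Real.pi)⁻¹ ≤ 1 := inv_le_one_of_one_le₀ (by linarith [Real.pi_gt_three])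
  have hpi0 : 0 < (2 * Real.pi)⁻¹ := by positivity
  have h7 : I ≤ (2 * n + 1) * (ε * I + (ε ^ n)⁻¹ * (trace (P ^ (n + 1))).re) := by
    have h8 : 0 ≤ (2 * n + 1) * (ε * I + (ε ^ n)⁻¹ * (trace (P ^ (n + 1))).re) := by positivity
    calc I ≤ (2 * Real.pi)⁻¹ *
          ((2 * n + 1) * (ε * I + (ε ^ n)⁻¹ * (trace (P ^ (n + 1))).re)) := by
          exact h1.le.trans (mul_le_mul_of_nonneg_left h6 hpi0.le)
      _ ≤ _ := mul_le_of_le_one_left h8 hpi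
  have h9 : (2 * (n : ℝ) + 1) * ε = 1 / 2 := by
    rw [hε]; field_simp
  have h10 : (2 * (n : ℝ) + 1) * (ε * I) = 1 / 2 * I := by rw [← mul_assoc, h9]
  rw [mul_add, h10] at h7
  linarith

end Khintchine

end SchurMultiplier


namespace SchurMultiplier

open Matrix MeasureTheory
open scoped RealInnerProductSpace ComplexOrder

/-! ### Square function bounds for Gaussian coefficients -/

section SquareFunction

variable {ι : Type*} [Fintype ι] [DecidableEq ι] {κ : Type*} [Fintype κ]
  {E : Type*} [NormedAddCommGroup E] [InnerProductSpace ℝ E] [FiniteDimensional ℝ E]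
  [MeasurableSpace E] [BorelSpace E]

theorem measurable_trace_mul_sq {S : E → Matrix ι ι ℂ}
    (hm : ∀ j k, Measurable fun x => S x j k) (R : Matrix ι ι ℂ) :
    Measurable fun x => (trace (R * (S x * S x))).re := by
  refine Complex.measurable_re.comp ?_
  simp only [trace, diag_apply, Matrix.mul_apply]
  refine Finset.measurable_sum _ fun i _ => Finset.measurable_sum _ fun j _ => ?_
  exact measurable_const.mul (Finset.measurable_sum _ fun l _ => (hm _ _).mul (hm _ _))

theorem norm_trace_le_of_bounded {S : E → Matrix ι ι ℂ} {C : ℝ} (hC : ∀ x j k, ‖S x j k‖ ≤ C)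
    (R : Matrix ι ι ℂ) : ∃ D, ∀ x, ‖(trace (R * (S x * S x))).re‖ ≤ D := by
  refine ⟨∑ i, ∑ j, ‖R i j‖ * ∑ _l : ι, C * C, fun x => ?_⟩
  refine (Complex.abs_re_le_norm _).trans ?_
  simp only [trace, diag_apply, Matrix.mul_apply]
  refine (norm_sum_le _ _).trans (Finset.sum_le_sum fun i _ => ?_)
  refine (norm_sum_le _ _).trans (Finset.sum_le_sum fun j _ => ?_)
  rw [norm_mul]
  refine mul_le_mul_of_nonneg_left ?_ (norm_nonneg _)
  refine (norm_sum_le _ _).trans (Finset.sum_le_sum fun l _ => ?_)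
  rw [norm_mul]
  exact mul_le_mul (hC _ _ _) (hC _ _ _) (norm_nonneg _) ((norm_nonneg _).trans (hC x j l))

theorem trace_conjTranspose_mul_sq {G B : Matrix ι ι ℂ} (hB : B.IsHermitian) :
    (trace (Gᴴ * G * (B * B))).re = ∑ r, ∑ s, ‖(B * Gᴴ) r s‖ ^ 2 := by
  rw [← schattenPow_zero_eq, schattenPow, pow_zero, pow_one, conjTranspose_mul,
    conjTranspose_conjTranspose, hB.eq, Matrix.mul_assoc, trace_mul_comm]
  simp only [Matrix.mul_assoc]

/-- Bessel's inequality for matrix-valued functions. -/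
theorem trace_mul_sum_sq_le {a : κ → E} (ha : ∀ v : κ → ℝ, ‖∑ i, v i • a i‖ ^ 2 ≤ ∑ i, v i ^ 2)
    {S : E → Matrix ι ι ℂ} (hm : ∀ j k, Measurable fun x => S x j k) {C : ℝ}
    (hC : ∀ x j k, ‖S x j k‖ ≤ C) (hS : ∀ x, (S x).IsHermitian)
    {b : κ → Matrix ι ι ℂ} (hb : ∀ i, (b i).IsHermitian)
    (hbS : ∀ i j k, b i j k = ∫ x, (⟪a i, x⟫ : ℂ) * S x j k ∂(gaussMeasure E))
    {R : Matrix ι ι ℂ} (hR : R.PosSemidef) :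
    (trace (R * ∑ i, b i * b i)).re ≤
      (2 * Real.pi)⁻¹ * ∫ x, (trace (R * (S x * S x))).re ∂(gaussMeasure E) := by
  -- With `R = GᴴG`, both traces are sums of squared entries of `B Gᴴ`, so the scalar Bessel
  -- inequality applies entry by entry.
  obtain ⟨G, rfl⟩ := exists_eq_conjTranspose_mul_self hR
  have hφm : ∀ r s, Measurable fun x => (S x * Gᴴ) r s := fun r s => by
    simp only [Matrix.mul_apply]
    exact Finset.measurable_sum _ fun l _ => (hm _ _).mul measurable_const
  have hφC : ∀ r s x, ‖(S x * Gᴴ) r s‖ ≤ ∑ l, C * ‖Gᴴ l s‖ := fun r s x => by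
    rw [Matrix.mul_apply]
    refine (norm_sum_le _ _).trans (Finset.sum_le_sum fun l _ => ?_)
    rw [norm_mul]
    exact mul_le_mul_of_nonneg_right (hC _ _ _) (norm_nonneg _)
  have hint : ∀ i j k, Integrable (fun x => (⟪a i, x⟫ : ℂ) * S x j k) (gaussMeasure E) := by
    intro i j k
    refine PolyGrowth.integrable (PolyGrowth.mul ?_ (PolyGrowth.of_norm_le (hC · j k)))
      (Measurable.mul (by fun_prop) (hm j k)).aestronglyMeasurable
    exact (polyGrowth_inner (a i)).mono zero_le_one (by simp)
  have hbG : ∀ i r s, (b i * Gᴴ) r s =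
      ∫ x, (⟪a i, x⟫ : ℂ) * (S x * Gᴴ) r s ∂(gaussMeasure E) := by
    intro i r s
    simp only [Matrix.mul_apply, hbS, Finset.mul_sum, ← mul_assoc]
    rw [integral_finsetSum _ fun l _ => (hint i r l).mul_const _]
    refine Finset.sum_congr rfl fun l _ => ?_
    rw [integral_mul_const]
  have h1 : ∀ r s, ∑ i, ‖(b i * Gᴴ) r s‖ ^ 2 ≤
      (2 * Real.pi)⁻¹ * ∫ x, ‖(S x * Gᴴ) r s‖ ^ 2 ∂(gaussMeasure E) := fun r s => by
    simp only [hbG]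
    exact sum_norm_integral_inner_mul_sq_le ha (hφm r s) (hφC r s)
  have hsq : ∀ r s, Integrable (fun x => ‖(S x * Gᴴ) r s‖ ^ 2) (gaussMeasure E) := fun r s => by
    have h := PolyGrowth.of_norm_le (E := E) (f := fun x => ‖(S x * Gᴴ) r s‖)
      (fun x => by rw [norm_norm]; exact hφC r s x)
    simpa only [pow_two] using (h.mul h).integrable
      ((hφm r s).norm.mul (hφm r s).norm).aestronglyMeasurable
  rw [Matrix.mul_sum, trace_sum, Complex.re_sum]
  simp only [trace_conjTranspose_mul_sq (hb _), trace_conjTranspose_mul_sq (hS _)]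
  rw [integral_finsetSum _ fun r _ => integrable_finsetSum _ fun s _ => hsq r s,
    Finset.sum_comm, Finset.mul_sum]
  refine Finset.sum_le_sum fun r _ => ?_
  rw [integral_finsetSum _ fun s _ => hsq r s, Finset.sum_comm, Finset.mul_sum]
  exact Finset.sum_le_sum fun s _ => h1 r s

/-- The square function of the first chaos part of a bounded function is bounded. -/
theorem trace_sum_sq_pow_le {k : ℕ} {a : κ → E}
    (ha : ∀ v : κ → ℝ, ‖∑ i, v i • a i‖ ^ 2 ≤ ∑ i, v i ^ 2)
    {S : E → Matrix ι ι ℂ} (hm : ∀ j k, Measurable fun x => S x j k) {C : ℝ}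
    (hC : ∀ x j k, ‖S x j k‖ ≤ C) (hS : ∀ x, (S x).IsHermitian)
    {b : κ → Matrix ι ι ℂ} (hb : ∀ i, (b i).IsHermitian)
    (hbS : ∀ i j k, b i j k = ∫ x, (⟪a i, x⟫ : ℂ) * S x j k ∂(gaussMeasure E))
    {K : ℝ} (hK : ∀ x, schattenPow k (S x) ≤ K) :
    (trace ((∑ i, b i * b i) ^ 2 ^ k)).re ≤ 2 * 2 ^ 2 ^ k * K := by
  obtain ⟨n, hn⟩ : ∃ n, 2 ^ k = n + 1 := Nat.exists_eq_succ_of_ne_zero (by positivity)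
  set P := ∑ i, b i * b i with hP
  have hPp : P.PosSemidef := posSemidef_sum _ fun i _ => by
    have := posSemidef_conjTranspose_mul_self (b i)
    rwa [(hb i).eq] at this
  have hSp : ∀ x, (S x * S x).PosSemidef := fun x => by
    have := posSemidef_conjTranspose_mul_self (S x)
    rwa [(hS x).eq] at this
  -- Testing against `R = P^n` puts `tr P^(n+1)` on the left. Young's inequality with `ε = 1/2` then
  -- returns half of it, together with `tr S^(2n+2)`.
  have h1 := trace_mul_sum_sq_le ha hm hC hS hb hbS (hPp.pow n)
  rw [← hP, ← pow_succ] at h1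
  set t := (trace (P ^ (n + 1))).re
  have ht : 0 ≤ t := (Complex.nonneg_iff.1 (hPp.pow _).trace_nonneg).1
  have hK0 : 0 ≤ K := (schattenPow_nonneg _ _).trans (hK 0)
  have h2 : ∀ x, (trace (P ^ n * (S x * S x))).re ≤ 1 / 2 * t + 2 ^ n * K := fun x => by
    refine (trace_young_psd hPp (hSp x) n (show (0 : ℝ) < 1 / 2 by norm_num)).trans ?_
    have h3 := hK x
    rw [schattenPow, (hS x).eq, hn] at h3
    rw [one_div, inv_pow, inv_inv]
    gcongr
  obtain ⟨D, hD⟩ := norm_trace_le_of_bounded hC (P ^ n)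
  have hint : Integrable (fun x => (trace (P ^ n * (S x * S x))).re) (gaussMeasure E) :=
    (PolyGrowth.of_norm_le hD).integrable (measurable_trace_mul_sq hm _).aestronglyMeasurable
  have h3 := integral_mono hint (integrable_const _) h2
  rw [integral_const, probReal_univ, one_smul] at h3
  have hpi : (2 * Real.pi)⁻¹ ≤ 1 := inv_le_one_of_one_le₀ (by linarith [Real.pi_gt_three])
  have h4 : t ≤ 1 / 2 * t + 2 ^ n * K := by
    refine h1.trans ((mul_le_mul_of_nonneg_left h3 (by positivity)).trans ?_)
    exact mul_le_of_le_one_left (by positivity) hpi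
  rw [hn]
  have : (2 : ℝ) ^ (n + 1) * K = 2 * (2 ^ n * K) := by ring
  have h5 : 0 ≤ 2 ^ n * K := by positivity
  rw [mul_assoc, this]
  linarith

end SquareFunction

/-! ### Sign symbols and real Grothendieck symbols -/

section Symbols

variable {ι : Type*} [Fintype ι] [DecidableEq ι]
  {E : Type*} [NormedAddCommGroup E] [InnerProductSpace ℝ E]

theorem schur_isHermitian {m : ι → ι → ℂ} (hm : ∀ j k, star (m j k) = m k j)
    {A : Matrix ι ι ℂ} (hA : A.IsHermitian) : (schur m A).IsHermitian := by
  ext j k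
  rw [conjTranspose_apply, schur, of_apply, of_apply, star_mul', hm, hA.apply]

/-- The sign symbol in the direction `x`. -/
def signSymbol (u : ι → E) (x : E) (j k : ι) : ℂ := sgn ⟪u j + u k, x⟫

/-- The sum `⟪u_j, x⟫ + ⟪u_k, x⟫` is nonnegative exactly when `-⟪u_k, x⟫ ≤ ⟪u_j, x⟫`: each direction
gives a triangular truncation. The convention `sgn 0 = 1` matches the weak inequality. -/
theorem signSymbol_eq_orderSymbol (u : ι → E) (x : E) :
    signSymbol u x = orderSymbol (fun j => ⟪u j, x⟫) (fun k => -⟪u k, x⟫) := by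
  ext j k
  simp only [signSymbol, orderSymbol, sgn, inner_add_left, neg_le_iff_add_nonneg]
  split_ifs <;> simp

theorem star_signSymbol (u : ι → E) (x : E) (j k : ι) :
    star (signSymbol u x j k) = signSymbol u x k j := by
  rw [signSymbol, signSymbol, Complex.star_def, Complex.conj_ofReal, add_comm]

/-- The symbol `⟪(u j + u' k)/‖u j + u' k‖, L ((w j + w' k)/‖w j + w' k‖)⟫` in a real Hilbert
space. -/
def realSymbol (L : E →L[ℝ] E) (u u' w w' : ι → E) (j k : ι) : ℂ :=
  (⟪unit (u j + u' k), L (unit (w j + w' k))⟫ : ℝ)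

theorem star_realSymbol (L : E →L[ℝ] E) (u w : ι → E) (j k : ι) :
    star (realSymbol L u u w w j k) = realSymbol L u u w w k j := by
  rw [realSymbol, realSymbol, Complex.star_def, Complex.conj_ofReal, add_comm (u j),
    add_comm (w j)]

end Symbols

/-! ### The real symbol on dyadic Schatten classes -/

section Dyadic

/-- The core estimate: sign truncation by `w`, projection to linear Gaussian coefficients,
Khintchine, sign truncation by `u`, and averaging. Taking `u' = u` and `w' = w` makes the symbols
symmetric, so every matrix involved is Hermitian. -/
theorem schattenPow_realSymbol_le_of_isHermitian (k : ℕ) : ∃ C : ℝ, 0 ≤ C ∧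
    ∀ {ι : Type*} [Fintype ι] [DecidableEq ι] {E : Type*} [NormedAddCommGroup E]
      [InnerProductSpace ℝ E] [FiniteDimensional ℝ E] [MeasurableSpace E] [BorelSpace E]
      (L : E →L[ℝ] E) (_ : ‖L‖ ≤ 1) (u w : ι → E) (A : Matrix ι ι ℂ) (_ : A.IsHermitian),
      schattenPow k (schur (realSymbol L u u w w) A) ≤ C * schattenPow k A := by
  obtain ⟨h, hh, hord⟩ := schattenPow_orderSymbol_le k
  obtain ⟨K, hK, hkhin⟩ := integral_schattenPow_gaussSum_le k
  obtain ⟨n, hn⟩ : ∃ n, 2 ^ (k + 1) = n + 1 := Nat.exists_eq_succ_of_ne_zero (by positivity)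
  refine ⟨(((4 * Real.pi) ^ 2) ^ 2) ^ 2 ^ k * (2 * (2 ^ n * (h * (K * (2 * 2 ^ 2 ^ k * h))))),
    by positivity, ?_⟩
  intro ι _ _ E _ _ _ _ _ L hL u w A hA
  obtain ⟨c, hc, hrep⟩ := exists_integral_sgn_mul E
  have hc0 : 0 < c := lt_of_lt_of_le (by positivity) hc
  set e := stdOrthonormalBasis ℝ E
  have hcc : CompleteSpace E := FiniteDimensional.complete ℝ E
  -- Using `L* e_i` instead of `e_i` inserts `L` into the symbol; since `L*` is a contraction, the
  -- Bessel hypothesis survives.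
  set a := fun i => ContinuousLinearMap.adjoint L (e i) with ha
  have haB : ∀ v : Fin (Module.finrank ℝ E) → ℝ, ‖∑ i, v i • a i‖ ^ 2 ≤ ∑ i, v i ^ 2 := by
    intro v
    have h1 : ∑ i, v i • a i = ContinuousLinearMap.adjoint L (∑ i, v i • e i) := by
      simp [ha, map_sum]
    have h2 : ‖∑ i, v i • e i‖ ^ 2 = ∑ i, v i ^ 2 := by
      rw [← e.sum_sq_norm_inner_right]
      refine Finset.sum_congr rfl fun i _ => ?_
      rw [e.orthonormal.inner_right_fintype, Real.norm_eq_abs, sq_abs]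
    rw [h1, ← h2]
    refine pow_le_pow_left₀ (norm_nonneg _) ?_ 2
    refine (ContinuousLinearMap.le_opNorm _ _).trans (mul_le_of_le_one_left (norm_nonneg _) ?_)
    rwa [LinearIsometryEquiv.norm_map]
  set S := fun x => schur (signSymbol w x) A with hS
  have hSH : ∀ x, (S x).IsHermitian := fun x => schur_isHermitian (star_signSymbol w x) hA
  have hmeas : ∀ (u : ι → E) j k, Measurable fun x => signSymbol u x j k := fun u j k => by
    unfold signSymbol
    exact Complex.measurable_ofReal.comp (measurable_sgn.comp (by fun_prop))
  have hSm : ∀ j k, Measurable fun x => S x j k := fun j k => (hmeas w j k).mul measurable_const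
  have hSC : ∀ x j k, ‖S x j k‖ ≤ ∑ j, ∑ k, ‖A j k‖ := fun x j k => by
    simp only [hS, schur, of_apply]
    rw [norm_mul, signSymbol, Complex.norm_real, Real.norm_eq_abs, abs_sgn,
      one_mul]
    refine le_trans ?_ (Finset.single_le_sum (f := fun j => ∑ k, ‖A j k‖)
      (fun _ _ => Finset.sum_nonneg fun _ _ => norm_nonneg _) (Finset.mem_univ j))
    exact Finset.single_le_sum (f := fun k => ‖A j k‖) (fun _ _ => norm_nonneg _)
      (Finset.mem_univ k)
  have hSK : ∀ x, schattenPow k (S x) ≤ h * schattenPow k A := fun x => by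
    rw [hS]
    simp only [signSymbol_eq_orderSymbol]
    exact hord _ _ A
  set V := fun j k => L (unit (w j + w k)) with hV
  have hVs : ∀ j k, V j k = V k j := fun j k => by simp only [hV, add_comm (w j)]
  set b : Fin (Module.finrank ℝ E) → Matrix ι ι ℂ :=
    fun i => schur (fun j k => ((c * ⟪e i, V j k⟫ : ℝ) : ℂ)) A with hb
  have hbH : ∀ i, (b i).IsHermitian := fun i => schur_isHermitian (fun j k => by
    rw [Complex.star_def, Complex.conj_ofReal, hVs]) hA
  have hbS : ∀ i j k, b i j k = ∫ x, (⟪a i, x⟫ : ℂ) * S x j k ∂(gaussMeasure E) := by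
    intro i j k
    have h1 := hrep (w j + w k) (a i)
    have h2 : ⟪unit (w j + w k), a i⟫ = ⟪e i, V j k⟫ := by
      rw [ha, ContinuousLinearMap.adjoint_inner_right, real_inner_comm]
    rw [h2] at h1
    simp only [hb, schur, of_apply]
    rw [← h1, ← integral_complex_ofReal, ← integral_mul_const]
    refine integral_congr_ae (Filter.Eventually.of_forall fun x => ?_)
    simp only [hS, schur, of_apply, signSymbol, Complex.ofReal_mul]
    ring
  have hP := trace_sum_sq_pow_le (k := k) haB hSm hSC hSH hbH hbS hSK
  obtain ⟨hXint, hX⟩ := hkhin e b hbH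
  set X := gaussSum e b with hXdef
  -- Resumming over the basis, the Gaussian sum is the Schur product with the linear form `c⟪V_jk,
  -- x⟫`, ready for a second use of the sign representation.
  have hXe : ∀ x j k, X x j k = ((c * ⟪V j k, x⟫ : ℝ) : ℂ) * A j k := by
    intro x j k
    rw [hXdef, gaussSum_apply, Matrix.sum_apply]
    simp only [Matrix.smul_apply, hb, schur, of_apply, Complex.real_smul]
    rw [← e.sum_inner_mul_inner (V j k) x, Finset.mul_sum, Complex.ofReal_sum, Finset.sum_mul]
    refine Finset.sum_congr rfl fun i _ => ?_
    rw [real_inner_comm (V j k) (e i)]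
    push_cast
    ring
  have hXH := gaussSum_isHermitian e hbH
  set B := schur (realSymbol L u u w w) A with hB
  have hBH : B.IsHermitian := schur_isHermitian (star_realSymbol L u w) hA
  -- Each of the two uses of the Gaussian representation contributes a factor `c`.
  set B' := ((c ^ 2 : ℝ) : ℂ) • B with hB'
  have hB'H : B'.IsHermitian := by
    rw [IsHermitian, hB', conjTranspose_smul, hBH.eq, Complex.star_def, Complex.conj_ofReal]
  set Y := fun x => schur (signSymbol u x) (X x) with hY
  have hYH : ∀ x, (Y x).IsHermitian := fun x =>
    schur_isHermitian (star_signSymbol u x) (hXH x)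
  have hYint : ∀ j k, Integrable (fun x => Y x j k) (gaussMeasure E) := by
    intro j k
    have h1 := ((integrable_sgn_mul (u j + u k) (V j k)).ofReal (𝕜 := ℂ)).const_mul
      ((c : ℂ) * A j k)
    refine h1.congr (Filter.Eventually.of_forall fun x => ?_)
    simp only [hY, schur, of_apply, hXe, signSymbol, RCLike.ofReal_mul, Complex.ofReal_mul,
      RCLike.ofReal_eq_complex_ofReal]
    ring
  have hB'Y : ∀ j k, B' j k = ∫ x, Y x j k ∂(gaussMeasure E) := by
    intro j k
    have h1 := hrep (u j + u k) (V j k)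
    have h2 : B' j k = (c : ℂ) * A j k * ((c * ⟪unit (u j + u k), V j k⟫ : ℝ) : ℂ) := by
      rw [hB', Matrix.smul_apply, hB, schur, of_apply, realSymbol, smul_eq_mul]
      push_cast
      ring
    rw [h2, ← h1, ← integral_complex_ofReal, ← integral_const_mul]
    refine integral_congr_ae (Filter.Eventually.of_forall fun x => ?_)
    simp only [hY, schur, of_apply, hXe, signSymbol, Complex.ofReal_mul]
    ring
  have hYtr : ∀ i j, Integrable (fun x => (B' ^ n) i j * Y x j i) (gaussMeasure E) :=
    fun i j => (hYint j i).const_mul _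
  have htr : ∀ x, trace (B' ^ n * Y x) = ∑ i, ∑ j, (B' ^ n) i j * Y x j i := fun x => by
    simp only [trace, diag_apply, Matrix.mul_apply]
  have htrint : Integrable (fun x => trace (B' ^ n * Y x)) (gaussMeasure E) := by
    simp only [htr]
    exact integrable_finsetSum _ fun i _ => integrable_finsetSum _ fun j _ => hYtr i j
  -- Pairing with `B'^n` replaces convexity of the norm: the average `B' = ∫ Y` is tested against
  -- its own power, and Young's inequality separates `B'` from `Y`. Here `n + 1` is the full
  -- exponent `2^(k+1)`.
  have h1 : schattenPow k B' = ∫ x, (trace (B' ^ n * Y x)).re ∂(gaussMeasure E) := by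
    rw [schattenPow_of_isHermitian k hB'H, hn, pow_succ]
    have h2 : trace (B' ^ n * B') = ∫ x, trace (B' ^ n * Y x) ∂(gaussMeasure E) := by
      simp only [htr]
      rw [integral_finsetSum _ fun i _ => integrable_finsetSum _ fun j _ => hYtr i j]
      simp only [trace, diag_apply, Matrix.mul_apply]
      refine Finset.sum_congr rfl fun i _ => ?_
      rw [integral_finsetSum _ fun j _ => hYtr i j]
      refine Finset.sum_congr rfl fun j _ => ?_
      rw [integral_const_mul, hB'Y]
    rw [h2]
    exact (integral_re htrint).symm
  have heven : Even (n + 1) := by rw [← hn, pow_succ]; exact even_two.mul_left _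
  have h2 : ∀ x, (trace (B' ^ n * Y x)).re ≤
      1 / 2 * schattenPow k B' + 2 ^ n * (h * schattenPow k (X x)) := by
    intro x
    refine (le_abs_self _).trans ((trace_young_hermitian hB'H (hYH x) n heven
      (show (0 : ℝ) < 1 / 2 by norm_num)).trans ?_)
    rw [← hn, ← schattenPow_of_isHermitian k hB'H, ← schattenPow_of_isHermitian k (hYH x), one_div,
      inv_pow, inv_inv]
    gcongr
    rw [hY]
    simp only [signSymbol_eq_orderSymbol]
    exact hord _ _ _
  have h3 := integral_mono htrint.re ((integrable_const _).add ((hXint.const_mul h).const_mul _)) h2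
  have h4 : ∫ x, (1 / 2 * schattenPow k B' + 2 ^ n * (h * schattenPow k (X x))) ∂(gaussMeasure E) =
      1 / 2 * schattenPow k B' + 2 ^ n * (h * ∫ x, schattenPow k (X x) ∂(gaussMeasure E)) := by
    rw [integral_add (integrable_const _) ((hXint.const_mul h).const_mul _), integral_const,
      probReal_univ, one_smul, integral_const_mul, integral_const_mul]
  have h5 : schattenPow k B' ≤ 1 / 2 * schattenPow k B' +
      2 ^ n * (h * (K * (2 * 2 ^ 2 ^ k * (h * schattenPow k A)))) := by
    refine h1.le.trans (h3.trans (h4.le.trans ?_))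
    have := hX.trans (mul_le_mul_of_nonneg_left hP hK)
    gcongr
  have h6 : schattenPow k B = ((((c ^ 2) ^ 2) ^ 2 ^ k)⁻¹) * schattenPow k B' := by
    rw [hB', schattenPow_smul, Complex.norm_real, Real.norm_of_nonneg (by positivity),
      inv_mul_cancel_left₀ (by positivity)]
  -- The lower bound on `c` makes the constant independent of the dimension of `E`.
  have h7 : (((c ^ 2) ^ 2) ^ 2 ^ k)⁻¹ ≤ (((4 * Real.pi) ^ 2) ^ 2) ^ 2 ^ k := by
    rw [← inv_pow, ← inv_pow, ← inv_pow]
    have : c⁻¹ ≤ 4 * Real.pi := inv_le_of_inv_le₀ (by positivity) hc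
    gcongr
  rw [h6, mul_assoc]
  refine mul_le_mul h7 ?_ (schattenPow_nonneg _ _) (by positivity)
  linarith

/-- Only finitely many vectors occur, so `L` may be compressed to their span. The dilation of `A` on
`ι ⊕ ι` is Hermitian, and for the concatenated families the entry joining the two copies sees `u_j +
u'_k`. -/
theorem schattenPow_realSymbol_le (k : ℕ) : ∃ C : ℝ, 0 ≤ C ∧
    ∀ {ι : Type*} [Fintype ι] [DecidableEq ι] {E : Type*} [NormedAddCommGroup E]
      [InnerProductSpace ℝ E] (L : E →L[ℝ] E) (_ : ‖L‖ ≤ 1) (u u' w w' : ι → E)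
      (A : Matrix ι ι ℂ),
      schattenPow k (schur (realSymbol L u u' w w') A) ≤ C * schattenPow k A := by
  obtain ⟨C, hC, H⟩ := schattenPow_realSymbol_le_of_isHermitian k
  refine ⟨C, hC, ?_⟩
  intro ι _ _ E _ _ L hL u u' w w' A
  set K : Submodule ℝ E := Submodule.span ℝ
    (Set.range (Sum.elim u u') ∪ Set.range (Sum.elim w w')) with hK
  have : FiniteDimensional ℝ K :=
    FiniteDimensional.span_of_finite ℝ ((Set.finite_range _).union (Set.finite_range _))
  let _ : MeasurableSpace K := borel K
  have : BorelSpace K := ⟨rfl⟩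
  let LK : K →L[ℝ] K := K.orthogonalProjectionOnto ∘L L ∘L K.subtypeL
  have hLK : ‖LK‖ ≤ 1 := by
    refine ContinuousLinearMap.opNorm_le_bound _ zero_le_one fun x => ?_
    rw [one_mul]
    refine ((K.orthogonalProjectionOnto).le_opNorm _).trans ?_
    refine (mul_le_of_le_one_left (norm_nonneg _) K.orthogonalProjectionOnto_norm_le).trans ?_
    exact (L.le_opNorm _).trans (mul_le_of_le_one_left (norm_nonneg _) hL)
  let uK : ι ⊕ ι → K := fun j => ⟨Sum.elim u u' j, Submodule.subset_span (Or.inl ⟨j, rfl⟩)⟩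
  let wK : ι ⊕ ι → K := fun j => ⟨Sum.elim w w' j, Submodule.subset_span (Or.inr ⟨j, rfl⟩)⟩
  have hsym : ∀ j k, realSymbol LK uK uK wK wK j k =
      realSymbol L (Sum.elim u u') (Sum.elim u u') (Sum.elim w w') (Sum.elim w w') j k := by
    intro j k
    have hu : ∀ x : K, ((unit x : K) : E) = unit (x : E) := fun x => rfl
    rw [realSymbol, realSymbol]
    congr 1
    change ⟪unit (uK j + uK k), K.orthogonalProjectionOnto (L (unit (wK j + wK k) : K))⟫ = _
    rw [Submodule.inner_orthogonalProjectionOnto_eq_of_mem_left]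
    rfl
  have hAH : (fromBlocks 0 A Aᴴ 0 : Matrix (ι ⊕ ι) (ι ⊕ ι) ℂ).IsHermitian := by
    rw [IsHermitian, fromBlocks_conjTranspose]
    simp
  have h1 := H LK hLK uK wK _ hAH
  have h2 : schur (realSymbol LK uK uK wK wK) (fromBlocks 0 A Aᴴ 0) =
      fromBlocks 0 (schur (realSymbol L u u' w w') A)
        (schur (realSymbol L u u' w w') A)ᴴ 0 := by
    ext j k
    rw [schur, of_apply, hsym]
    rcases j with j | j <;> rcases k with k | k
    · simp
    · simp [realSymbol, schur]
    · simp [realSymbol, schur, add_comm (u' j), add_comm (w' j)]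
    · simp
  rw [h2, schattenPow_dilation, schattenPow_dilation] at h1
  linarith

end Dyadic

end SchurMultiplier


namespace SchurMultiplier

open Matrix
open scoped ComplexOrder

/-! ### Reduction of real or complex scalars to real symbols -/

section ComplexSymbol

variable {ι : Type*} [Fintype ι] [DecidableEq ι]

theorem schur_add_smul (m₁ m₂ : ι → ι → ℂ) (c : ℂ) (A : Matrix ι ι ℂ) :
    schur (fun j k => m₁ j k + c * m₂ j k) A = schur m₁ A + c • schur m₂ A := by
  ext j k
  simp only [schur, of_apply, Matrix.add_apply, Matrix.smul_apply, smul_eq_mul]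
  ring

/-- The imaginary part of `⟪x, y⟫` is the real part of `⟪x, -I y⟫`, so it is a real symbol for `-I
Λ`, still a contraction. Over `ℝ`, where `I = 0`, the second operator vanishes. -/
theorem exists_grothendieckSymbol_eq {𝕜 : Type*} [RCLike 𝕜] {H : Type*} [NormedAddCommGroup H]
    [InnerProductSpace 𝕜 H] {Γ : Type*} (u u' w w' : Γ → H) (Λ : H →L[𝕜] H) (hΛ : ‖Λ‖ ≤ 1) :
    letI := InnerProductSpace.rclikeToReal 𝕜 H
    ∃ L₁ L₂ : H →L[ℝ] H, ‖L₁‖ ≤ 1 ∧ ‖L₂‖ ≤ 1 ∧ grothendieckSymbol u u' w w' Λ =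
      fun j k => realSymbol L₁ u u' w w' j k + Complex.I * realSymbol L₂ u u' w w' j k := by
  let _ := InnerProductSpace.rclikeToReal 𝕜 H
  have hsmul : ∀ (r : ℝ) (x : H), ((r : ℝ) : 𝕜) • x = r • x := fun r x => by
    rw [RCLike.real_smul_eq_coe_smul (K := 𝕜)]
  have hI : ‖(-RCLike.I : 𝕜) • Λ‖ ≤ 1 := by
    rw [norm_smul, norm_neg]
    have : ‖(RCLike.I : 𝕜)‖ ≤ 1 := by
      rcases eq_or_ne (RCLike.I : 𝕜) 0 with h | h
      · rw [h, norm_zero]; exact zero_le_one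
      · rw [RCLike.norm_I_of_ne_zero h]
    exact mul_le_one₀ this (norm_nonneg _) hΛ
  have hbound : ∀ M : H →L[𝕜] H, ‖M‖ ≤ 1 → ‖M.restrictScalars ℝ‖ ≤ 1 := fun M hM =>
    ContinuousLinearMap.opNorm_le_bound _ zero_le_one fun x => by
      rw [one_mul]
      exact (M.le_opNorm x).trans (mul_le_of_le_one_left (norm_nonneg _) hM)
  refine ⟨Λ.restrictScalars ℝ, ((-RCLike.I : 𝕜) • Λ).restrictScalars ℝ, hbound _ hΛ, hbound _ hI, ?_⟩
  ext j k
  rw [grothendieckSymbol, hsmul, hsmul, realSymbol, realSymbol]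
  change RCLike.map 𝕜 ℂ (inner 𝕜 (unit (u j + u' k)) (Λ (unit (w j + w' k)))) =
    ((RCLike.re (inner 𝕜 (unit (u j + u' k)) (Λ (unit (w j + w' k)))) : ℝ) : ℂ) + Complex.I *
      ((RCLike.re (inner 𝕜 (unit (u j + u' k)) ((-RCLike.I : 𝕜) • Λ (unit (w j + w' k)))) : ℝ) : ℂ)
  rw [inner_smul_right, neg_mul, map_neg, RCLike.I_mul_re, neg_neg, RCLike.map_apply, mul_comm]
  simp

theorem schattenPow_grothendieckSymbol_le (k : ℕ) : ∃ C : ℝ, 0 ≤ C ∧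
    ∀ {ι : Type*} [Fintype ι] [DecidableEq ι] {𝕜 : Type*} [RCLike 𝕜] {H : Type*}
      [NormedAddCommGroup H] [InnerProductSpace 𝕜 H] (u u' w w' : ι → H) (Λ : H →L[𝕜] H)
      (_ : ‖Λ‖ ≤ 1) (A : Matrix ι ι ℂ),
      schattenPow k (schur (grothendieckSymbol u u' w w' Λ) A) ≤ C * schattenPow k A := by
  obtain ⟨C, hC, h⟩ := schattenPow_realSymbol_le k
  obtain ⟨D, hD, hadd⟩ := schattenPow_add_le k
  refine ⟨D * (C + C), by positivity, ?_⟩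
  intro ι _ _ 𝕜 _ H _ _ u u' w w' Λ hΛ A
  let _ := InnerProductSpace.rclikeToReal 𝕜 H
  obtain ⟨L₁, L₂, h₁, h₂, he⟩ := exists_grothendieckSymbol_eq u u' w w' Λ hΛ
  rw [he, schur_add_smul, mul_assoc]
  refine (hadd _ _).trans (mul_le_mul_of_nonneg_left ?_ hD)
  rw [schattenPow_smul, Complex.norm_I, one_pow, one_pow, one_mul, add_mul]
  exact add_le_add (h L₁ h₁ u u' w w' A) (h L₂ h₂ u u' w w' A)

end ComplexSymbol

end SchurMultiplier


namespace SchurMultiplier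

open Matrix
open scoped ComplexOrder

/-! ### Singular values and dyadic Schatten powers -/

section SingularValues

variable {ι : Type*} [Fintype ι] [DecidableEq ι] {κ : Type*} [Fintype κ] [DecidableEq κ]

/-- The singular value decomposition, restricted to the nonzero singular values. -/
theorem exists_singular_value_decomposition {ι : Type u} [Fintype ι] [DecidableEq ι]
    (A : Matrix ι ι ℂ) :
    ∃ (κ : Type u) (_ : Fintype κ) (_ : DecidableEq κ) (V W : Matrix ι κ ℂ) (s : κ → ℝ),
      Vᴴ * V = 1 ∧ Wᴴ * W = 1 ∧ (∀ i, 0 < s i) ∧ A = V * diagonal (fun i => (s i : ℂ)) * Wᴴ := by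
  obtain ⟨U, l, hU, hU', hA, hl⟩ := exists_unitary_diagonal (isHermitian_conjTranspose_mul_self A)
  have hl := hl (posSemidef_conjTranspose_mul_self A)
  have hAU : ∀ i j, ((A * U)ᴴ * (A * U)) i j = if i = j then (l i : ℂ) else 0 := by
    intro i j
    have : (A * U)ᴴ * (A * U) = diagonal fun i => (l i : ℂ) := by
      rw [conjTranspose_mul, Matrix.mul_assoc, ← Matrix.mul_assoc Aᴴ, hA]
      simp only [← Matrix.mul_assoc, hU, Matrix.one_mul]
      rw [Matrix.mul_assoc, hU, Matrix.mul_one]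
    rw [this, diagonal_apply]
  have hcol : ∀ i, l i = 0 → ∀ j, (A * U) j i = 0 := by
    intro i hi j
    have h1 := hAU i i
    rw [if_pos rfl, hi, Matrix.mul_apply] at h1
    have h2 : ∑ j, ‖(A * U) j i‖ ^ 2 = 0 := by
      have h3 : ((∑ j, ‖(A * U) j i‖ ^ 2 : ℝ) : ℂ) = 0 := by
        rw [← Complex.ofReal_zero, ← h1]
        push_cast
        refine Finset.sum_congr rfl fun j _ => ?_
        rw [conjTranspose_apply, Complex.star_def, Complex.conj_mul']
      exact_mod_cast h3
    have h3 := (Finset.sum_eq_zero_iff_of_nonneg fun j _ => sq_nonneg _).1 h2 j (Finset.mem_univ j)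
    exact norm_eq_zero.1 (pow_eq_zero_iff two_ne_zero |>.1 h3)
  have hs : ∀ i : {i // l i ≠ 0}, 0 < Real.sqrt (l i) := fun i =>
    Real.sqrt_pos.2 (lt_of_le_of_ne (hl i) (Ne.symm i.2))
  -- The columns of `AU` are orthogonal with squared norms `l i`. Null columns are dropped, so all
  -- singular values are positive and may later be raised to complex powers.
  refine ⟨{i // l i ≠ 0}, inferInstance, inferInstance,
    Matrix.of fun j i => (A * U) j i.1 * ((Real.sqrt (l i) : ℝ) : ℂ)⁻¹,
    Matrix.of fun j i => U j i.1, fun i => Real.sqrt (l i), ?_, ?_, hs, ?_⟩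
  · ext i j
    have h1 := hAU i j
    rw [Matrix.mul_apply] at h1 ⊢
    simp only [conjTranspose_apply, of_apply, star_mul', star_inv₀, Complex.star_def,
      Complex.conj_ofReal] at h1 ⊢
    have h2 : ∀ x, (starRingEnd ℂ) ((A * U) x i.1) * ((Real.sqrt (l i) : ℝ) : ℂ)⁻¹ *
        ((A * U) x j.1 * ((Real.sqrt (l j) : ℝ) : ℂ)⁻¹) =
        ((starRingEnd ℂ) ((A * U) x i.1) * (A * U) x j.1) *
          (((Real.sqrt (l i) : ℝ) : ℂ)⁻¹ * ((Real.sqrt (l j) : ℝ) : ℂ)⁻¹) := fun x => by ring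
    simp only [h2]
    rw [← Finset.sum_mul, h1]
    by_cases hij : i = j
    · subst hij
      rw [if_pos rfl, one_apply_eq, ← mul_inv, ← Complex.ofReal_mul, Real.mul_self_sqrt (hl _),
        mul_inv_cancel₀ (Complex.ofReal_ne_zero.2 i.2)]
    · rw [if_neg (fun h => hij (Subtype.ext h)), zero_mul, one_apply_ne hij]
  · ext i j
    have h1 := congrFun (congrFun hU i.1) j.1
    rw [Matrix.mul_apply] at h1 ⊢
    simp only [conjTranspose_apply, of_apply] at h1 ⊢
    rw [h1, one_apply, one_apply]
    simp only [Subtype.ext_iff]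
  · have h1 : A = A * U * Uᴴ := by rw [Matrix.mul_assoc, hU', Matrix.mul_one]
    conv_lhs => rw [h1]
    ext j k
    rw [Matrix.mul_apply, Matrix.mul_apply]
    have h2 : ∑ i, (A * U) j i * Uᴴ i k = ∑ i : {i // l i ≠ 0}, (A * U) j i * Uᴴ i k := by
      rw [← Finset.sum_filter_add_sum_filter_not Finset.univ (fun i => l i ≠ 0),
        Finset.sum_subtype (p := fun i => l i ≠ 0) (Finset.univ.filter fun i => l i ≠ 0)
          (by simp) (fun i => (A * U) j i * Uᴴ i k), add_eq_left]
      refine Finset.sum_eq_zero fun i hi => ?_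
      rw [hcol i (not_not.1 (Finset.mem_filter.1 hi).2), zero_mul]
    rw [h2]
    refine Finset.sum_congr rfl fun i _ => ?_
    rw [mul_diagonal, of_apply, conjTranspose_apply, conjTranspose_apply, of_apply,
      inv_mul_cancel_right₀ (Complex.ofReal_ne_zero.2 (hs i).ne')]

theorem schattenPow_singular_value_decomposition (k : ℕ) {V W : Matrix ι κ ℂ} (hV : Vᴴ * V = 1)
    (hW : Wᴴ * W = 1) (a : κ → ℂ) :
    schattenPow k (V * diagonal a * Wᴴ) = ∑ i, ‖a i‖ ^ 2 ^ (k + 1) := by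
  obtain ⟨n, hn⟩ : ∃ n, 2 ^ k = n + 1 := Nat.exists_eq_succ_of_ne_zero (by positivity)
  have h1 : (V * diagonal a * Wᴴ)ᴴ * (V * diagonal a * Wᴴ) =
      W * diagonal (fun i => star (a i) * a i) * Wᴴ := by
    rw [conjTranspose_mul, conjTranspose_mul, conjTranspose_conjTranspose, diagonal_conjTranspose]
    calc W * (diagonal (star a) * Vᴴ) * (V * diagonal a * Wᴴ)
        = W * (diagonal (star a) * (Vᴴ * V) * diagonal a) * Wᴴ := by simp only [Matrix.mul_assoc]
      _ = _ := by rw [hV, Matrix.mul_one, diagonal_mul_diagonal]; rfl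
  rw [schattenPow, h1, hn, unitary_conj_diagonal_pow hW, trace_mul_comm, ← Matrix.mul_assoc, hW,
    Matrix.one_mul, trace_diagonal, Complex.re_sum]
  refine Finset.sum_congr rfl fun i _ => ?_
  rw [Complex.star_def, Complex.conj_mul', ← hn, pow_succ' 2 k, pow_mul, ← Complex.ofReal_pow,
    ← Complex.ofReal_pow, Complex.ofReal_re]

theorem norm_conj_apply_sq_le {V W : Matrix ι κ ℂ} (hW : Wᴴ * W = 1) (Z : Matrix ι ι ℂ) (l : κ) :
    ‖(Wᴴ * Z * V) l l‖ ^ 2 ≤ ((Vᴴ * (Zᴴ * Z) * V) l l).re := by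
  have h1 : ∑ j, ‖W j l‖ ^ 2 = 1 := by
    have h2 := congrFun (congrFun hW l) l
    rw [Matrix.mul_apply, one_apply_eq] at h2
    have h3 : ((∑ j, ‖W j l‖ ^ 2 : ℝ) : ℂ) = 1 := by
      rw [← h2]
      push_cast
      refine Finset.sum_congr rfl fun j _ => ?_
      rw [conjTranspose_apply, Complex.star_def, Complex.conj_mul']
    exact_mod_cast h3
  have h2 : ((Vᴴ * (Zᴴ * Z) * V) l l).re = ∑ j, ‖(Z * V) j l‖ ^ 2 := by
    have : Vᴴ * (Zᴴ * Z) * V = (Z * V)ᴴ * (Z * V) := by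
      rw [conjTranspose_mul]; simp only [Matrix.mul_assoc]
    rw [this, Matrix.mul_apply, Complex.re_sum]
    refine Finset.sum_congr rfl fun j _ => ?_
    rw [conjTranspose_apply, Complex.star_def, Complex.conj_mul', ← Complex.ofReal_pow,
      Complex.ofReal_re]
  rw [h2, Matrix.mul_assoc, Matrix.mul_apply]
  refine (pow_le_pow_left₀ (norm_nonneg _) (norm_sum_le _ _) 2).trans ?_
  simp only [norm_mul, conjTranspose_apply, norm_star]
  refine (Finset.sum_mul_sq_le_sq_mul_sq _ _ _).trans ?_
  rw [h1, one_mul]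

/-- A dyadic Jensen inequality: Cauchy–Schwarz against a unit column is repeated, with `V` on both
sides after the first step, and squares the positive matrix each time. -/
theorem norm_conj_apply_pow_le {V W : Matrix ι κ ℂ} (hV : Vᴴ * V = 1) (hW : Wᴴ * W = 1)
    (Z : Matrix ι ι ℂ) (l : κ) (k : ℕ) :
    ‖(Wᴴ * Z * V) l l‖ ^ 2 ^ (k + 1) ≤ ((Vᴴ * (Zᴴ * Z) ^ (2 ^ k) * V : Matrix κ κ ℂ) l l).re := by
  induction k with
  | zero => simpa using norm_conj_apply_sq_le hW Z l
  | succ k ih =>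
    rw [pow_succ 2 (k + 1), pow_mul]
    refine (pow_le_pow_left₀ (by positivity) ih 2).trans ?_
    have h1 := norm_conj_apply_sq_le hV (V := V) ((Zᴴ * Z) ^ 2 ^ k) l
    have h2 : ((Zᴴ * Z) ^ 2 ^ k)ᴴ = (Zᴴ * Z) ^ 2 ^ k :=
      ((isHermitian_conjTranspose_mul_self Z).pow _)
    rw [h2, ← pow_two, ← pow_mul, ← pow_succ] at h1
    refine le_trans ?_ h1
    rw [← sq_abs]
    exact pow_le_pow_left₀ (abs_nonneg _) (Complex.abs_re_le_norm _) 2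

/-- After the pointwise bound the sum is the trace of a compression, and `V Vᴴ ≤ 1`. -/
theorem sum_norm_conj_apply_pow_le {V W : Matrix ι κ ℂ} (hV : Vᴴ * V = 1) (hW : Wᴴ * W = 1)
    (Z : Matrix ι ι ℂ) (k : ℕ) :
    ∑ l, ‖(Wᴴ * Z * V) l l‖ ^ 2 ^ (k + 1) ≤ schattenPow k Z := by
  refine (Finset.sum_le_sum fun l _ => norm_conj_apply_pow_le hV hW Z l k).trans ?_
  have hR := (posSemidef_conjTranspose_mul_self Z).pow (2 ^ k)
  set R := (Zᴴ * Z) ^ 2 ^ k with hRdef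
  have h1 : ((1 - V * Vᴴ) : Matrix ι ι ℂ).PosSemidef := by
    have h2 := posSemidef_conjTranspose_mul_self (1 - V * Vᴴ)
    have h3 : (1 - V * Vᴴ)ᴴ * (1 - V * Vᴴ) = 1 - V * Vᴴ := by
      rw [conjTranspose_sub, conjTranspose_one, conjTranspose_mul, conjTranspose_conjTranspose,
        Matrix.sub_mul, Matrix.one_mul, Matrix.mul_sub,
        Matrix.mul_one, Matrix.mul_assoc V, ← Matrix.mul_assoc Vᴴ, hV, Matrix.one_mul, sub_self,
        sub_zero]
    rwa [h3] at h2
  have h2 := trace_mul_re_nonneg hR h1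
  rw [Matrix.mul_sub, Matrix.mul_one, trace_sub, Complex.sub_re, sub_nonneg] at h2
  refine le_trans (le_of_eq ?_) h2
  rw [← Matrix.mul_assoc, trace_mul_comm, ← Matrix.mul_assoc, trace, Complex.re_sum]
  rfl

end SingularValues

/-! ### Duality and complex interpolation -/

section Interpolation

theorem exists_young_const {p q : ℝ} (hpq : p.HolderConjugate q) {δ : ℝ} (hδ : 0 < δ) :
    ∃ K : ℝ, 0 ≤ K ∧ ∀ s t : ℝ, 0 ≤ s → 0 ≤ t → s * t ≤ K * s ^ p + δ * t ^ q := by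
  set η : ℝ := δ ^ (1 / q) with hη
  have hη0 : 0 < η := Real.rpow_pos_of_pos hδ _
  have hηq : η ^ q = δ := by
    rw [hη, ← Real.rpow_mul hδ.le, one_div, inv_mul_cancel₀ hpq.symm.ne_zero, Real.rpow_one]
  refine ⟨(η⁻¹) ^ p, by positivity, fun s t hs ht => ?_⟩
  have h := Real.young_inequality_of_nonneg (a := η⁻¹ * s) (b := η * t) (by positivity)
    (by positivity) hpq
  rw [Real.mul_rpow (by positivity) hs, Real.mul_rpow hη0.le ht, hηq] at h
  have h1 : η⁻¹ * s * (η * t) = s * t := by field_simp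
  rw [h1] at h
  refine h.trans (add_le_add (div_le_self (by positivity) hpq.lt.le)
    (div_le_self (by positivity) hpq.symm.lt.le))

variable {ι : Type*} [Fintype ι] [DecidableEq ι] {κ : Type*} [Fintype κ] [DecidableEq κ]

/-- Duality pairing of a matrix with a singular value decomposition. -/
theorem norm_trace_mul_svd_le {V W : Matrix ι κ ℂ} (hV : Vᴴ * V = 1) (hW : Wᴴ * W = 1)
    (Z : Matrix ι ι ℂ) (k : ℕ) (a : κ → ℂ) {p K δ : ℝ} (hδ : 0 ≤ δ)
    (hK : ∀ s t : ℝ, 0 ≤ s → 0 ≤ t → s * t ≤ K * s ^ p + δ * t ^ ((2 ^ (k + 1) : ℕ) : ℝ)) :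
    ‖trace (Z * (V * diagonal a * Wᴴ))‖ ≤ K * ∑ l, ‖a l‖ ^ p + δ * schattenPow k Z := by
  have h1 : trace (Z * (V * diagonal a * Wᴴ)) = ∑ l, a l * (Wᴴ * Z * V) l l := by
    rw [← Matrix.mul_assoc, trace_mul_comm, ← Matrix.mul_assoc, ← Matrix.mul_assoc, trace]
    refine Finset.sum_congr rfl fun l _ => ?_
    rw [diag_apply, mul_diagonal, mul_comm]
  rw [h1]
  refine (norm_sum_le _ _).trans ?_
  refine le_trans ?_ (add_le_add le_rfl (mul_le_mul_of_nonneg_left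
    (sum_norm_conj_apply_pow_le hV hW Z k) hδ))
  rw [Finset.mul_sum, Finset.mul_sum, ← Finset.sum_add_distrib]
  refine Finset.sum_le_sum fun l _ => ?_
  have := hK ‖a l‖ ‖(Wᴴ * Z * V) l l‖ (norm_nonneg _) (norm_nonneg _)
  rwa [Real.rpow_natCast, ← norm_mul] at this

theorem trace_schur_mul (m : ι → ι → ℂ) (A B : Matrix ι ι ℂ) :
    trace (schur m A * B) = trace (schur (fun j k => m k j) B * A) := by
  simp only [trace, diag_apply, Matrix.mul_apply, schur, of_apply]
  rw [Finset.sum_comm]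
  refine Finset.sum_congr rfl fun i _ => Finset.sum_congr rfl fun j _ => ?_
  ring

theorem trace_schur_svd (m : ι → ι → ℂ) {κ' : Type*} [Fintype κ'] [DecidableEq κ']
    (V W : Matrix ι κ ℂ) (V' W' : Matrix ι κ' ℂ) (a : κ → ℂ) (b : κ' → ℂ) :
    trace (schur m (V * diagonal a * Wᴴ) * (W' * diagonal b * V'ᴴ)) =
      ∑ i, ∑ j, m i j * (∑ l, V i l * a l * star (W j l)) *
        ∑ r, W' j r * b r * star (V' i r) := by
  rw [trace]
  refine Finset.sum_congr rfl fun i _ => ?_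
  rw [diag_apply, Matrix.mul_apply]
  refine Finset.sum_congr rfl fun j _ => ?_
  rw [schur, of_apply, Matrix.mul_apply, Matrix.mul_apply]
  simp only [mul_diagonal, conjTranspose_apply]

/-- Interpolation between the Schatten class of exponent `2^(k+1)` and its dual. -/
theorem exists_interpolation_const (k : ℕ) {p : ℝ} (hp1 : 1 < p) (hpk : p < 2 ^ (k + 1))
    (hpk' : p / (p - 1) < 2 ^ (k + 1)) {C : ℝ} (hC : 0 ≤ C) :
    ∃ K : ℝ, 0 ≤ K ∧ ∀ {ι κ κ' : Type*} [Fintype ι] [DecidableEq ι] [Fintype κ] [DecidableEq κ]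
      [Fintype κ'] [DecidableEq κ'] (m : ι → ι → ℂ)
      (_ : ∀ A, schattenPow k (schur m A) ≤ C * schattenPow k A)
      (_ : ∀ A, schattenPow k (schur (fun i j => m j i) A) ≤ C * schattenPow k A)
      {V W : Matrix ι κ ℂ} (_ : Vᴴ * V = 1) (_ : Wᴴ * W = 1) {a : κ → ℝ} (_ : ∀ l, 0 < a l)
      {V' W' : Matrix ι κ' ℂ} (_ : V'ᴴ * V' = 1) (_ : W'ᴴ * W' = 1) {s : κ' → ℝ}
      (_ : ∀ r, 0 < s r)
      (_ : schur m (V * diagonal (fun l => (a l : ℂ)) * Wᴴ) =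
        V' * diagonal (fun r => (s r : ℂ)) * W'ᴴ),
      ∑ r, s r ^ p ≤ K * ∑ l, a l ^ p := by
  set q : ℝ := ((2 ^ (k + 1) : ℕ) : ℝ) with hq
  have hq' : q = 2 ^ (k + 1) := by rw [hq]; push_cast; rfl
  rw [← hq'] at hpk hpk'
  have hq1 : 1 < q := hp1.trans hpk
  set q' := q.conjExponent with hq'def
  have hconj : q.HolderConjugate q' := Real.HolderConjugate.conjExponent hq1
  have hp0 : 0 < p := by linarith
  have hq0 : 0 < q := by linarith
  have hq'0 : 0 < q' := hconj.symm.pos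
  -- Both boundary estimates must leave at most half of `∑ s^p`; one of them carries the additional
  -- factor `C`.
  obtain ⟨δ, hδ, hδC, hδ1⟩ : ∃ δ : ℝ, 0 < δ ∧ δ * C ≤ 1 / 2 ∧ δ ≤ 1 / 2 := by
    refine ⟨(2 * (C + 1))⁻¹, by positivity, ?_, ?_⟩
    · rw [inv_mul_le_iff₀ (by positivity)]; linarith
    · rw [inv_le_comm₀ (by positivity) (by norm_num)]; linarith
  obtain ⟨K₀, hK₀, hy₀⟩ := exists_young_const hconj.symm hδ
  obtain ⟨K₁, hK₁, hy₁⟩ := exists_young_const hconj hδ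
  refine ⟨2 * (K₀ + K₁ * C), by positivity, ?_⟩
  intro ι κ κ' _ _ _ _ _ _ m hm hmt V W hV hW a ha V' W' hV' hW' s hs hsvd
  -- The exponents of `a` run affinely from `p/q'` at `Re z = 0` to `p/q` at `Re z = 1`, and those
  -- of `s` the other way. On each boundary line one factor has `q'`-power sum and the other
  -- `q`-power sum equal to those of `a^p` and `s^p`. The two assumptions on `p` say that `r₁ < 1 <
  -- r₀`.
  set r₀ := p / q' with hr₀
  set r₁ := p / q with hr₁
  have hsum : r₀ + r₁ = p := by
    have := hconj.inv_add_inv_eq_one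
    rw [hr₀, hr₁, div_eq_mul_inv, div_eq_mul_inv, ← mul_add, add_comm, this, mul_one]
  have hr1 : r₁ < 1 := (div_lt_one hq0).2 hpk
  have hr1' : 1 < r₀ := by
    have h1 : p < q * (p - 1) := (div_lt_iff₀ (by linarith)).1 hpk'
    have h2 : r₁ < p - 1 := by rw [hr₁, div_lt_iff₀ hq0]; linarith
    linarith
  set ℓ : ℂ → ℂ := fun z => (r₀ : ℂ) + ((r₁ - r₀ : ℝ) : ℂ) * z with hℓ
  set ℓ' : ℂ → ℂ := fun z => (r₁ : ℂ) + ((r₀ - r₁ : ℝ) : ℂ) * z with hℓ'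
  have hℓre : ∀ z, (ℓ z).re = r₀ + (r₁ - r₀) * z.re := fun z => by
    simp only [hℓ, Complex.add_re, Complex.ofReal_re, Complex.re_ofReal_mul]
  have hℓ're : ∀ z, (ℓ' z).re = r₁ + (r₀ - r₁) * z.re := fun z => by
    simp only [hℓ', Complex.add_re, Complex.ofReal_re, Complex.re_ofReal_mul]
  set α : ℂ → κ → ℂ := fun z l => (a l : ℂ) ^ ℓ z with hα
  set β : ℂ → κ' → ℂ := fun z r => (s r : ℂ) ^ ℓ' z with hβ
  have hαn : ∀ z l, ‖α z l‖ = a l ^ (r₀ + (r₁ - r₀) * z.re) := fun z l => by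
    rw [hα, Complex.norm_cpow_eq_rpow_re_of_pos (ha l), hℓre]
  have hβn : ∀ z r, ‖β z r‖ = s r ^ (r₁ + (r₀ - r₁) * z.re) := fun z r => by
    rw [hβ, Complex.norm_cpow_eq_rpow_re_of_pos (hs r), hℓ're]
  set F : ℂ → ℂ := fun z =>
    trace (schur m (V * diagonal (α z) * Wᴴ) * (W' * diagonal (β z) * V'ᴴ)) with hF
  set R : ℝ := (K₀ + K₁ * C) * ∑ l, a l ^ p + 1 / 2 * ∑ r, s r ^ p with hR
  have hsa : 0 ≤ ∑ l, a l ^ p := Finset.sum_nonneg fun l _ => (Real.rpow_pos_of_pos (ha l) _).le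
  have hss : 0 ≤ ∑ r, s r ^ p := Finset.sum_nonneg fun r _ => (Real.rpow_pos_of_pos (hs r) _).le
  have hdiff : Differentiable ℂ F := by
    have h1 : ∀ l, Differentiable ℂ fun z => α z l := fun l => by
      simp only [hα, hℓ]
      exact Differentiable.const_cpow (by fun_prop)
        (Or.inl (Complex.ofReal_ne_zero.2 (ha l).ne'))
    have h2 : ∀ r, Differentiable ℂ fun z => β z r := fun r => by
      simp only [hβ, hℓ']
      exact Differentiable.const_cpow (by fun_prop)
        (Or.inl (Complex.ofReal_ne_zero.2 (hs r).ne'))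
    simp only [hF, trace_schur_svd]
    fun_prop
  -- The moduli of the complex powers depend only on `Re z`, so boundedness on the strip reduces to
  -- continuity on `[0, 1]`.
  have hbdd : BddAbove (norm ∘ F '' Complex.HadamardThreeLines.verticalClosedStrip 0 1) := by
    set g : ℝ → ℝ := fun t => ∑ i, ∑ j, ‖m i j‖ *
      (∑ l, ‖V i l‖ * a l ^ (r₀ + (r₁ - r₀) * t) * ‖star (W j l)‖) *
        ∑ r, ‖W' j r‖ * s r ^ (r₁ + (r₀ - r₁) * t) * ‖star (V' i r)‖ with hg
    have hgc : Continuous g := by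
      have h1 : ∀ l, Continuous fun t : ℝ => a l ^ (r₀ + (r₁ - r₀) * t) := fun l =>
        Continuous.rpow continuous_const (by fun_prop) fun _ => Or.inl (ha l).ne'
      have h2 : ∀ r, Continuous fun t : ℝ => s r ^ (r₁ + (r₀ - r₁) * t) := fun r =>
        Continuous.rpow continuous_const (by fun_prop) fun _ => Or.inl (hs r).ne'
      simp only [hg]
      fun_prop
    obtain ⟨D, hD⟩ := (isCompact_Icc (a := (0 : ℝ)) (b := 1)).exists_bound_of_continuousOn
      hgc.continuousOn
    refine ⟨D, ?_⟩
    rintro _ ⟨z, hz, rfl⟩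
    refine le_trans ?_ ((le_abs_self _).trans (hD z.re hz))
    simp only [Function.comp, hF, trace_schur_svd, hg]
    refine (norm_sum_le _ _).trans (Finset.sum_le_sum fun i _ => ?_)
    refine (norm_sum_le _ _).trans (Finset.sum_le_sum fun j _ => ?_)
    rw [norm_mul, norm_mul]
    have hn₁ : ‖∑ l, V i l * α z l * star (W j l)‖ ≤
        ∑ l, ‖V i l‖ * a l ^ (r₀ + (r₁ - r₀) * z.re) * ‖star (W j l)‖ := by
      refine (norm_sum_le _ _).trans (Finset.sum_le_sum fun l _ => ?_)
      rw [norm_mul, norm_mul, hαn]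
    have hn₂ : ‖∑ r, W' j r * β z r * star (V' i r)‖ ≤
        ∑ r, ‖W' j r‖ * s r ^ (r₁ + (r₀ - r₁) * z.re) * ‖star (V' i r)‖ := by
      refine (norm_sum_le _ _).trans (Finset.sum_le_sum fun r _ => ?_)
      rw [norm_mul, norm_mul, hβn]
    exact mul_le_mul (mul_le_mul_of_nonneg_left hn₁ (norm_nonneg _)) hn₂ (norm_nonneg _)
      (mul_nonneg (norm_nonneg _) ((norm_nonneg _).trans hn₁))
  have hpow : ∀ {x e f : ℝ}, 0 < x → e * f = p → (x ^ e) ^ f = x ^ p := fun hx h => by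
    rw [← Real.rpow_mul hx.le, h]
  have hr₀q : r₀ * q' = p := div_mul_cancel₀ _ hq'0.ne'
  have hr₁q : r₁ * q = p := div_mul_cancel₀ _ hq0.ne'
  have h0 : ∀ z ∈ Complex.re ⁻¹' {(0 : ℝ)}, ‖F z‖ ≤ R := by
    intro z hz
    have hz : z.re = 0 := hz
    simp only [hF]
    -- On this line the factor from `s` is the one controlled at exponent `q`, so the multiplier is
    -- moved onto it, with transposed symbol.
    rw [trace_schur_mul]
    refine (norm_trace_mul_svd_le hV hW _ k _ hδ.le hy₀).trans ?_
    have h1 : ∑ l, ‖α z l‖ ^ q' = ∑ l, a l ^ p := Finset.sum_congr rfl fun l _ => by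
      rw [hαn, hz, mul_zero, add_zero, hpow (ha l) hr₀q]
    have h2 : schattenPow k (W' * diagonal (β z) * V'ᴴ) = ∑ r, s r ^ p := by
      rw [schattenPow_singular_value_decomposition k hW' hV']
      refine Finset.sum_congr rfl fun r _ => ?_
      rw [hβn, hz, mul_zero, add_zero, ← Real.rpow_natCast, ← hq, hpow (hs r) hr₁q]
    have h3 := hmt (W' * diagonal (β z) * V'ᴴ)
    rw [h2] at h3
    rw [h1, hR]
    have h4 : 0 ≤ K₁ * C * ∑ l, a l ^ p := by positivity
    have h5 := mul_le_mul_of_nonneg_left h3 hδ.le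
    nlinarith [mul_le_mul_of_nonneg_right hδC hss]
  have h1 : ∀ z ∈ Complex.re ⁻¹' {(1 : ℝ)}, ‖F z‖ ≤ R := by
    intro z hz
    have hz : z.re = 1 := hz
    have hy : ∀ u t : ℝ, 0 ≤ u → 0 ≤ t → u * t ≤ δ * u ^ q' + K₁ * t ^ q := fun u t hu ht => by
      have := hy₁ t u ht hu
      linarith
    simp only [hF]
    refine (norm_trace_mul_svd_le hW' hV' _ k _ hK₁ hy).trans ?_
    have h1 : ∑ r, ‖β z r‖ ^ q' = ∑ r, s r ^ p := Finset.sum_congr rfl fun r _ => by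
      rw [hβn, hz, mul_one, add_sub_cancel, hpow (hs r) hr₀q]
    have h2 : schattenPow k (V * diagonal (α z) * Wᴴ) = ∑ l, a l ^ p := by
      rw [schattenPow_singular_value_decomposition k hV hW]
      refine Finset.sum_congr rfl fun l _ => ?_
      rw [hαn, hz, mul_one, add_sub_cancel, ← Real.rpow_natCast, ← hq, hpow (ha l) hr₁q]
    have h3 := hm (V * diagonal (α z) * Wᴴ)
    rw [h2] at h3
    rw [h1, hR]
    have h4 : 0 ≤ K₀ * ∑ l, a l ^ p := by positivity
    have h5 := mul_le_mul_of_nonneg_left h3 hK₁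
    nlinarith [mul_le_mul_of_nonneg_right hδ1 hss]
  -- At `θ` the exponent of `a` is `1` and that of `s` is `p - 1`: the original matrix is paired
  -- with its dual element and `F θ = ∑ s^p`. Half of this already sits in `R` and is absorbed at
  -- the end.
  set θ : ℝ := (r₀ - 1) / (r₀ - r₁) with hθ
  have hd : 0 < r₀ - r₁ := by linarith
  have hθ0 : 0 ≤ θ := div_nonneg (by linarith) hd.le
  have hθ1 : θ ≤ 1 := (div_le_one hd).2 (by linarith)
  have hθd : (r₀ - r₁) * θ = r₀ - 1 := by rw [hθ]; field_simp
  have hFθ : F θ = ((∑ r, s r ^ p : ℝ) : ℂ) := by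
    have e1 : ℓ θ = 1 := by
      simp only [hℓ]
      rw [← Complex.ofReal_mul, ← Complex.ofReal_add, show r₀ + (r₁ - r₀) * θ = 1 by linarith,
        Complex.ofReal_one]
    have e2 : ℓ' θ = ((p - 1 : ℝ) : ℂ) := by
      simp only [hℓ']
      rw [← Complex.ofReal_mul, ← Complex.ofReal_add, show r₁ + (r₀ - r₁) * θ = p - 1 by linarith]
    have e3 : α θ = fun l => (a l : ℂ) := by
      funext l; simp only [hα, e1, Complex.cpow_one]
    have e4 : β θ = fun r => ((s r ^ (p - 1) : ℝ) : ℂ) := by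
      funext r; simp only [hβ, e2]; rw [Complex.ofReal_cpow (hs r).le]
    simp only [hF]
    rw [e3, e4, hsvd]
    have : V' * diagonal (fun r => (s r : ℂ)) * W'ᴴ *
        (W' * diagonal (fun r => ((s r ^ (p - 1) : ℝ) : ℂ)) * V'ᴴ) =
        V' * (diagonal (fun r => (s r : ℂ)) * (W'ᴴ * W') *
          diagonal (fun r => ((s r ^ (p - 1) : ℝ) : ℂ))) * V'ᴴ := by simp only [Matrix.mul_assoc]
    rw [this, hW', Matrix.mul_one, diagonal_mul_diagonal, trace_mul_comm, ← Matrix.mul_assoc, hV',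
      Matrix.one_mul, trace_diagonal, Complex.ofReal_sum]
    refine Finset.sum_congr rfl fun r _ => ?_
    rw [← Complex.ofReal_mul, ← Real.rpow_one_add' (hs r).le (by linarith), add_sub_cancel]
  have hthree := Complex.HadamardThreeLines.norm_le_interp_of_mem_verticalClosedStrip₀₁' F
    (z := (θ : ℂ)) ⟨by simpa using hθ0, by simpa using hθ1⟩ hdiff.diffContOnCl hbdd h0 h1
  have hR0 : 0 ≤ R := by rw [hR]; positivity
  rw [hFθ, Complex.ofReal_re, ← Real.rpow_add_of_nonneg hR0 (by linarith) hθ0, sub_add_cancel,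
    Real.rpow_one, Complex.norm_real, Real.norm_of_nonneg hss] at hthree
  linarith

end Interpolation

end SchurMultiplier

namespace SchurMultiplier
open Filter Topology

/-! ### Functional calculus on Hilbert space: strong continuity and Jensen's inequality -/

section HilbertSpace

variable {E : Type*} [NormedAddCommGroup E] [InnerProductSpace ℂ E] [CompleteSpace E]

theorem tendsto_apply_of_norm_le {α : Type*} {l : Filter α} {S : α → E →L[ℂ] E} {T : E →L[ℂ] E}
    {C : ℝ} (hC : ∀ i, ‖S i‖ ≤ C) (hS : ∀ x, Tendsto (fun i => S i x) l (𝓝 (T x)))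
    {x : α → E} {y : E} (hx : Tendsto x l (𝓝 y)) :
    Tendsto (fun i => S i (x i)) l (𝓝 (T y)) := by
  have h1 : Tendsto (fun i => S i (x i - y)) l (𝓝 0) := by
    refine squeeze_zero_norm (a := fun i => C * ‖x i - y‖) (fun i => ?_) ?_
    · exact ((S i).le_opNorm _).trans (mul_le_mul_of_nonneg_right (hC i) (norm_nonneg _))
    · have h2 : Tendsto (fun i => ‖x i - y‖) l (𝓝 0) := by
        simpa using (hx.sub_const y).norm
      simpa using h2.const_mul C
  simpa using h1.add (hS y)

theorem tendsto_aeval_apply {α : Type*} {l : Filter α} {S : α → E →L[ℂ] E} {T : E →L[ℂ] E}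
    {C : ℝ} (hC : ∀ i, ‖S i‖ ≤ C) (hS : ∀ x, Tendsto (fun i => S i x) l (𝓝 (T x)))
    (P : Polynomial ℝ) (x : E) :
    Tendsto (fun i => Polynomial.aeval (S i) P x) l (𝓝 (Polynomial.aeval T P x)) := by
  induction P using Polynomial.induction_on' with
  | add P Q hP hQ => simpa using hP.add hQ
  | monomial n a =>
    have hpow : Tendsto (fun i => (S i ^ n) x) l (𝓝 ((T ^ n) x)) := by
      induction n with
      | zero => simp [tendsto_const_nhds]
      | succ n ih =>
        simp only [pow_succ', mul_apply_eq_comp]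
        exact tendsto_apply_of_norm_le hC hS ih
    simpa [Polynomial.aeval_monomial, Algebra.algebraMap_eq_smul_one] using hpow.const_smul a

theorem spectrum_subset_Icc {T : E →L[ℂ] E} {R : ℝ} (hR : ‖T‖ ≤ R) :
    spectrum ℝ T ⊆ Set.Icc (-R) R := by
  intro x hx
  cases subsingleton_or_nontrivial E with
  | inl h => simp [spectrum.of_subsingleton] at hx
  | inr h =>
    have h1 := spectrum.norm_le_norm_of_mem hx
    exact abs_le.1 (h1.trans hR)

theorem norm_cfc_sub_aeval_le {T : E →L[ℂ] E} (hT : IsSelfAdjoint T) {R ε : ℝ} (hR : ‖T‖ ≤ R)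
    {f : ℝ → ℝ} (hf : Continuous f) {P : Polynomial ℝ}
    (hP : ∀ x ∈ Set.Icc (-R) R, |P.eval x - f x| < ε) (hε : 0 ≤ ε) :
    ‖cfc f T - Polynomial.aeval T P‖ ≤ ε := by
  rw [← cfc_polynomial P T hT, ← cfc_sub f P.eval T hf.continuousOn P.continuous.continuousOn]
  refine norm_cfc_le hε fun x hx => ?_
  rw [Real.norm_eq_abs, abs_sub_comm]
  exact (hP x (spectrum_subset_Icc hR hx)).le

/-- The continuous functional calculus is strongly continuous on bounded sets. -/
theorem tendsto_cfc_apply {α : Type*} {l : Filter α} {S : α → E →L[ℂ] E} {T : E →L[ℂ] E}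
    {C : ℝ} (hC : ∀ i, ‖S i‖ ≤ C) (hTC : ‖T‖ ≤ C) (hSa : ∀ i, IsSelfAdjoint (S i))
    (hTa : IsSelfAdjoint T) (hS : ∀ x, Tendsto (fun i => S i x) l (𝓝 (T x)))
    {f : ℝ → ℝ} (hf : Continuous f) (x : E) :
    Tendsto (fun i => cfc f (S i) x) l (𝓝 (cfc f T x)) := by
  rw [Metric.tendsto_nhds]
  intro ε hε
  have hδ : 0 < ε / (3 * (‖x‖ + 1)) := by positivity
  obtain ⟨P, hP⟩ := exists_polynomial_near_of_continuousOn (-C) C f hf.continuousOn _ hδ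
  filter_upwards [Metric.tendsto_nhds.1 (tendsto_aeval_apply hC hS P x) (ε / 3) (by positivity)]
    with i hi
  have hb : ∀ U : E →L[ℂ] E, IsSelfAdjoint U → ‖U‖ ≤ C →
      dist (cfc f U x) (Polynomial.aeval U P x) < ε / 3 := by
    intro U hU hUC
    rw [dist_eq_norm, ← sub_apply]
    calc _ ≤ ‖cfc f U - Polynomial.aeval U P‖ * ‖x‖ := ContinuousLinearMap.le_opNorm _ _
      _ ≤ ε / (3 * (‖x‖ + 1)) * ‖x‖ := by
        gcongr
        exact norm_cfc_sub_aeval_le hU hUC hf hP hδ.le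
      _ < ε / (3 * (‖x‖ + 1)) * (‖x‖ + 1) := by gcongr; linarith
      _ = ε / 3 := by field_simp
  have h1 := hb _ (hSa i) (hC i)
  have h2 := hb T hTa hTC
  rw [dist_comm] at h2
  have h3 := dist_triangle4 (cfc f (S i) x) (Polynomial.aeval (S i) P x)
    (Polynomial.aeval T P x) (cfc f T x)
  linarith

/-- True for polynomials, hence in general by uniform approximation on an interval containing both
the spectrum and `σ`; this covers `x = 0`, where `σ` need not be spectral. -/
theorem cfc_apply_of_apply_eq_smul {T : E →L[ℂ] E} (hT : IsSelfAdjoint T) {f : ℝ → ℝ}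
    (hf : Continuous f) {σ : ℝ} {x : E} (hx : T x = (σ : ℂ) • x) :
    cfc f T x = (f σ : ℂ) • x := by
  have hPx : ∀ P : Polynomial ℝ, Polynomial.aeval T P x = ((P.eval σ : ℝ) : ℂ) • x := by
    intro P
    induction P using Polynomial.induction_on' with
    | add P Q hP hQ => simp [hP, hQ, add_smul]
    | monomial n a =>
      have hpow : (T ^ n) x = ((σ : ℂ) ^ n) • x := by
        induction n with
        | zero => simp
        | succ n ih => rw [pow_succ', mul_apply_eq_comp, ih, map_smul, hx, smul_smul,
            pow_succ]
      simp [Polynomial.aeval_monomial, Algebra.algebraMap_eq_smul_one, hpow, mul_smul]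
  rw [← sub_eq_zero, ← norm_le_zero_iff]
  refine le_of_forall_pos_le_add fun ε hε => ?_
  have hδ : 0 < ε / (2 * (‖x‖ + 1)) := by positivity
  set R := max ‖T‖ |σ| with hRdef
  obtain ⟨P, hP⟩ := exists_polynomial_near_of_continuousOn (-R) R f hf.continuousOn _ hδ
  have h1 : ‖cfc f T x - Polynomial.aeval T P x‖ ≤ ε / (2 * (‖x‖ + 1)) * ‖x‖ := by
    rw [← sub_apply]
    refine (ContinuousLinearMap.le_opNorm _ _).trans ?_
    gcongr
    exact norm_cfc_sub_aeval_le hT (le_max_left _ _) hf hP hδ.le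
  have h2 : ‖((P.eval σ : ℝ) : ℂ) • x - (f σ : ℂ) • x‖ ≤ ε / (2 * (‖x‖ + 1)) * ‖x‖ := by
    rw [← sub_smul, norm_smul, ← Complex.ofReal_sub, Complex.norm_real, Real.norm_eq_abs]
    gcongr
    exact (hP σ (abs_le.1 (le_max_right _ _))).le
  rw [hPx] at h1
  have h3 := norm_sub_le_norm_sub_add_norm_sub (cfc f T x) (((P.eval σ : ℝ) : ℂ) • x)
    ((f σ : ℂ) • x)
  have h4 : ε / (2 * (‖x‖ + 1)) * ‖x‖ ≤ ε / 2 := by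
    calc _ ≤ ε / (2 * (‖x‖ + 1)) * (‖x‖ + 1) := by gcongr; linarith
      _ = ε / 2 := by field_simp
  linarith

theorem absPow_eq_cfc {p : ℝ} (hp : 0 < p) (A : E →L[ℂ] E) :
    absPow p A = cfc (fun x : ℝ => x ^ (p / 2)) (star A * A) := by
  have h : CFC.abs A ^ p = (star A * A) ^ (p / 2) := by
    rw [CFC.abs, CFC.sqrt_eq_rpow, CFC.rpow_rpow_of_exponent_nonneg _ _ _ (by norm_num) hp.le]
    congr 1
    ring
  rw [absPow, h, CFC.rpow_eq_cfc_real (star_mul_self_nonneg A)]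

theorem rpow_half_mul_rpow_half {T : E →L[ℂ] E} (hT : 0 ≤ T) {p : ℝ} (hp : 0 < p) :
    T ^ (p / 2) * T ^ (p / 2) = T ^ p := by
  have h := CFC.rpow_rpow_of_exponent_nonneg T (p / 2) 2 (by positivity) (by norm_num)
  rw [div_mul_cancel₀ _ (two_ne_zero)] at h
  rw [← h, ← Nat.cast_ofNat (R := ℝ), CFC.rpow_natCast _ _ CFC.rpow_nonneg, pow_two]

theorem norm_rpow_half_apply_sq {T : E →L[ℂ] E} (hT : 0 ≤ T) {p : ℝ} (hp : 0 < p) (x : E) :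
    ‖(T ^ (p / 2)) x‖ ^ 2 = (inner ℂ x ((T ^ p) x)).re := by
  have hs : IsSelfAdjoint (T ^ (p / 2)) := .of_nonneg CFC.rpow_nonneg
  rw [← rpow_half_mul_rpow_half hT hp, mul_apply_eq_comp,
    ← ContinuousLinearMap.adjoint_inner_left, hs.adjoint_eq, ← inner_self_eq_norm_sq (𝕜 := ℂ)]
  rfl

/-- Jensen's inequality `⟪x, T x⟫ ^ p ≤ ⟪x, T ^ p x⟫` for a positive operator `T`, `p ≥ 1`
and `‖x‖ ≤ 1`. -/
theorem inner_rpow_le_inner_rpow {T : E →L[ℂ] E} (hT : 0 ≤ T) {p : ℝ} (hp : 1 < p) {x : E}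
    (hx : ‖x‖ ≤ 1) : (inner ℂ x (T x)).re ^ p ≤ (inner ℂ x ((T ^ p) x)).re := by
  have hpos : 0 ≤ (inner ℂ x (T x)).re := by
    simpa using ((ContinuousLinearMap.nonneg_iff_isPositive T).1 hT).re_inner_nonneg_right x
  set y := (inner ℂ x (T x)).re with hy
  -- The tangent line of `t^p` at `y = ⟪x, T x⟫` lies below the curve, by Bernoulli's inequality; at
  -- `y = 0` it is the zero function. Its value at `x` exceeds `y^p` by `(p - 1) y^p (1 - ‖x‖²)`.
  have hle : cfc (fun t : ℝ => y ^ p + p * y ^ (p - 1) * (t - y)) T ≤ T ^ p := by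
    rw [CFC.rpow_eq_cfc_real hT]
    refine cfc_mono (fun t ht => ?_) (by fun_prop)
      (Real.continuous_rpow_const (by linarith)).continuousOn
    have ht0 : 0 ≤ t := spectrum_nonneg_of_nonneg hT ht
    rcases hpos.eq_or_lt with h0 | h0
    · rw [← h0, Real.zero_rpow (by linarith), Real.zero_rpow (by linarith)]
      simpa using Real.rpow_nonneg ht0 p
    · have hb := one_add_mul_self_le_rpow_one_add (s := t / y - 1) (p := p)
        (by have := div_nonneg ht0 h0.le; linarith) hp.le
      rw [add_sub_cancel, Real.div_rpow ht0 h0.le, le_div_iff₀ (by positivity)] at hb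
      have e : y ^ p = y ^ (p - 1) * y := by
        rw [← Real.rpow_add_one h0.ne', sub_add_cancel]
      calc y ^ p + p * y ^ (p - 1) * (t - y) = (1 + p * (t / y - 1)) * y ^ p := by
            rw [e]; field_simp
        _ ≤ t ^ p := hb
  have hval : cfc (fun t : ℝ => y ^ p + p * y ^ (p - 1) * (t - y)) T =
      (y ^ p - p * y ^ (p - 1) * y) • (1 : E →L[ℂ] E) + (p * y ^ (p - 1)) • T := by
    have hsa : IsSelfAdjoint T := .of_nonneg hT
    have e : (fun t : ℝ => y ^ p + p * y ^ (p - 1) * (t - y)) =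
        fun t => (y ^ p - p * y ^ (p - 1) * y) + (p * y ^ (p - 1)) * t := by
      ext t; ring
    rw [e, cfc_const_add _ _ T, cfc_const_mul_id _ T, Algebra.algebraMap_eq_smul_one]
  rw [hval, ContinuousLinearMap.le_def] at hle
  have h := hle.re_inner_nonneg_right x
  have hsm : ∀ (r : ℝ) (z : E), (inner ℂ x (r • z)).re = r * (inner ℂ x z).re := by
    intro r z
    rw [inner_smul_right_eq_smul, Complex.real_smul, Complex.re_ofReal_mul]
  have hxx : (inner ℂ x x).re = ‖x‖ ^ 2 := inner_self_eq_norm_sq (𝕜 := ℂ) x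
  simp only [sub_apply, add_apply, _root_.smul_apply, one_apply_eq_self, inner_sub_right,
    inner_add_right, map_sub, map_add, RCLike.re_to_complex, hsm, hxx, ← hy] at h
  refine le_trans ?_ (sub_nonneg.1 h)
  have e : p * y ^ (p - 1) * y = p * y ^ p := by
    rcases hpos.eq_or_lt with h0 | h0
    · rw [← h0, Real.zero_rpow (by linarith : p ≠ 0)]; simp
    · rw [mul_assoc, ← Real.rpow_add_one h0.ne', sub_add_cancel]
  rw [e]
  have hx2 : ‖x‖ ^ 2 ≤ 1 := pow_le_one₀ (norm_nonneg _) hx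
  nlinarith [mul_nonneg (mul_nonneg (Real.rpow_nonneg hpos p) (by linarith : 0 ≤ p - 1))
    (sub_nonneg.2 hx2)]

/-- The Hilbert-Schmidt sum of an orthonormal family is at most that of the adjoint over a basis. -/
theorem sum_norm_apply_sq_le_tsum {Γ κ : Type*} [Fintype κ] (b : HilbertBasis Γ ℂ E)
    (G : E →L[ℂ] E) {h : κ → E} (hh : Orthonormal ℂ h) :
    ∑ l, ENNReal.ofReal (‖G (h l)‖ ^ 2) ≤
      ∑' j, ENNReal.ofReal (‖ContinuousLinearMap.adjoint G (b j)‖ ^ 2) := by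
  have h1 : ∀ x : E, ENNReal.ofReal (‖x‖ ^ 2) = ∑' j, ENNReal.ofReal (‖inner ℂ (b j) x‖ ^ 2) := by
    intro x
    have hs := b.hasSum_inner_mul_inner x x
    have hs' : HasSum (fun j => ‖inner ℂ (b j) x‖ ^ 2) (‖x‖ ^ 2) := by
      have := Complex.hasSum_re hs
      rw [show (inner ℂ x x).re = ‖x‖ ^ 2 from inner_self_eq_norm_sq (𝕜 := ℂ) x] at this
      convert this using 2 with j
      rw [← inner_conj_symm x (b j), ← Complex.normSq_eq_conj_mul_self, Complex.ofReal_re,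
        Complex.normSq_eq_norm_sq]
    rw [← hs'.tsum_eq, ENNReal.ofReal_tsum_of_nonneg (fun j => by positivity) hs'.summable]
  simp only [h1 (G _)]
  rw [← Summable.tsum_finsetSum (fun _ _ => ENNReal.summable)]
  refine ENNReal.tsum_le_tsum fun j => ?_
  rw [← ENNReal.ofReal_sum_of_nonneg (fun _ _ => by positivity)]
  refine ENNReal.ofReal_le_ofReal ?_
  refine le_trans (le_of_eq ?_) (hh.sum_inner_products_le (s := Finset.univ)
    (ContinuousLinearMap.adjoint G (b j)))
  refine Finset.sum_congr rfl fun l _ => ?_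
  rw [← ContinuousLinearMap.adjoint_inner_left, norm_inner_symm]

end HilbertSpace

end SchurMultiplier

namespace SchurMultiplier
open Filter Topology

/-! ### The trace of `|A|^p` dominates diagonal sums over orthonormal families -/

section HilbertSpace

variable {E : Type*} [NormedAddCommGroup E] [InnerProductSpace ℂ E] [CompleteSpace E]

theorem norm_sqrt_apply_rpow_le {T : E →L[ℂ] E} (hT : 0 ≤ T) {p : ℝ} (hp : 1 < p) {x : E}
    (hx : ‖x‖ ≤ 1) : ‖(T ^ (1 / 2 : ℝ)) x‖ ^ (2 * p) ≤ ‖(T ^ (p / 2)) x‖ ^ 2 := by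
  rw [norm_rpow_half_apply_sq hT (by linarith), Real.rpow_mul (norm_nonneg _), Real.rpow_two,
    norm_rpow_half_apply_sq hT one_pos, CFC.rpow_one T hT]
  exact inner_rpow_le_inner_rpow hT hp hx

/-- Splitting `T` into two square roots, Cauchy–Schwarz and the arithmetic–geometric mean decouple
`x` from `y`; Jensen's inequality then acts on each. It is needed for vectors of norm at most one
since `W* y` is only that. -/
theorem norm_inner_rpow_le {T W : E →L[ℂ] E} (hT : 0 ≤ T) (hW : ‖W‖ ≤ 1) {p : ℝ} (hp : 1 < p)
    {x y : E} (hx : ‖x‖ = 1) (hy : ‖y‖ = 1) :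
    ‖inner ℂ y (W (T x))‖ ^ p ≤ (‖(T ^ (p / 2)) x‖ ^ 2 +
      ‖(T ^ (p / 2)) (ContinuousLinearMap.adjoint W y)‖ ^ 2) / 2 := by
  have hs : IsSelfAdjoint (T ^ (1 / 2 : ℝ)) := .of_nonneg CFC.rpow_nonneg
  have e : inner ℂ y (W (T x)) = inner ℂ ((T ^ (1 / 2 : ℝ)) (ContinuousLinearMap.adjoint W y))
      ((T ^ (1 / 2 : ℝ)) x) := by
    have h1 := rpow_half_mul_rpow_half hT one_pos
    rw [CFC.rpow_one T hT] at h1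
    nth_rw 1 [← h1]
    rw [mul_apply_eq_comp, ← ContinuousLinearMap.adjoint_inner_left,
      ← ContinuousLinearMap.adjoint_inner_left, hs.adjoint_eq]
  have hWy : ‖ContinuousLinearMap.adjoint W y‖ ≤ 1 := by
    refine ((ContinuousLinearMap.adjoint W).le_opNorm y).trans ?_
    rw [hy, mul_one, LinearIsometryEquiv.norm_map]
    exact hW
  have h1 := norm_sqrt_apply_rpow_le hT hp hx.le
  have h2 := norm_sqrt_apply_rpow_le hT hp hWy
  rw [e]
  set a := ‖(T ^ (1 / 2 : ℝ)) (ContinuousLinearMap.adjoint W y)‖ with ha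
  set b := ‖(T ^ (1 / 2 : ℝ)) x‖ with hb
  have ha0 : 0 ≤ a := norm_nonneg _
  have hb0 : 0 ≤ b := norm_nonneg _
  calc _ ≤ (a * b) ^ p := Real.rpow_le_rpow (norm_nonneg _) (norm_inner_le_norm _ _) (by linarith)
    _ = a ^ p * b ^ p := Real.mul_rpow ha0 hb0
    _ ≤ (b ^ (2 * p) + a ^ (2 * p)) / 2 := by
      rw [mul_comm 2 p, Real.rpow_mul ha0, Real.rpow_mul hb0, Real.rpow_two, Real.rpow_two]
      nlinarith [sq_nonneg (a ^ p - b ^ p)]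
    _ ≤ _ := by gcongr

theorem sum_norm_inner_contraction_rpow_le {Γ κ : Type*} [Fintype κ] (b : HilbertBasis Γ ℂ E)
    {T W : E →L[ℂ] E} (hT : 0 ≤ T) (hW : ‖W‖ ≤ 1) {p : ℝ} (hp : 1 < p) {h k : κ → E}
    (hh : Orthonormal ℂ h) (hk : Orthonormal ℂ k) :
    ∑ l, ENNReal.ofReal (‖inner ℂ (k l) (W (T (h l)))‖ ^ p) ≤
      ∑' j, ENNReal.ofReal (inner ℂ (b j) ((T ^ p) (b j))).re := by
  have hs : IsSelfAdjoint (T ^ (p / 2)) := .of_nonneg CFC.rpow_nonneg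
  set X := ∑' j, ENNReal.ofReal (inner ℂ (b j) ((T ^ p) (b j))).re with hX
  have h1 : ∑ l, ENNReal.ofReal (‖(T ^ (p / 2)) (h l)‖ ^ 2) ≤ X := by
    refine (sum_norm_apply_sq_le_tsum b _ hh).trans (le_of_eq ?_)
    simp only [hs.adjoint_eq, norm_rpow_half_apply_sq hT (by linarith : 0 < p), hX]
  have h2 : ∑ l, ENNReal.ofReal (‖(T ^ (p / 2)) (ContinuousLinearMap.adjoint W (k l))‖ ^ 2) ≤
      X := by
    refine (sum_norm_apply_sq_le_tsum b ((T ^ (p / 2)) ∘L ContinuousLinearMap.adjoint W) hk).trans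
      (ENNReal.tsum_le_tsum fun j => ENNReal.ofReal_le_ofReal ?_)
    rw [← norm_rpow_half_apply_sq hT (by linarith : 0 < p), ContinuousLinearMap.adjoint_comp,
      ContinuousLinearMap.adjoint_adjoint, hs.adjoint_eq]
    gcongr
    exact (W.le_opNorm _).trans (mul_le_of_le_one_left (norm_nonneg _) hW)
  calc _ ≤ ∑ l, (2⁻¹ * (ENNReal.ofReal (‖(T ^ (p / 2)) (h l)‖ ^ 2) +
        ENNReal.ofReal (‖(T ^ (p / 2)) (ContinuousLinearMap.adjoint W (k l))‖ ^ 2))) := by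
        refine Finset.sum_le_sum fun l _ => ?_
        rw [← ENNReal.ofReal_add (by positivity) (by positivity),
          ← ENNReal.ofReal_ofNat (n := 2), ← ENNReal.ofReal_inv_of_pos two_pos,
          ← ENNReal.ofReal_mul (by norm_num)]
        refine ENNReal.ofReal_le_ofReal ?_
        have := norm_inner_rpow_le hT hW hp (hh.1 l) (hk.1 l)
        linarith
    _ = 2⁻¹ * (∑ l, ENNReal.ofReal (‖(T ^ (p / 2)) (h l)‖ ^ 2) +
        ∑ l, ENNReal.ofReal (‖(T ^ (p / 2)) (ContinuousLinearMap.adjoint W (k l))‖ ^ 2)) := by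
        rw [← Finset.mul_sum, Finset.sum_add_distrib]
    _ ≤ 2⁻¹ * (X + X) := by gcongr
    _ = X := by
        rw [← two_mul, ← mul_assoc, ENNReal.inv_mul_cancel two_ne_zero ENNReal.ofNat_ne_top,
          one_mul]

theorem norm_apply_eq_norm_abs_apply (A : E →L[ℂ] E) (x : E) : ‖A x‖ = ‖CFC.abs A x‖ := by
  have hs : IsSelfAdjoint (CFC.abs A) := .of_nonneg (CFC.abs_nonneg A)
  have h := CFC.abs_mul_abs A
  have h1 : ‖A x‖ ^ 2 = ‖CFC.abs A x‖ ^ 2 := by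
    rw [← inner_self_eq_norm_sq (𝕜 := ℂ), ← inner_self_eq_norm_sq (𝕜 := ℂ),
      ← ContinuousLinearMap.adjoint_inner_right, ← ContinuousLinearMap.adjoint_inner_right,
      hs.adjoint_eq, ← mul_apply_eq_comp (CFC.abs A), h]
    rfl
  exact (sq_eq_sq₀ (norm_nonneg _) (norm_nonneg _)).1 h1

/-- An approximate polar decomposition. -/
theorem exists_contraction_mul_abs_near (A : E →L[ℂ] E) {ε : ℝ} (hε : 0 < ε) :
    ∃ W : E →L[ℂ] E, ‖W‖ ≤ 1 ∧ ‖A - W * CFC.abs A‖ ≤ ε := by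
  set T := CFC.abs A with hT
  have hT0 : 0 ≤ T := CFC.abs_nonneg A
  have hsa : IsSelfAdjoint T := .of_nonneg hT0
  have hsp : ∀ t ∈ spectrum ℝ T, 0 ≤ t := fun t ht => spectrum_nonneg_of_nonneg hT0 ht
  have hc : ContinuousOn (fun t : ℝ => (t + ε)⁻¹) (spectrum ℝ T) := by
    refine ContinuousOn.inv₀ (by fun_prop) fun t ht => ?_
    have := hsp t ht
    positivity
  -- `D` is `(|A| + ε)⁻¹`, so `W = A D` approximates the polar part and the error is exactly `ε A
  -- D`.
  set D := cfc (fun t : ℝ => (t + ε)⁻¹) T with hD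
  have hTD : T * D = cfc (fun t : ℝ => t * (t + ε)⁻¹) T := by
    rw [hD]; nth_rw 1 [← cfc_id' ℝ T]
    rw [← cfc_mul (fun t : ℝ => t) _ T continuousOn_id hc]
  have hDT : D * T = T * D := by
    rw [hTD, hD]; nth_rw 2 [← cfc_id' ℝ T]
    rw [← cfc_mul _ (fun t : ℝ => t) T hc continuousOn_id]
    congr 1; ext t; rw [mul_comm]
  have hone : T * D + ε • D = 1 := by
    rw [hTD, hD, ← cfc_const_mul ε (fun t : ℝ => (t + ε)⁻¹) T hc,
      ← cfc_add (a := T) (fun t : ℝ => t * (t + ε)⁻¹) (fun t : ℝ => ε * (t + ε)⁻¹)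
        (continuousOn_id.mul hc) (continuousOn_const.mul hc), ← cfc_one ℝ T]
    refine cfc_congr fun t ht => ?_
    have : t + ε ≠ 0 := by have := hsp t ht; positivity
    simp only [Pi.one_apply]
    field_simp
  have hnTD : ‖T * D‖ ≤ 1 := by
    rw [hTD]
    refine norm_cfc_le zero_le_one fun t ht => ?_
    have h0 := hsp t ht
    rw [Real.norm_of_nonneg (by positivity), ← div_eq_mul_inv, div_le_one (by positivity)]
    linarith
  have hW : ‖A * D‖ ≤ 1 := by
    refine ContinuousLinearMap.opNorm_le_bound _ zero_le_one fun x => ?_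
    rw [mul_apply_eq_comp, norm_apply_eq_norm_abs_apply, ← hT, ← mul_apply_eq_comp]
    exact (ContinuousLinearMap.le_opNorm _ _).trans
      (mul_le_mul_of_nonneg_right hnTD (norm_nonneg _))
  refine ⟨A * D, hW, ?_⟩
  have e : A - A * D * T = ε • (A * D) := by
    rw [mul_assoc, hDT, ← mul_smul_comm, eq_sub_of_add_eq' hone, mul_sub, mul_one]
  rw [e, norm_smul, Real.norm_of_nonneg hε.le]
  exact mul_le_of_le_one_right hε.le hW

/-- The estimate for `W T` with `T = |A|`, in the limit of approximate polar decompositions; the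
left side is a finite sum continuous in the operator. -/
theorem sum_norm_inner_rpow_le {Γ κ : Type*} [Fintype κ] (b : HilbertBasis Γ ℂ E)
    (A : E →L[ℂ] E) {p : ℝ} (hp : 1 < p) {h k : κ → E}
    (hh : Orthonormal ℂ h) (hk : Orthonormal ℂ k) :
    ∑ l, ENNReal.ofReal (‖inner ℂ (k l) (A (h l))‖ ^ p) ≤
      ∑' j, ENNReal.ofReal (inner ℂ (b j) ((absPow p A) (b j))).re := by
  have hex : ∀ n : ℕ, ∃ W : E →L[ℂ] E, ‖W‖ ≤ 1 ∧ ‖A - W * CFC.abs A‖ ≤ 1 / ((n : ℝ) + 1) :=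
    fun n => exists_contraction_mul_abs_near A (by positivity)
  choose W hW1 hW2 using hex
  have hlim : Tendsto (fun n => W n * CFC.abs A) atTop (𝓝 A) := by
    rw [tendsto_iff_norm_sub_tendsto_zero]
    refine squeeze_zero (fun _ => norm_nonneg _) (fun n => ?_)
      tendsto_one_div_add_atTop_nhds_zero_nat
    rw [norm_sub_rev]; exact hW2 n
  have hlim2 : Tendsto (fun n => ∑ l, ENNReal.ofReal
      (‖inner ℂ (k l) ((W n * CFC.abs A) (h l))‖ ^ p)) atTop
      (𝓝 (∑ l, ENNReal.ofReal (‖inner ℂ (k l) (A (h l))‖ ^ p))) := by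
    refine tendsto_finsetSum _ fun l _ => ?_
    have hcont : Continuous fun S : E →L[ℂ] E => ENNReal.ofReal (‖inner ℂ (k l) (S (h l))‖ ^ p) := by
      refine ENNReal.continuous_ofReal.comp ((Real.continuous_rpow_const (by linarith)).comp ?_)
      fun_prop
    exact (hcont.tendsto A).comp hlim
  exact le_of_tendsto' hlim2 fun n =>
    sum_norm_inner_contraction_rpow_le b (CFC.abs_nonneg A) (hW1 n) hp hh hk

end HilbertSpace

end SchurMultiplier

namespace SchurMultiplier
open Filter Topology

/-! ### Finite rank operators and lower semicontinuity of the trace -/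

section HilbertSpace

variable {E : Type*} [NormedAddCommGroup E] [InnerProductSpace ℂ E] [CompleteSpace E]
  {κ : Type*} [Fintype κ]

/-- The finite rank operator `∑ r, s r |g r⟩⟨h r|`. -/
def finiteRankOp (s : κ → ℝ) (g h : κ → E) : E →L[ℂ] E :=
  ∑ r, (s r : ℂ) • InnerProductSpace.rankOne ℂ (g r) (h r)

theorem finiteRankOp_apply (s : κ → ℝ) (g h : κ → E) (x : E) :
    finiteRankOp s g h x = ∑ r, ((s r : ℂ) * inner ℂ (h r) x) • g r := by
  simp [finiteRankOp, mul_smul]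

theorem star_finiteRankOp (s : κ → ℝ) (g h : κ → E) :
    star (finiteRankOp s g h) = finiteRankOp s h g := by
  simp [finiteRankOp, star_sum, ContinuousLinearMap.star_eq_adjoint,
    InnerProductSpace.adjoint_rankOne]

theorem finiteRankOp_apply_self (s : κ → ℝ) (g : κ → E) {h : κ → E} (hh : Orthonormal ℂ h)
    (r : κ) : finiteRankOp s g h (h r) = (s r : ℂ) • g r := by
  classical
  simp [finiteRankOp_apply, orthonormal_iff_ite.1 hh, ite_smul]

theorem star_mul_self_finiteRankOp (s : κ → ℝ) {g : κ → E} (h : κ → E) (hg : Orthonormal ℂ g) :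
    star (finiteRankOp s g h) * finiteRankOp s g h = finiteRankOp (fun r => s r ^ 2) h h := by
  ext x
  rw [star_finiteRankOp, mul_apply_eq_comp, finiteRankOp_apply s g h, map_sum, finiteRankOp_apply]
  refine Finset.sum_congr rfl fun r _ => ?_
  rw [map_smul, finiteRankOp_apply_self s h hg, smul_smul]
  push_cast
  congr 1
  ring

theorem norm_finiteRankOp_le {s : κ → ℝ} (hs : ∀ r, 0 ≤ s r) {c : ℝ} (hc0 : 0 ≤ c)
    (hc : ∀ r, s r ≤ c) {g h : κ → E} (hg : Orthonormal ℂ g) (hh : Orthonormal ℂ h) :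
    ‖finiteRankOp s g h‖ ≤ c := by
  refine ContinuousLinearMap.opNorm_le_bound _ hc0 fun x => ?_
  rw [← sq_le_sq₀ (norm_nonneg _) (by positivity), finiteRankOp_apply, mul_pow]
  have h1 : ‖∑ r, ((s r : ℂ) * inner ℂ (h r) x) • g r‖ ^ 2 =
      ∑ r, ‖(s r : ℂ) * inner ℂ (h r) x‖ ^ 2 := by
    have := hg.inner_sum (fun r => (s r : ℂ) * inner ℂ (h r) x)
      (fun r => (s r : ℂ) * inner ℂ (h r) x) Finset.univ
    rw [inner_self_eq_norm_sq_to_K] at this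
    have h2 := congrArg Complex.re this
    simp only [← Complex.normSq_eq_conj_mul_self, Complex.re_sum, Complex.ofReal_re,
      Complex.normSq_eq_norm_sq] at h2
    rw [← h2]
    norm_cast
  rw [h1]
  calc _ ≤ ∑ r, c ^ 2 * ‖inner ℂ (h r) x‖ ^ 2 := by
        refine Finset.sum_le_sum fun r _ => ?_
        rw [norm_mul, mul_pow, Complex.norm_real, Real.norm_of_nonneg (hs r)]
        gcongr
        · exact hs r
        · exact hc r
    _ ≤ c ^ 2 * ‖x‖ ^ 2 := by
        rw [← Finset.mul_sum]
        gcongr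
        exact hh.sum_inner_products_le x

theorem isSelfAdjoint_finiteRankOp (t : κ → ℝ) (h : κ → E) :
    IsSelfAdjoint (finiteRankOp t h h) :=
  star_finiteRankOp t h h

/-- The family consists of eigenvectors and its orthogonal complement is the kernel side, where `f 0
= 0` makes the calculus vanish. -/
theorem cfc_finiteRankOp {t : κ → ℝ} {h : κ → E} (hh : Orthonormal ℂ h) {f : ℝ → ℝ}
    (hf : Continuous f) (hf0 : f 0 = 0) :
    cfc f (finiteRankOp t h h) = finiteRankOp (fun r => f (t r)) h h := by
  have hsa := isSelfAdjoint_finiteRankOp t h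
  ext x
  set y := x - ∑ r, inner ℂ (h r) x • h r with hy
  have hperp : ∀ r, inner ℂ (h r) y = 0 := by
    intro r
    rw [hy, inner_sub_right, hh.inner_right_fintype, sub_self]
  have hxy : x = ∑ r, inner ℂ (h r) x • h r + y := by rw [hy]; abel
  have hky : finiteRankOp t h h y = ((0 : ℝ) : ℂ) • y := by
    simp [finiteRankOp_apply, hperp]
  have hc : ∀ r, cfc f (finiteRankOp t h h) (h r) = (f (t r) : ℂ) • h r := fun r =>
    cfc_apply_of_apply_eq_smul hsa hf (finiteRankOp_apply_self t h hh r)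
  nth_rw 1 [hxy]
  rw [map_add, cfc_apply_of_apply_eq_smul hsa hf hky, hf0, Complex.ofReal_zero, zero_smul,
    add_zero, map_sum, finiteRankOp_apply]
  refine Finset.sum_congr rfl fun r _ => ?_
  rw [map_smul, hc, smul_smul, mul_comm]

theorem absPow_finiteRankOp {p : ℝ} (hp : 0 < p) {s : κ → ℝ} (hs : ∀ r, 0 ≤ s r) {g h : κ → E}
    (hg : Orthonormal ℂ g) (hh : Orthonormal ℂ h) :
    absPow p (finiteRankOp s g h) = finiteRankOp (fun r => s r ^ p) h h := by
  rw [absPow_eq_cfc hp, star_mul_self_finiteRankOp s h hg,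
    cfc_finiteRankOp hh (Real.continuous_rpow_const (by positivity))
      (Real.zero_rpow (by positivity))]
  congr 1
  ext r
  rw [← Real.rpow_natCast, ← Real.rpow_mul (hs r)]
  congr 1
  push_cast
  ring

theorem sum_inner_finiteRankOp_le {Γ : Type*} {b : Γ → E} (hb : Orthonormal ℂ b) {t : κ → ℝ}
    (ht : ∀ r, 0 ≤ t r) {h : κ → E} (hh : Orthonormal ℂ h) (G : Finset Γ) :
    ∑ j ∈ G, (inner ℂ (b j) (finiteRankOp t h h (b j))).re ≤ ∑ r, t r := by
  have h1 : ∀ j, (inner ℂ (b j) (finiteRankOp t h h (b j))).re =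
      ∑ r, t r * ‖inner ℂ (b j) (h r)‖ ^ 2 := by
    intro j
    rw [finiteRankOp_apply, inner_sum, Complex.re_sum]
    refine Finset.sum_congr rfl fun r _ => ?_
    rw [inner_smul_right, mul_assoc, ← inner_conj_symm (h r) (b j),
      ← Complex.normSq_eq_conj_mul_self, Complex.normSq_eq_norm_sq, ← Complex.ofReal_mul,
      Complex.ofReal_re]
  simp only [h1]
  rw [Finset.sum_comm]
  refine Finset.sum_le_sum fun r _ => ?_
  rw [← Finset.mul_sum]
  refine mul_le_of_le_one_right (ht r) ((hb.sum_inner_products_le (h r)).trans ?_)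
  rw [hh.1 r, one_pow]

/-- Lower semicontinuity of the trace of `|·|^p` under strong convergence. -/
theorem tsum_inner_absPow_le_of_tendsto {Γ α : Type*} {l : Filter α} [l.NeBot] (b : Γ → E)
    {p : ℝ} (hp : 0 < p) {S : α → E →L[ℂ] E} {B : E →L[ℂ] E} {C : ℝ} (hC : ∀ i, ‖S i‖ ≤ C)
    (hBC : ‖B‖ ≤ C) (hS : ∀ x, Tendsto (fun i => S i x) l (𝓝 (B x)))
    (hS' : ∀ x, Tendsto (fun i => star (S i) x) l (𝓝 (star B x))) {K : ℝ}
    (hK : ∀ i, ∀ G : Finset Γ, ∑ j ∈ G, (inner ℂ (b j) (absPow p (S i) (b j))).re ≤ K) :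
    ∑' j, ENNReal.ofReal (inner ℂ (b j) (absPow p B (b j))).re ≤ ENNReal.ofReal K := by
  have hC0 : 0 ≤ C := (norm_nonneg _).trans hBC
  have hsq : ∀ U : E →L[ℂ] E, ‖U‖ ≤ C → ‖star U * U‖ ≤ C * C := by
    intro U hU
    refine (norm_mul_le _ _).trans ?_
    rw [norm_star]
    gcongr
  have hnn : ∀ U : E →L[ℂ] E, ∀ x, 0 ≤ (inner ℂ x (absPow p U x)).re := by
    intro U x
    have : 0 ≤ absPow p U := CFC.rpow_nonneg
    simpa using ((ContinuousLinearMap.nonneg_iff_isPositive _).1 this).re_inner_nonneg_right x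
  have hconv : ∀ x, Tendsto (fun i => absPow p (S i) x) l (𝓝 (absPow p B x)) := by
    intro x
    simp only [absPow_eq_cfc hp]
    refine tendsto_cfc_apply (C := C * C) (fun i => hsq _ (hC i)) (hsq _ hBC)
      (fun i => .star_mul_self _) (.star_mul_self _) (fun y => ?_)
      (Real.continuous_rpow_const (by positivity)) x
    simp only [mul_apply_eq_comp]
    -- Strong convergence of `S* S` needs that of the adjoints as well, because multiplication is
    -- strongly continuous only on bounded sets.
    exact tendsto_apply_of_norm_le (C := C) (fun i => by rw [norm_star]; exact hC i) hS' (hS y)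
  rw [ENNReal.tsum_eq_iSup_sum]
  refine iSup_le fun G => ?_
  rw [← ENNReal.ofReal_sum_of_nonneg fun j _ => hnn B (b j)]
  refine ENNReal.ofReal_le_ofReal ?_
  refine le_of_tendsto' (f := fun i => ∑ j ∈ G, (inner ℂ (b j) (absPow p (S i) (b j))).re)
    (x := l) (tendsto_finsetSum _ fun j _ => ?_) fun i => hK i G
  exact (Complex.continuous_re.tendsto _).comp (tendsto_const_nhds.inner (hconv (b j)))

end HilbertSpace

end SchurMultiplier

namespace SchurMultiplier
open Filter Topology Matrix

universe u

/-! ### Coordinates, compressions and bounded matrices on `ℓ²(Γ)` -/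

section EllTwo

variable {Γ : Type u}

/-- The canonical basis of `ℓ²(Γ)` as a Hilbert basis. -/
def canonicalBasis (Γ : Type u) : HilbertBasis Γ ℂ (EllTwo Γ) :=
  HilbertBasis.ofRepr (LinearIsometryEquiv.refl ℂ _)

theorem canonicalBasis_apply (j : Γ) : canonicalBasis Γ j = basisVec j := by
  classical
  have h := (canonicalBasis Γ).repr_symm_single j
  rw [← h, basisVec]
  have h2 : ∀ f : EllTwo Γ, (canonicalBasis Γ).repr.symm f = f := fun f => rfl
  rw [h2]

theorem orthonormal_basisVec : Orthonormal ℂ (basisVec : Γ → EllTwo Γ) := by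
  have h := (canonicalBasis Γ).orthonormal
  rwa [show ⇑(canonicalBasis Γ) = basisVec from funext canonicalBasis_apply] at h

theorem inner_basisVec (j : Γ) (x : EllTwo Γ) : inner ℂ (basisVec j) x = x j := by
  rw [← canonicalBasis_apply, ← HilbertBasis.repr_apply_apply]
  rfl

theorem positiveTrace_eq (T : EllTwo Γ →L[ℂ] EllTwo Γ) :
    positiveTrace T = ∑' j, ENNReal.ofReal (inner ℂ (basisVec j) (T (basisVec j))).re := by
  simp only [inner_basisVec]
  rfl

theorem basisVec_apply [DecidableEq Γ] (j k : Γ) : basisVec k j = if j = k then (1 : ℂ) else 0 := by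
  rw [← inner_basisVec, orthonormal_iff_ite.1 orthonormal_basisVec]

/-- The vector of `ℓ²(Γ)` supported in `F` with the given coordinates. -/
def finsetVec (F : Finset Γ) (c : F → ℂ) : EllTwo Γ := ∑ j : F, c j • basisVec j.1

theorem inner_finsetVec (F : Finset Γ) (c : F → ℂ) (x : EllTwo Γ) :
    inner ℂ (finsetVec F c) x = ∑ j : F, star (c j) * x j.1 := by
  simp [finsetVec, inner_basisVec, mul_comm]

open Classical in
theorem finsetVec_apply (F : Finset Γ) (c : F → ℂ) (j : Γ) :
    finsetVec F c j = if h : j ∈ F then c ⟨j, h⟩ else 0 := by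
  rw [← inner_basisVec, finsetVec, inner_sum]
  simp only [inner_smul_right, inner_basisVec, basisVec_apply]
  split_ifs with h
  · rw [Finset.sum_eq_single ⟨j, h⟩]
    · simp
    · intro b _ hb
      rw [if_neg, mul_zero]
      rintro rfl
      exact hb rfl
    · simp
  · refine Finset.sum_eq_zero fun b _ => ?_
    rw [if_neg, mul_zero]
    rintro rfl
    exact h b.2

variable {F : Finset Γ} {κ : Type*} [Fintype κ] [DecidableEq κ]

theorem orthonormal_finsetVec [DecidableEq Γ] {V : Matrix F κ ℂ} (hV : Vᴴ * V = 1) :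
    Orthonormal ℂ fun l => finsetVec F fun j => V j l := by
  rw [orthonormal_iff_ite]
  intro l m
  have h := congrFun (congrFun hV l) m
  rw [Matrix.mul_apply, Matrix.one_apply] at h
  rw [inner_finsetVec, ← h]
  refine Finset.sum_congr rfl fun j _ => ?_
  rw [conjTranspose_apply, finsetVec_apply, dif_pos j.2]

open Classical in
theorem finiteRankOp_finsetVec_apply (V W : Matrix F κ ℂ) (s : κ → ℝ) (x : EllTwo Γ) (j : Γ) :
    finiteRankOp s (fun l => finsetVec F fun i => V i l) (fun l => finsetVec F fun i => W i l) x j =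
      if h : j ∈ F then ∑ k : F, (V * diagonal (fun l => (s l : ℂ)) * Wᴴ) ⟨j, h⟩ k * x k.1
      else 0 := by
  rw [← inner_basisVec, finiteRankOp_apply, inner_sum]
  simp only [inner_smul_right, inner_basisVec, finsetVec_apply, inner_finsetVec]
  split_ifs with h
  · simp only [Matrix.mul_apply (N := Wᴴ), mul_diagonal, conjTranspose_apply, Finset.sum_mul,
      Finset.mul_sum]
    rw [Finset.sum_comm]
    refine Finset.sum_congr rfl fun k _ => Finset.sum_congr rfl fun l _ => ?_
    ring
  · simp

/-- The compression of an operator to the coordinates in `F`. -/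
def compress (F : Finset Γ) (A : EllTwo Γ →L[ℂ] EllTwo Γ) : Matrix F F ℂ :=
  Matrix.of fun j k => matrixEntry A j.1 k.1

theorem inner_finsetVec_apply_finsetVec (A : EllTwo Γ →L[ℂ] EllTwo Γ) (V W : Matrix F κ ℂ) (l : κ) :
    inner ℂ (finsetVec F fun i => V i l) (A (finsetVec F fun i => W i l)) =
      (Vᴴ * compress F A * W) l l := by
  rw [inner_finsetVec, Matrix.mul_assoc, Matrix.mul_apply]
  refine Finset.sum_congr rfl fun j _ => ?_
  rw [conjTranspose_apply, Matrix.mul_apply, finsetVec, map_sum, ← inner_basisVec, inner_sum]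
  congr 1
  refine Finset.sum_congr rfl fun k _ => ?_
  rw [map_smul, inner_smul_right, inner_basisVec, mul_comm]
  rfl

/-- The singular vectors of the compression, extended by zero, are orthonormal families in `ℓ²(Γ)`
on which the diagonal entries of `A` are the singular values. -/
theorem sum_singularValue_rpow_le [DecidableEq Γ] (A : EllTwo Γ →L[ℂ] EllTwo Γ) {p : ℝ}
    (hp : 1 < p) {V W : Matrix F κ ℂ} (hV : Vᴴ * V = 1) (hW : Wᴴ * W = 1) {a : κ → ℝ}
    (ha : ∀ l, 0 < a l) (hA : compress F A = V * diagonal (fun l => (a l : ℂ)) * Wᴴ) :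
    ∑ l, ENNReal.ofReal (a l ^ p) ≤ positiveTrace (absPow p A) := by
  have h := sum_norm_inner_rpow_le (canonicalBasis Γ) A hp (orthonormal_finsetVec hW)
    (orthonormal_finsetVec hV)
  simp only [canonicalBasis_apply] at h
  rw [← positiveTrace_eq] at h
  refine le_trans (le_of_eq (Finset.sum_congr rfl fun l _ => ?_)) h
  have e : Vᴴ * compress F A * W = diagonal (fun l => (a l : ℂ)) := by
    rw [hA, Matrix.mul_assoc, Matrix.mul_assoc, hW, Matrix.mul_one, ← Matrix.mul_assoc, hV,
      Matrix.one_mul]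
  rw [inner_finsetVec_apply_finsetVec, e, diagonal_apply_eq, Complex.norm_real,
    Real.norm_of_nonneg (ha l).le]

/-- The coordinate projection onto the span of the basis vectors in `F`. -/
def coordProj (F : Finset Γ) : EllTwo Γ →L[ℂ] EllTwo Γ :=
  finiteRankOp (fun _ : F => 1) (fun j => basisVec j.1) (fun j => basisVec j.1)

theorem coordProj_eq (F : Finset Γ) (x : EllTwo Γ) :
    coordProj F x = ∑ k ∈ F, x k • basisVec k := by
  rw [coordProj, finiteRankOp_apply, ← Finset.sum_coe_sort F]
  simp [inner_basisVec]

open Classical in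
theorem coordProj_apply (F : Finset Γ) (x : EllTwo Γ) (j : Γ) :
    coordProj F x j = if j ∈ F then x j else 0 := by
  rw [coordProj_eq, ← inner_basisVec, inner_sum]
  simp [inner_smul_right, inner_basisVec, basisVec_apply]

theorem norm_coordProj_le (F : Finset Γ) : ‖coordProj F‖ ≤ 1 := by
  have h : Orthonormal ℂ fun j : F => (basisVec j.1 : EllTwo Γ) :=
    orthonormal_basisVec.comp _ Subtype.val_injective
  exact norm_finiteRankOp_le (fun _ => zero_le_one) zero_le_one (fun _ => le_rfl) h h

theorem star_coordProj (F : Finset Γ) : star (coordProj F) = coordProj F :=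
  isSelfAdjoint_finiteRankOp _ _

theorem tendsto_coordProj_apply (x : EllTwo Γ) :
    Tendsto (fun F : Finset Γ => coordProj F x) atTop (𝓝 x) := by
  have h := (canonicalBasis Γ).hasSum_repr x
  simp only [coordProj_eq]
  refine h.congr fun F => ?_
  refine Finset.sum_congr rfl fun k _ => ?_
  rw [← canonicalBasis_apply]
  rfl

theorem eq_coordProj_mul_mul {c : Γ → Γ → ℂ} {B S : EllTwo Γ →L[ℂ] EllTwo Γ}
    (hB : ∀ j k, matrixEntry B j k = c j k) (F : Finset Γ) [DecidablePred (· ∈ F)]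
    (hS : ∀ x j, S x j = if j ∈ F then ∑ k ∈ F, c j k * x k else 0) :
    S = coordProj F * B * coordProj F := by
  classical
  ext x j
  rw [hS, mul_apply_eq_comp, mul_apply_eq_comp, coordProj_apply]
  split_ifs with h
  · rw [coordProj_eq, map_sum, ← inner_basisVec, inner_sum]
    refine Finset.sum_congr rfl fun k _ => ?_
    rw [map_smul, inner_smul_right, inner_basisVec, ← hB, mul_comm]
    rfl
  · rfl

/-- Lower semicontinuity of the trace along the compressions of an operator. -/
theorem positiveTrace_absPow_le_of_compressions {p : ℝ} (hp : 0 < p) (B : EllTwo Γ →L[ℂ] EllTwo Γ)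
    {K : ℝ} (hK : ∀ F G : Finset Γ, ∑ j ∈ G,
      (inner ℂ (basisVec j) (absPow p (coordProj F * B * coordProj F) (basisVec j))).re ≤ K) :
    positiveTrace (absPow p B) ≤ ENNReal.ofReal K := by
  have hconv : ∀ (D : EllTwo Γ →L[ℂ] EllTwo Γ) x, Tendsto
      (fun F : Finset Γ => (coordProj F * D * coordProj F) x) atTop (𝓝 (D x)) := by
    intro D x
    simp only [mul_apply_eq_comp]
    have h1 := (D.continuous.tendsto x).comp (tendsto_coordProj_apply x)
    exact tendsto_apply_of_norm_le (T := 1) norm_coordProj_le tendsto_coordProj_apply h1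
  rw [positiveTrace_eq]
  refine tsum_inner_absPow_le_of_tendsto (l := atTop) basisVec hp (C := ‖B‖) (fun F => ?_) le_rfl
    (hconv B) (fun x => ?_) hK
  · refine (norm_mul_le _ _).trans ((mul_le_of_le_one_right (norm_nonneg _)
      (norm_coordProj_le F)).trans ((norm_mul_le _ _).trans ?_))
    exact mul_le_of_le_one_left (norm_nonneg _) (norm_coordProj_le F)
  · simpa only [star_mul, star_coordProj, mul_assoc] using hconv (star B) x

/-- A matrix with square summable rows whose finite sections are uniformly bounded is the matrix
of a bounded operator. -/
theorem exists_matrixEntry_eq {c : Γ → Γ → ℂ} (hc : ∀ j, Memℓp (c j) 2) {R : ℝ}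
    {S : Finset Γ → EllTwo Γ →L[ℂ] EllTwo Γ} (hS : ∀ F, ‖S F‖ ≤ R)
    (hSc : ∀ F x, ∀ j ∈ F, S F x j = ∑ k ∈ F, c j k * x k) :
    ∃ B : EllTwo Γ →L[ℂ] EllTwo Γ, ∀ j k, matrixEntry B j k = c j k := by
  classical
  have hsum : ∀ (x : EllTwo Γ) j, Summable fun k => c j k * x k := by
    intro x j
    have h := lp.summable_inner (𝕜 := ℂ) (star (⟨c j, hc j⟩ : EllTwo Γ)) x
    refine h.congr fun k => ?_
    simp [mul_comm]
  have hlim : ∀ x : EllTwo Γ, Tendsto (fun F => (S F x : Γ → ℂ)) atTop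
      (𝓝 fun j => ∑' k, c j k * x k) := by
    intro x
    rw [tendsto_pi_nhds]
    intro j
    refine ((hsum x j).hasSum).congr' ?_
    filter_upwards [eventually_ge_atTop {j}] with F hF
    exact (hSc F x j (hF (Finset.mem_singleton_self j))).symm
  have hb : ∀ (x : EllTwo Γ) F, ‖S F x‖ ≤ R * ‖x‖ := fun x F =>
    ((S F).le_opNorm x).trans (mul_le_mul_of_nonneg_right (hS F) (norm_nonneg _))
  have hbdd : ∀ x : EllTwo Γ, Bornology.IsBounded (Set.range fun F => S F x) := fun x =>
    isBounded_iff_forall_norm_le.2 ⟨R * ‖x‖, by rintro _ ⟨F, rfl⟩; exact hb x F⟩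
  -- The finite sections converge coordinatewise and stay in a ball of `ℓ²`, so the limit sequence
  -- lies in `ℓ²` by Fatou.
  have hmem : ∀ x : EllTwo Γ, Memℓp (fun j => ∑' k, c j k * x k) 2 := fun x =>
    lp.memℓp_of_tendsto (hbdd x) (hlim x)
  let B₀ : EllTwo Γ →ₗ[ℂ] EllTwo Γ :=
    { toFun := fun x => ⟨fun j => ∑' k, c j k * x k, hmem x⟩
      map_add' := fun x y => by
        ext j
        change ∑' k, c j k * (x k + y k) = ∑' k, c j k * x k + ∑' k, c j k * y k
        simp only [mul_add]
        exact (hsum x j).tsum_add (hsum y j)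
      map_smul' := fun a x => by
        ext j
        change ∑' k, c j k * (a * x k) = a * ∑' k, c j k * x k
        simp only [mul_left_comm _ a]
        exact tsum_mul_left }
  refine ⟨B₀.mkContinuous R fun x => ?_, fun j k => ?_⟩
  · exact lp.norm_le_of_tendsto (Eventually.of_forall (hb x)) (hlim x)
  · change ∑' l, c j l * basisVec k l = c j k
    rw [tsum_eq_single k]
    · simp [basisVec_apply]
    · intro l hl
      simp [basisVec_apply, hl]

end EllTwo

end SchurMultiplier

namespace SchurMultiplier
open Filter Topology Matrix

universe u

/-! ### From finite sections to Schur multipliers on `S_p(Γ)` -/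

section Transfer

variable {Γ : Type u}

/-- The bound `∑ s ^ p ≤ K ∑ a ^ p` between the singular values of `M ∘ A` and of `A`. -/
def SingularValueBound {ι : Type u} [Fintype ι] (p K : ℝ) (m : ι → ι → ℂ) : Prop :=
  ∀ {κ κ' : Type u} [Fintype κ] [DecidableEq κ] [Fintype κ'] [DecidableEq κ']
    {V W : Matrix ι κ ℂ} (_ : Vᴴ * V = 1) (_ : Wᴴ * W = 1) {a : κ → ℝ} (_ : ∀ l, 0 < a l)
    {V' W' : Matrix ι κ' ℂ} (_ : V'ᴴ * V' = 1) (_ : W'ᴴ * W' = 1) {s : κ' → ℝ}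
    (_ : ∀ r, 0 < s r)
    (_ : schur m (V * diagonal (fun l => (a l : ℂ)) * Wᴴ) =
      V' * diagonal (fun r => (s r : ℂ)) * W'ᴴ),
    ∑ r, s r ^ p ≤ K * ∑ l, a l ^ p

theorem memℓp_row (A : EllTwo Γ →L[ℂ] EllTwo Γ) (j : Γ) : Memℓp (matrixEntry A j) 2 := by
  have h : matrixEntry A j = fun k => star ((star A (basisVec j) : EllTwo Γ) k) := by
    funext k
    rw [← inner_basisVec k, ContinuousLinearMap.star_eq_adjoint,
      ContinuousLinearMap.adjoint_inner_right, matrixEntry, ← inner_basisVec j, ← inner_conj_symm]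
    simp
  rw [h]
  exact (lp.memℓp (star A (basisVec j) : EllTwo Γ)).star_mem

/-- The section of the Schur product over `F` is realized from its singular value decomposition. Its
operator norm is the largest singular value at most, hence bounded by their `p`-sum to the power
`1/p`, uniformly in `F`. -/
theorem exists_finite_section {p K : ℝ} (hp : 1 < p) (hK : 0 ≤ K) {M : Γ → Γ → ℂ}
    (A : EllTwo Γ →L[ℂ] EllTwo Γ) (hA : positiveTrace (absPow p A) ≠ ∞) (F : Finset Γ)
    [DecidablePred (· ∈ F)] (hM : SingularValueBound p K fun j k : F => M j k) :
    ∃ S : EllTwo Γ →L[ℂ] EllTwo Γ,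
      ‖S‖ ≤ (K * (positiveTrace (absPow p A)).toReal) ^ (1 / p) ∧
      (∀ x j, S x j = if j ∈ F then ∑ k ∈ F, M j k * matrixEntry A j k * x k else 0) ∧
      ∀ G : Finset Γ, ∑ j ∈ G, (inner ℂ (basisVec j) (absPow p S (basisVec j))).re ≤
        K * (positiveTrace (absPow p A)).toReal := by
  classical
  have hp0 : 0 < p := by linarith
  set t := (positiveTrace (absPow p A)).toReal with ht
  obtain ⟨κ, _, _, V, W, a, hV, hW, ha, hAe⟩ := exists_singular_value_decomposition (compress F A)
  obtain ⟨κ', _, _, V', W', s, hV', hW', hs, hSe⟩ := exists_singular_value_decomposition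
    (schur (fun j k : F => M j k) (compress F A))
  have hat : ∑ l, a l ^ p ≤ t := by
    have h := sum_singularValue_rpow_le A hp hV hW ha hAe
    rw [← ENNReal.ofReal_sum_of_nonneg fun l _ => Real.rpow_nonneg (ha l).le p] at h
    exact (ENNReal.ofReal_le_iff_le_toReal hA).1 h
  have hst : ∑ r, s r ^ p ≤ K * t :=
    (hM hV hW ha hV' hW' hs (by rw [← hAe, hSe])).trans (mul_le_mul_of_nonneg_left hat hK)
  have hV'o := orthonormal_finsetVec hV'
  have hW'o := orthonormal_finsetVec hW'
  have hKt : 0 ≤ K * t := mul_nonneg hK ENNReal.toReal_nonneg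
  refine ⟨finiteRankOp s (fun l => finsetVec F fun i => V' i l)
    (fun l => finsetVec F fun i => W' i l), ?_, fun x j => ?_, fun G => ?_⟩
  · refine norm_finiteRankOp_le (fun r => (hs r).le) (Real.rpow_nonneg hKt _) (fun r => ?_) hV'o hW'o
    rw [one_div, Real.le_rpow_inv_iff_of_pos (hs r).le hKt hp0]
    exact (Finset.single_le_sum (fun i _ => Real.rpow_nonneg (hs i).le p)
      (Finset.mem_univ r)).trans hst
  · rw [finiteRankOp_finsetVec_apply, ← hSe]
    split_ifs with h
    · rw [← Finset.sum_coe_sort F]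
      rfl
    · rfl
  · rw [absPow_finiteRankOp hp0 (fun r => (hs r).le) hV'o hW'o]
    exact (sum_inner_finiteRankOp_le orthonormal_basisVec (fun r => Real.rpow_nonneg (hs r).le p)
      hW'o G).trans hst

/-- Boundedness of the symbol keeps the rows square summable, so the uniformly bounded sections
define an operator `B`; the sections are its compressions, and lower semicontinuity transfers the
trace bound. -/
theorem exists_isSchurProduct {p K : ℝ} (hp : 1 < p) (hK : 0 ≤ K) {M : Γ → Γ → ℂ} {D : ℝ}
    (hD : ∀ j k, ‖M j k‖ ≤ D) (hM : ∀ F : Finset Γ, SingularValueBound p K fun j k : F => M j k)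
    (A : EllTwo Γ →L[ℂ] EllTwo Γ) (hA : positiveTrace (absPow p A) ≠ ∞) :
    ∃ B, IsSchurProduct M A B ∧
      positiveTrace (absPow p B) ≤ ENNReal.ofReal K * positiveTrace (absPow p A) := by
  classical
  choose S hS1 hS2 hS3 using fun F => exists_finite_section hp hK A hA F (hM F)
  have hrow : ∀ j, Memℓp (fun k => M j k * matrixEntry A j k) 2 := by
    intro j
    have h : Memℓp (fun k => D * ‖matrixEntry A j k‖) 2 := (memℓp_row A j).norm.const_mul D
    refine h.mono fun k => ?_
    rw [norm_mul]
    exact mul_le_mul_of_nonneg_right (hD j k) (norm_nonneg _)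
  obtain ⟨B, hB⟩ := exists_matrixEntry_eq hrow hS1 fun F x j hj => by rw [hS2, if_pos hj]
  refine ⟨B, hB, ?_⟩
  have h := positiveTrace_absPow_le_of_compressions (by linarith : 0 < p) B
    (K := K * (positiveTrace (absPow p A)).toReal) fun F G => by
      rw [← eq_coordProj_mul_mul hB F (hS2 F)]
      exact hS3 F G
  rwa [ENNReal.ofReal_mul hK, ENNReal.ofReal_toReal hA] at h

theorem schurBoundedBy_of_singularValueBound {p K : ℝ} (hp : 1 < p) (hK : 0 ≤ K)
    {M : Γ → Γ → ℂ} {D : ℝ} (hD : ∀ j k, ‖M j k‖ ≤ D)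
    (hM : ∀ F : Finset Γ, SingularValueBound p K fun j k : F => M j k) :
    SchurBoundedBy p M (K ^ (1 / p)).toNNReal := by
  have hp0 : 0 < p := by linarith
  have hex : ∀ A : schattenClass Γ p, ∃ B : schattenClass Γ p, IsSchurProduct M A.1 B.1 ∧
      schattenNorm p B.1 ≤ (K ^ (1 / p)).toNNReal * schattenNorm p A.1 := by
    rintro ⟨A, hA⟩
    have hA' : positiveTrace (absPow p A) ≠ ∞ := by
      rintro h
      rw [schattenClass, Set.mem_ofPred_eq, schattenNorm, h,
        ENNReal.top_rpow_of_pos (by positivity)] at hA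
      exact lt_irrefl _ hA
    obtain ⟨B, hB, hBA⟩ := exists_isSchurProduct hp hK hD hM A hA'
    have hle : schattenNorm p B ≤ (K ^ (1 / p)).toNNReal * schattenNorm p A := by
      have h := ENNReal.rpow_le_rpow hBA (by positivity : 0 ≤ 1 / p)
      rw [ENNReal.mul_rpow_of_nonneg _ _ (by positivity),
        ENNReal.ofReal_rpow_of_nonneg hK (by positivity)] at h
      exact h
    exact ⟨⟨B, hle.trans_lt (ENNReal.mul_lt_top ENNReal.coe_lt_top hA)⟩, hB, hle⟩
  choose S hS using hex
  exact ⟨S, fun A => (hS A).1, fun A => (hS A).2⟩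

theorem exists_singularValueBound {p : ℝ} (hp : 1 < p) : ∃ K : ℝ, 0 ≤ K ∧
    ∀ {ι : Type u} [Fintype ι] {𝕜 : Type*} [RCLike 𝕜] {H : Type*}
      [NormedAddCommGroup H] [InnerProductSpace 𝕜 H] (u u' w w' : ι → H) (Λ : H →L[𝕜] H)
      (_ : ‖Λ‖ ≤ 1), SingularValueBound p K (grothendieckSymbol u u' w w' Λ) := by
  -- The dyadic exponent is taken above both `p` and its conjugate, as interpolation requires.
  obtain ⟨k, hk⟩ := pow_unbounded_of_one_lt (max p (p / (p - 1))) (one_lt_two (α := ℝ))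
  have hk' : (2 : ℝ) ^ k ≤ 2 ^ (k + 1) := pow_le_pow_right₀ one_le_two (Nat.le_succ k)
  obtain ⟨C, hC, h⟩ := schattenPow_grothendieckSymbol_le k
  obtain ⟨K, hK, hb⟩ := exists_interpolation_const k hp
    ((le_max_left _ _).trans_lt (hk.trans_le hk'))
    ((le_max_right _ _).trans_lt (hk.trans_le hk')) hC
  refine ⟨K, hK, ?_⟩
  intro ι _ 𝕜 _ H _ _ u u' w w' Λ hΛ κ κ' _ _ _ _ V W hV hW a ha V' W' hV' hW' s hs he
  classical
  refine hb _ (h u u' w w' Λ hΛ) (fun A => ?_) hV hW ha hV' hW' hs he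
  -- Transposing the symbol only exchanges `u` with `u'` and `w` with `w'`, so the same bound serves
  -- for the dual estimate.
  have e : (fun i j => grothendieckSymbol u u' w w' Λ j i) = grothendieckSymbol u' u w' w Λ := by
    funext i j
    simp only [grothendieckSymbol, add_comm]
  rw [e]
  exact h u' u w' w Λ hΛ A

theorem norm_map_complex_le {𝕜 : Type*} [RCLike 𝕜] (z : 𝕜) : ‖RCLike.map 𝕜 ℂ z‖ ≤ ‖z‖ + ‖z‖ := by
  rw [RCLike.map_apply]
  refine (norm_add_le _ _).trans (add_le_add ?_ ?_)
  · simpa using RCLike.abs_re_le_norm z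
  · simpa using RCLike.abs_im_le_norm z

theorem norm_grothendieckSymbol_le {𝕜 : Type*} [RCLike 𝕜] {H : Type*} [NormedAddCommGroup H]
    [InnerProductSpace 𝕜 H] (u u' w w' : Γ → H) (Λ : H →L[𝕜] H) (hΛ : ‖Λ‖ ≤ 1) (j k : Γ) :
    ‖grothendieckSymbol u u' w w' Λ j k‖ ≤ 2 := by
  have hu : ∀ x : H, ‖((‖x‖⁻¹ : ℝ) : 𝕜) • x‖ ≤ 1 := by
    intro x
    rw [norm_smul, RCLike.norm_ofReal, abs_of_nonneg (by positivity)]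
    exact inv_mul_le_one
  have h : ∀ x y : H, ‖x‖ ≤ 1 → ‖y‖ ≤ 1 → ‖inner 𝕜 x (Λ y)‖ ≤ 1 := by
    intro x y hx hy
    refine (norm_inner_le_norm _ _).trans (mul_le_one₀ hx (norm_nonneg _) ?_)
    exact (Λ.le_opNorm y).trans (mul_le_one₀ hΛ (norm_nonneg _) hy)
  refine (norm_map_complex_le _).trans ?_
  have := h _ _ (hu (u j + u' k)) (hu (w j + w' k))
  linarith

/-- The constant is fixed before the index set, the Hilbert space and the vectors; this uniformity
is what yields complete boundedness. -/
theorem schurBoundedBy_grothendieckSymbol {p : ℝ} (hp : 1 < p) : ∃ C : ℝ≥0,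
    ∀ {Γ : Type u} {𝕜 : Type*} [RCLike 𝕜] {H : Type*} [NormedAddCommGroup H]
      [InnerProductSpace 𝕜 H] (u u' w w' : Γ → H) (Λ : H →L[𝕜] H) (_ : ‖Λ‖ ≤ 1),
      SchurBoundedBy p (grothendieckSymbol u u' w w' Λ) C := by
  obtain ⟨K, hK, h⟩ := exists_singularValueBound hp
  exact ⟨_, fun u u' w w' Λ hΛ => schurBoundedBy_of_singularValueBound hp hK
    (norm_grothendieckSymbol_le u u' w w' Λ hΛ)
    fun F => h (fun j : F => u j) (fun j => u' j) (fun j => w j) (fun j => w' j) Λ hΛ⟩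

end Transfer

end SchurMultiplier

end

/-- The amplified symbol is the Grothendieck symbol of the families pulled back along `Γ × ι → Γ`,
so the uniform bound applies to it verbatim. -/
theorem mainTheorem8 {𝕜 : Type*} [RCLike 𝕜] {H : Type*} [NormedAddCommGroup H]
    [InnerProductSpace 𝕜 H] [CompleteSpace H] {Γ : Type*} (u u' w w' : Γ → H)
    (Λ : H →L[𝕜] H) (hΛ : ‖Λ‖ ≤ 1) (p : ℝ) (hp : 1 < p) :
    IsCompletelyBoundedSchurMultiplier p (grothendieckSymbol u u' w w' Λ) := by
  obtain ⟨C, hC⟩ := SchurMultiplier.schurBoundedBy_grothendieckSymbol hp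
  refine ⟨⟨C, hC u u' w w' Λ hΛ⟩, C, fun ι _ => ?_⟩
  exact hC (fun x : Γ × ι => u x.1) (fun x => u' x.1) (fun x => w x.1) (fun x => w' x.1) Λ hΛ
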